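/- Let $0<\beta\le 1$ and let $(\Omega,\mathcal A,\mathbb P)$ be a probability space. For every $n\ge 1$ let $(\tilde a_n(i,j))_{1\le i,j\le n}$ be real random variables on $\Omega$ that are Curie–Weiss$(\beta,n^2)$-distributed, i.e. for all $y=(y_{ij})\in\{-1,1\}^{n\times n}$, $$\mathbb P\big(\tilde a_n(i,j)=y_{ij}\ \forall i,j\big)=\frac1{Z_{\beta,n^2}}\exp\Big(\frac{\beta}{2n^2}\Big(\sum_{i,j}y_{ij}\Big)^2\Big),$$ where $Z_{\beta,n^2}$ is the normalization constant (the sum of the exponentials over all $y$). No assumption is made on the joint law for different $n$. Put $a_n(i,j)=\tilde a_n(i,j)$ for $i\le j$ and $a_n(i,j)=\tilde a_n(j,i)$ for $i>j$. For $n\ge 1$, an $n$-bandwidth is a number $b_n$ that is either $n$ or an odd natural number smaller than $n$. A pair $(i,j)\in\{1,\dots,n\}^2$ is $b_n$-relevant if $b_n=n$, or $|i-j|\le\frac{b_n-1}2$, or $|i-j|\ge n-\frac{b_n-1}2$. For a sequence $b=(b_n)_n$ of $n$-bandwidths let $X_n$ be the symmetric $n\times n$ matrix with $X_n(i,j)=b_n^{-1/2}a_n(i,j)$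 if $(i,j)$ is $b_n$-relevant and $X_n(i,j)=0$ otherwise. Let $\sigma_n=\frac1n\sum_{i=1}^n\delta_{\lambda_i}$, where $\lambda_1,\dots,\lambda_n$ are the eigenvalues of $X_n$ with multiplicity, and let $\sigma$ be the semicircle distribution, with Lebesgue density $\frac1{2\pi}\sqrt{4-x^2}\,\mathbf 1_{[-2,2]}(x)$. The semicircle law holds for $(X_n)_n$ in probability (almost surely) if for every bounded continuous $f:\mathbb R\to\mathbb R$ one has $\int f\,d\sigma_n\to\int f\,d\sigma$ in probability (almost surely) as $n\to\infty$. Then the following hold. (i) $(a_n)_n$ is $\frac12$-almost uncorrelated: there are real constants $(C_k)_k$ and $(C_n^{(l)})_{n,l}$ with $\lim_{n\to\infty}C^{(l)}_n=0$ for each $l$ such that for all $N,l\ge1$, all pairs $(p_1,q_1),\dots,(p_l,q_l)\in\{1,\dots,N\}^2$ for which the sets $\{p_i,q_i\}$ are pairwise distinct, and all $n\ge N$: for all integers $\delta_1,\dots,\delta_l\ge1$ the expectation below exists and $$\big|\mathbb E\,a_n(p_1,q_1)^{\delta_1}\cdots a_n(p_l,q_l)^{\delta_l}\big|\le \frac{C_{\delta_1+\dots+\delta_l}}{n^{\frac12\#\{i:\delta_i=1\}}},$$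 and $$\big|\mathbb E\,a_n(p_1,q_1)^2\cdots a_n(p_l,q_l)^2-1\big|\le C_n^{(l)}.$$ (ii) If $b_n\to\infty$, then the semicircle law holds for $(X_n)_n$ in probability. (iii) If $\sum_n b_n^{-3}<\infty$, then the semicircle law holds for $(X_n)_n$ almost surely. In particular, it holds almost surely for full matrices ($b_n=n$). -/

import Mathlib

open MeasureTheory Filter Topology
open scoped BoundedContinuousFunction ENNReal

noncomputable section

namespace CurieWeissBand

/-! ### Curie-Weiss distribution -/

/-- All spin configurations `y : ι → {-1, 1}`. -/
def spinConfigs (ι : Type*) [Fintype ι] [DecidableEq ι] : Finset (ι → ℝ) :=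
  Fintype.piFinset fun _ => ({-1, 1} : Finset ℝ)

/-- The Boltzmann weight `exp (β / (2 n) * (∑ y_i)²)`, where `n` is the number of spins. -/
def curieWeissWeight {ι : Type*} [Fintype ι] (β : ℝ) (y : ι → ℝ) : ℝ :=
  Real.exp (β / (2 * (Fintype.card ι : ℝ)) * (∑ i, y i) ^ 2)

/-- The normalization constant `Z_{β,n}`. -/
def curieWeissZ (ι : Type*) [Fintype ι] [DecidableEq ι] (β : ℝ) : ℝ :=
  ∑ y ∈ spinConfigs ι, curieWeissWeight β y

/-- The family `(Y_i)_{i ∈ ι}` is Curie-Weiss(`β`, `n`)-distributed, `n` the cardinality of `ι`. -/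
def IsCurieWeiss {Ω : Type*} [MeasurableSpace Ω] {ι : Type*} [Fintype ι] [DecidableEq ι]
    (β : ℝ) (Y : ι → Ω → ℝ) (μ : Measure Ω) : Prop :=
  (∀ i, Measurable (Y i)) ∧
    ∀ y ∈ spinConfigs ι,
      μ {ω | ∀ i, Y i ω = y i} = ENNReal.ofReal (curieWeissWeight β y / curieWeissZ ι β)

/-! ### Triangular schemes -/

/-- A triangular scheme: for each `n`, a symmetric `n × n` matrix of real random variables. -/
structure IsTriangularScheme {Ω : Type*} [MeasurableSpace Ω]
    (a : (n : ℕ) → Fin n → Fin n → Ω → ℝ) : Prop where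
  measurable : ∀ n i j, Measurable (a n i j)
  symm : ∀ n i j ω, a n i j ω = a n j i ω

/-- The pairs `P_1, …, P_l` are fundamentally different: they are distinct as unordered pairs. -/
def FundamentallyDifferent {l N : ℕ} (P : Fin l → Fin N × Fin N) : Prop :=
  ∀ i j, i ≠ j → s((P i).1, (P i).2) ≠ s((P j).1, (P j).2)

/-- The product `a_n(p_1,q_1)^{δ_1} ⋯ a_n(p_l,q_l)^{δ_l}` for pairs in `{1,…,N}²` and `n ≥ N`. -/
def entryProd {Ω : Type*} (a : (n : ℕ) → Fin n → Fin n → Ω → ℝ) {l N n : ℕ} (h : N ≤ n)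
    (P : Fin l → Fin N × Fin N) (δ : Fin l → ℕ) (ω : Ω) : ℝ :=
  ∏ i, a n (Fin.castLE h (P i).1) (Fin.castLE h (P i).2) ω ^ δ i

/-- `α`-almost uncorrelated triangular schemes. The existence of the expectations involved is
part of the notion. -/
def IsAlmostUncorrelated {Ω : Type*} [MeasurableSpace Ω] (μ : Measure Ω) (α : ℝ)
    (a : (n : ℕ) → Fin n → Fin n → Ω → ℝ) : Prop :=
  IsTriangularScheme a ∧
    ∃ (C : ℕ → ℝ) (C' : ℕ → ℕ → ℝ),
      (∀ l, Tendsto (C' l) atTop (𝓝 0)) ∧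
      ∀ (N l : ℕ), 1 ≤ N → 1 ≤ l → ∀ P : Fin l → Fin N × Fin N, FundamentallyDifferent P →
        (∀ δ : Fin l → ℕ, (∀ i, 1 ≤ δ i) → ∀ (n : ℕ) (h : N ≤ n),
          Integrable (entryProd a h P δ) μ ∧
          |∫ ω, entryProd a h P δ ω ∂μ| ≤
            C (∑ i, δ i) / (n : ℝ) ^ (α * ((Finset.univ.filter fun i => δ i = 1).card : ℝ))) ∧
        (∀ (n : ℕ) (h : N ≤ n),
          |(∫ ω, entryProd a h P (fun _ => 2) ω ∂μ) - 1| ≤ C' l n)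

/-- The scheme obtained by reflecting the upper triangle of `a'` at the diagonal. -/
def symmetrize {Ω : Type*} (a' : (n : ℕ) → Fin n × Fin n → Ω → ℝ) :
    (n : ℕ) → Fin n → Fin n → Ω → ℝ :=
  fun n i j ω => if i ≤ j then a' n (i, j) ω else a' n (j, i) ω

/-! ### Periodic band matrices -/

/-- `b` is an `n`-bandwidth: an odd number smaller than `n`, or `n` itself. -/
def IsBandwidth (n b : ℕ) : Prop := (b < n ∧ Odd b) ∨ b = n

/-- `b`-relevant index pairs. For `b < n` the number `b` is odd, so the integer division
`(b - 1) / 2` is exact. -/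
def Relevant {n : ℕ} (b : ℕ) (i j : Fin n) : Prop :=
  b = n ∨ |(i : ℤ) - (j : ℤ)| ≤ ((b : ℤ) - 1) / 2 ∨
    (n : ℤ) - ((b : ℤ) - 1) / 2 ≤ |(i : ℤ) - (j : ℤ)|

instance {n : ℕ} (b : ℕ) (i j : Fin n) : Decidable (Relevant b i j) := by
  unfold Relevant; infer_instance

/-- The periodic random band matrices based on `a` with bandwidth `b`. -/
def bandMatrix {Ω : Type*} (a : (n : ℕ) → Fin n → Fin n → Ω → ℝ) (b : ℕ → ℕ) (n : ℕ) (ω : Ω) :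
    Matrix (Fin n) (Fin n) ℝ :=
  Matrix.of fun i j => 1 / Real.sqrt (b n) * (if Relevant (b n) i j then a n i j ω else 0)

/-! ### Empirical spectral distribution and the semicircle law -/

/-- The empirical spectral distribution `(1/n) ∑ δ_{λ_i}` of a real symmetric matrix. -/
def esd {n : ℕ} {A : Matrix (Fin n) (Fin n) ℝ} (hA : A.IsHermitian) : Measure ℝ :=
  (n : ℝ≥0∞)⁻¹ • ∑ i, Measure.dirac (hA.eigenvalues i)

/-- The semicircle distribution. -/
def semicircle : Measure ℝ :=
  volume.withDensity fun x => ENNReal.ofReal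
    ((Set.Icc (-2 : ℝ) 2).indicator (fun x => 1 / (2 * Real.pi) * Real.sqrt (4 - x ^ 2)) x)

/-- The semicircle law holds in probability for the random symmetric matrices `X_n`. -/
def SemicircleLawInProbability {Ω : Type*} [MeasurableSpace Ω] (μ : Measure Ω)
    (X : (n : ℕ) → Ω → Matrix (Fin n) (Fin n) ℝ) (hX : ∀ n ω, (X n ω).IsHermitian) : Prop :=
  ∀ f : ℝ →ᵇ ℝ, TendstoInMeasure μ (fun n ω => ∫ x, f x ∂(esd (hX n ω))) atTop
    (fun _ => ∫ x, f x ∂semicircle)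

/-- The semicircle law holds almost surely for the random symmetric matrices `X_n`. -/
def SemicircleLawAlmostSurely {Ω : Type*} [MeasurableSpace Ω] (μ : Measure Ω)
    (X : (n : ℕ) → Ω → Matrix (Fin n) (Fin n) ℝ) (hX : ∀ n ω, (X n ω).IsHermitian) : Prop :=
  ∀ f : ℝ →ᵇ ℝ, ∀ᵐ ω ∂μ, Tendsto (fun n => ∫ x, f x ∂(esd (hX n ω))) atTop
    (𝓝 (∫ x, f x ∂semicircle))

/-! ### Symmetry of the matrices -/

theorem symmetrize_symm {Ω : Type*} (a' : (n : ℕ) → Fin n × Fin n → Ω → ℝ) (n : ℕ)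
    (i j : Fin n) (ω : Ω) : symmetrize a' n i j ω = symmetrize a' n j i ω := by
  unfold symmetrize
  rcases lt_trichotomy i j with h | h | h
  · simp [h.le, not_le.mpr h]
  · simp [h]
  · simp [h.le, not_le.mpr h]

theorem relevant_comm {n : ℕ} (b : ℕ) (i j : Fin n) : Relevant b i j ↔ Relevant b j i := by
  unfold Relevant; rw [abs_sub_comm]

theorem bandMatrix_isHermitian {Ω : Type*} (a' : (n : ℕ) → Fin n × Fin n → Ω → ℝ) (b : ℕ → ℕ)
    (n : ℕ) (ω : Ω) : (bandMatrix (symmetrize a') b n ω).IsHermitian := by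
  ext i j
  simp only [bandMatrix, Matrix.conjTranspose_apply, Matrix.of_apply, star_trivial]
  rw [symmetrize_symm a' n j i ω]
  simp only [relevant_comm (b n) j i]

end CurieWeissBand

end

open MeasureTheory Filter Topology
open scoped BoundedContinuousFunction ENNReal

noncomputable section

namespace CurieWeissBand

/-! ### Expectations in the Curie-Weiss model -/

section Expectation

variable {ι : Type*} [Fintype ι] [DecidableEq ι]
variable {E : Type*} [AddCommGroup E] [Module ℝ E]

/-! Let N = n² be the number of spins and S their sum. Conditioning on all spins but one gives the
exact integration by parts `cwExp_spin_smul`, whose drift is tanh(β/N · cavity sum). Apply it to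
powers of S. Even for β = 1 the linear part of tanh at most reproduces the left side, and the cubic
deficit -u³/6 is left over; it forces E|S|^(2m+4) ≲ N³ E(1+|S|)^(2m), hence E|S|^r ≲ N^(3r/4)
uniformly in β ≤ 1 (`cwExp_total_spin_pow`). Exchangeability ties a product of k + 1 spins to
products of fewer spins times one more factor S, and every additional spin gains N^(-1/4).
Correlations of k spins are thus O(N^(-k/4)) = O(n^(-k/2)) (`abs_cwExp_prod_mul_total_le`), which is
(i); squares of spins are exactly 1.

The semicircle law uses resolvents G = (X - iη)⁻¹ with η ≥ 2, and of the spins only integration by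
parts and the sixth moment of S. Let H_i be the average of G_jj over the b indices relevant to i.
The error W_i = (iη + H_i) G_ii + 1 is a sum over the b spins of row i. In E|W_i|⁶ each spin is
integrated by parts against conj(W_i)|W_i|⁴; the main term of the derivative of G_ji cancels the
contribution of H_i G_ii. Since ∑_j |G_ij|² ≤ η⁻², the remainders add up to order b^(-1/2)|W|⁵ +
b⁻¹|W|⁴ + (|S|/N)|W|⁵, up to shifts of |W| by O(b^(-1/2)). Young's inequality and E(|S|/N)⁶ ≲ n⁻³ ≤
b⁻³ give E|W_i|⁶ ≲ b⁻³ (`cwExp_norm_selfErr_pow_six_le`). For η ≥ 2 the self-consistent equation is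
contractive, so the Stieltjes transform at iη is close to the semicircle one, with sixth moment
O(b⁻³) (`cwExp_norm_stieltjes_sub_le`). Markov's inequality gives (ii), and Borel-Cantelli gives
(iii).

Stieltjes transforms at iη, η ≥ 2, determine weak convergence: by Stone-Weierstrass on the one-point
compactification they control all its continuous functions, and no mass escapes because the limit is
a compactly supported probability measure. This is proved along an arbitrary filter
(`tendsto_integral_semicircle`), so that one deterministic statement serves both modes of
convergence. -/

/-- The expectation of `F` under the Curie-Weiss distribution. -/
def cwExp (β : ℝ) (F : (ι → ℝ) → E) : E :=
  (curieWeissZ ι β)⁻¹ • ∑ y ∈ spinConfigs ι, curieWeissWeight β y • F y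

theorem mem_spinConfigs {y : ι → ℝ} : y ∈ spinConfigs ι ↔ ∀ i, y i = -1 ∨ y i = 1 := by
  simp [spinConfigs, Fintype.mem_piFinset]

theorem spin_sq {y : ι → ℝ} (hy : y ∈ spinConfigs ι) (i : ι) : y i ^ 2 = 1 := by
  rcases mem_spinConfigs.1 hy i with h | h <;> simp [h]

theorem abs_spin {y : ι → ℝ} (hy : y ∈ spinConfigs ι) (i : ι) : |y i| = 1 := by
  rcases mem_spinConfigs.1 hy i with h | h <;> simp [h]

theorem curieWeissWeight_pos {ι : Type*} [Fintype ι] (β : ℝ) (y : ι → ℝ) : 0 < curieWeissWeight β y :=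
  Real.exp_pos _

theorem spinConfigs_nonempty : (spinConfigs ι).Nonempty :=
  ⟨fun _ => 1, mem_spinConfigs.2 fun _ => Or.inr rfl⟩

theorem curieWeissZ_pos (ι : Type*) [Fintype ι] [DecidableEq ι] (β : ℝ) : 0 < curieWeissZ ι β :=
  Finset.sum_pos (fun y _ => curieWeissWeight_pos β y) spinConfigs_nonempty

theorem cwExp_congr {β : ℝ} {F F' : (ι → ℝ) → E} (h : ∀ y ∈ spinConfigs ι, F y = F' y) :
    cwExp β F = cwExp β F' := by
  unfold cwExp
  rw [Finset.sum_congr rfl fun y hy => by rw [h y hy]]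

theorem cwExp_add (β : ℝ) (F F' : (ι → ℝ) → E) :
    cwExp β (fun y => F y + F' y) = cwExp β F + cwExp β F' := by
  simp [cwExp, Finset.sum_add_distrib]

theorem cwExp_sub (β : ℝ) (F F' : (ι → ℝ) → E) :
    cwExp β (fun y => F y - F' y) = cwExp β F - cwExp β F' := by
  simp [cwExp, Finset.sum_sub_distrib, smul_sub]

theorem cwExp_smul (β c : ℝ) (F : (ι → ℝ) → E) :
    cwExp β (fun y => c • F y) = c • cwExp β F := by
  simp only [cwExp, Finset.smul_sum]
  exact Finset.sum_congr rfl fun y _ => by simp only [smul_smul]; ring_nf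

theorem cwExp_mul_left (β c : ℝ) (F : (ι → ℝ) → ℝ) :
    cwExp β (fun y => c * F y) = c * cwExp β F := by
  simpa using cwExp_smul β c F

theorem cwExp_sum {κ : Type*} (s : Finset κ) (β : ℝ) (F : κ → (ι → ℝ) → E) :
    cwExp β (fun y => ∑ k ∈ s, F k y) = ∑ k ∈ s, cwExp β (F k) := by
  simp only [cwExp, Finset.smul_sum]
  rw [Finset.sum_comm]

theorem cwExp_mono {β : ℝ} {F F' : (ι → ℝ) → ℝ} (h : ∀ y ∈ spinConfigs ι, F y ≤ F' y) :
    cwExp β F ≤ cwExp β F' := by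
  unfold cwExp
  refine smul_le_smul_of_nonneg_left (Finset.sum_le_sum fun y hy => ?_)
    (inv_nonneg.2 (curieWeissZ_pos ι β).le)
  exact smul_le_smul_of_nonneg_left (h y hy) (curieWeissWeight_pos β y).le

theorem cwExp_const (β : ℝ) (c : ℝ) : cwExp β (fun _ : ι → ℝ => c) = c := by
  simp only [cwExp, smul_eq_mul, ← Finset.sum_mul]
  rw [← mul_assoc]
  change (curieWeissZ ι β)⁻¹ * curieWeissZ ι β * c = c
  rw [inv_mul_cancel₀ (curieWeissZ_pos ι β).ne', one_mul]

theorem cwExp_nonneg {β : ℝ} {F : (ι → ℝ) → ℝ} (h : ∀ y ∈ spinConfigs ι, 0 ≤ F y) :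
    0 ≤ cwExp β F := by
  simpa [cwExp_const] using cwExp_mono (β := β) h

theorem norm_cwExp_le {V : Type*} [NormedAddCommGroup V] [NormedSpace ℝ V] (β : ℝ)
    (F : (ι → ℝ) → V) : ‖cwExp β F‖ ≤ cwExp β fun y => ‖F y‖ := by
  unfold cwExp
  rw [norm_smul, Real.norm_of_nonneg (inv_nonneg.2 (curieWeissZ_pos ι β).le), smul_eq_mul]
  refine mul_le_mul_of_nonneg_left ((norm_sum_le _ _).trans (le_of_eq ?_))
    (inv_nonneg.2 (curieWeissZ_pos ι β).le)
  exact Finset.sum_congr rfl fun y _ => by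
    rw [norm_smul, Real.norm_of_nonneg (curieWeissWeight_pos β y).le, smul_eq_mul]

theorem abs_cwExp_le (β : ℝ) (F : (ι → ℝ) → ℝ) : |cwExp β F| ≤ cwExp β fun y => |F y| :=
  norm_cwExp_le β F

/-- Cauchy-Schwarz against the constant function. -/
theorem cwExp_sq_le (β : ℝ) (F : (ι → ℝ) → ℝ) :
    cwExp β F ^ 2 ≤ cwExp β fun y => F y ^ 2 := by
  have h : 0 ≤ cwExp β fun y => (F y - cwExp β F) ^ 2 := cwExp_nonneg fun y _ => sq_nonneg _
  have e : (cwExp β fun y => (F y - cwExp β F) ^ 2)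
      = (cwExp β fun y => F y ^ 2) - cwExp β F ^ 2 := by
    have : (fun y : ι → ℝ => (F y - cwExp β F) ^ 2)
        = fun y => (F y ^ 2 - 2 * cwExp β F * F y) + cwExp β F ^ 2 := by
      ext y; ring
    rw [this, cwExp_add, cwExp_sub, cwExp_mul_left, cwExp_const]
    ring
  linarith

/-- The Curie-Weiss distribution is exchangeable. -/
theorem cwExp_comp_perm (β : ℝ) (σ : Equiv.Perm ι) (F : (ι → ℝ) → E) :
    cwExp β (fun y => F (y ∘ σ)) = cwExp β F := by
  unfold cwExp
  congr 1
  refine Finset.sum_nbij' (fun y => y ∘ σ) (fun y => y ∘ σ.symm) ?_ ?_ ?_ ?_ ?_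
  · intro y hy
    exact mem_spinConfigs.2 fun i => mem_spinConfigs.1 hy (σ i)
  · intro y hy
    exact mem_spinConfigs.2 fun i => mem_spinConfigs.1 hy (σ.symm i)
  · intro y _; ext i; simp
  · intro y _; ext i; simp
  · intro y _
    have : ∑ i, y (σ i) = ∑ i, y i := Equiv.sum_comp σ y
    simp [curieWeissWeight, this]

/-! ### Conditioning on all spins but one -/

theorem update_mem_spinConfigs {y : ι → ℝ} (hy : y ∈ spinConfigs ι) (e : ι) {c : ℝ}
    (hc : c = -1 ∨ c = 1) : Function.update y e c ∈ spinConfigs ι := by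
  refine mem_spinConfigs.2 fun i => ?_
  by_cases h : i = e
  · subst h; simpa using hc
  · simpa [h] using mem_spinConfigs.1 hy i

theorem eq_update_or {y : ι → ℝ} (hy : y ∈ spinConfigs ι) (e : ι) :
    y = Function.update y e 1 ∨ y = Function.update y e (-1) := by
  rcases mem_spinConfigs.1 hy e with h | h
  · right; rw [← h, Function.update_eq_self]
  · left; rw [← h, Function.update_eq_self]

/-- The sum of all spins except the one at `e`. -/
def cavity (e : ι) (y : ι → ℝ) : ℝ := ∑ i, y i - y e

theorem sum_update_eq (e : ι) (y : ι → ℝ) (c : ℝ) :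
    ∑ i, Function.update y e c i = cavity e y + c := by
  rw [Finset.sum_update_of_mem (Finset.mem_univ e), cavity,
    ← Finset.sum_erase_add _ _ (Finset.mem_univ e), Finset.sdiff_singleton_eq_erase]
  ring

theorem cavity_update (e : ι) (y : ι → ℝ) (c : ℝ) :
    cavity e (Function.update y e c) = cavity e y := by
  rw [cavity, sum_update_eq]; simp

/-- Flipping the spin at `e` permutes the configurations, and a configuration together with its flip
is the pair of its two updates. -/
theorem sum_spinConfigs_pair (e : ι) (Φ : (ι → ℝ) → E) :
    ∑ y ∈ spinConfigs ι, (Φ (Function.update y e 1) + Φ (Function.update y e (-1)))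
      = (2 : ℝ) • ∑ y ∈ spinConfigs ι, Φ y := by
  have key : ∑ y ∈ spinConfigs ι, Φ (Function.update y e (-(y e))) = ∑ y ∈ spinConfigs ι, Φ y := by
    refine Finset.sum_nbij' (fun y => Function.update y e (-(y e)))
      (fun y => Function.update y e (-(y e))) ?_ ?_ ?_ ?_ ?_
    · intro y hy
      refine update_mem_spinConfigs hy e ?_
      rcases mem_spinConfigs.1 hy e with h | h <;> simp [h]
    · intro y hy
      refine update_mem_spinConfigs hy e ?_
      rcases mem_spinConfigs.1 hy e with h | h <;> simp [h]
    · intro y _; simp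
    · intro y _; simp
    · intro y _; rfl
  rw [two_smul]
  nth_rewrite 2 [← key]
  rw [← Finset.sum_add_distrib]
  refine Finset.sum_congr rfl fun y hy => ?_
  rcases mem_spinConfigs.1 hy e with h | h
  · have : Function.update y e (-1) = y := by rw [← h, Function.update_eq_self]
    rw [this, h, neg_neg, add_comm]
  · have : Function.update y e 1 = y := by rw [← h, Function.update_eq_self]
    rw [this, h]

/-- The conditional expectation of the spin at `e` given all other spins. -/
def condSpin (β : ℝ) (e : ι) (y : ι → ℝ) : ℝ :=
  Real.tanh (β / Fintype.card ι * cavity e y)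

/-- With s the cavity sum, (s ± 1)² = s² + 1 ± 2s, so the two weights are a common factor times
exp(±u) with u = βs/N; their difference over their sum is tanh u. -/
theorem condSpin_weight [Nonempty ι] (β : ℝ) (e : ι) (y : ι → ℝ) :
    condSpin β e y * (curieWeissWeight β (Function.update y e 1)
        + curieWeissWeight β (Function.update y e (-1)))
      = curieWeissWeight β (Function.update y e 1)
        - curieWeissWeight β (Function.update y e (-1)) := by
  have hN : (Fintype.card ι : ℝ) ≠ 0 := by exact_mod_cast Fintype.card_ne_zero
  set u := β / Fintype.card ι * cavity e y with hu
  set c := β / (2 * (Fintype.card ι : ℝ)) * (cavity e y ^ 2 + 1) with hc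
  have h1 : curieWeissWeight β (Function.update y e 1) = Real.exp c * Real.exp u := by
    rw [curieWeissWeight, sum_update_eq, ← Real.exp_add, hu, hc]
    congr 1; field_simp; ring
  have h2 : curieWeissWeight β (Function.update y e (-1)) = Real.exp c * Real.exp (-u) := by
    rw [curieWeissWeight, sum_update_eq, ← Real.exp_add, hu, hc]
    congr 1; field_simp; ring
  rw [h1, h2, condSpin, ← hu, Real.tanh_eq_sinh_div_cosh, Real.sinh_eq, Real.cosh_eq]
  have : Real.exp u + Real.exp (-u) ≠ 0 := by positivity
  field_simp

/-- Integration by parts for a single spin in the Curie-Weiss model. -/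
theorem cwExp_spin_smul [Nonempty ι] (β : ℝ) (e : ι) (F : (ι → ℝ) → E) :
    cwExp β (fun y => y e • F y) = cwExp β fun y =>
      (2 : ℝ)⁻¹ • (F (Function.update y e 1) - F (Function.update y e (-1)))
        + (condSpin β e y * 2⁻¹) •
          (F (Function.update y e 1) + F (Function.update y e (-1))) := by
  unfold cwExp
  congr 1
  -- Doubling both sides allows `sum_spinConfigs_pair` to group each configuration with its flip;
  -- the identity then holds pair by pair.
  refine smul_right_injective E (two_ne_zero (α := ℝ)) ?_
  simp only
  rw [← sum_spinConfigs_pair e, ← sum_spinConfigs_pair e]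
  refine Finset.sum_congr rfl fun y _ => ?_
  have h := condSpin_weight β e y
  have ht : ∀ c, condSpin β e (Function.update y e c) = condSpin β e y := fun c => by
    simp [condSpin, cavity_update]
  simp only [Function.update_self, Function.update_idem, ht]
  set w₁ := curieWeissWeight β (Function.update y e 1)
  set w₂ := curieWeissWeight β (Function.update y e (-1))
  set t := condSpin β e y
  set a := F (Function.update y e 1)
  set b := F (Function.update y e (-1))
  have h' : (w₁ + w₂) • (t * 2⁻¹) • (a + b) = ((w₁ - w₂) * 2⁻¹) • (a + b) := by
    rw [smul_smul, ← h]; congr 1; ring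
  rw [← add_smul, smul_add (w₁ + w₂), h']
  module

end Expectation

/-! ### Bounds for the hyperbolic tangent -/

/-- The cubic term is all that confines the total spin at β = 1. The constant 1/6, weaker than the
Taylor coefficient 1/3, makes the bound valid up to u = 1. -/
theorem tanh_le_self_sub_cube {u : ℝ} (h0 : 0 ≤ u) (h1 : u ≤ 1) :
    Real.tanh u ≤ u - u ^ 3 / 6 := by
  -- The bound 5/3 makes the derivative below at least (v² - v⁴)/6; it holds because cosh 1 ≤
  -- exp(1/2) and e < 25/9.
  have hcosh : ∀ v ∈ Set.Icc (0 : ℝ) 1, Real.cosh v ≤ 5 / 3 := by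
    intro v hv
    have h : Real.cosh v ≤ Real.cosh 1 :=
      Real.cosh_le_cosh.2 (by rw [abs_of_nonneg hv.1, abs_one]; exact hv.2)
    refine h.trans ?_
    have h3 : Real.exp (1 / 2) ≤ 5 / 3 := by
      have h4 : Real.exp (1 / 2) ^ 2 = Real.exp 1 := by rw [← Real.exp_nat_mul]; norm_num
      have h5 := Real.exp_one_lt_d9
      nlinarith [Real.exp_pos (1 / 2)]
    have h2 := Real.cosh_le_exp_half_sq 1
    norm_num at h2 ⊢
    linarith
  have hmono : MonotoneOn (fun v => (v - v ^ 3 / 6) * Real.cosh v - Real.sinh v)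
      (Set.Icc 0 1) := by
    refine monotoneOn_of_hasDerivWithinAt_nonneg
      (f' := fun v => (1 - v ^ 2 / 2) * Real.cosh v + (v - v ^ 3 / 6) * Real.sinh v - Real.cosh v)
      (convex_Icc 0 1) (by fun_prop) ?_ ?_
    · intro v _
      refine HasDerivAt.hasDerivWithinAt ?_
      have h1 : HasDerivAt (fun v : ℝ => v - v ^ 3 / 6) (1 - v ^ 2 / 2) v := by
        refine ((hasDerivAt_id' v).fun_sub ((hasDerivAt_pow 3 v).div_const 6)).congr_deriv ?_
        norm_num; ring
      exact (h1.mul (Real.hasDerivAt_cosh v)).sub (Real.hasDerivAt_sinh v)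
    · intro v hv
      rw [interior_Icc] at hv
      have hc := hcosh v ⟨hv.1.le, hv.2.le⟩
      have hs : v ≤ Real.sinh v := Real.self_le_sinh_iff.2 hv.1.le
      have h6 : 0 ≤ v - v ^ 3 / 6 := by nlinarith [hv.1, hv.2, mul_pos hv.1 hv.1]
      have h7 : (v - v ^ 3 / 6) * v ≤ (v - v ^ 3 / 6) * Real.sinh v :=
        mul_le_mul_of_nonneg_left hs h6
      have h8 : v ^ 2 / 2 * Real.cosh v ≤ v ^ 2 / 2 * (5 / 3) :=
        mul_le_mul_of_nonneg_left hc (by positivity)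
      have h9 : v ^ 4 ≤ v ^ 2 := by
        have : v ^ 2 ≤ 1 := by nlinarith [hv.1, hv.2]
        nlinarith [sq_nonneg v]
      nlinarith
  have h := hmono (Set.left_mem_Icc.2 zero_le_one) ⟨h0, h1⟩ h0
  simp only [Real.sinh_zero] at h
  rw [Real.tanh_eq_sinh_div_cosh, div_le_iff₀ (Real.cosh_pos u)]
  simpa using h

theorem tanh_monotone : Monotone Real.tanh := by
  intro a b hab
  rw [Real.tanh_eq_sinh_div_cosh, Real.tanh_eq_sinh_div_cosh,
    div_le_div_iff₀ (Real.cosh_pos a) (Real.cosh_pos b), ← sub_nonneg]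
  have : Real.sinh b * Real.cosh a - Real.sinh a * Real.cosh b = Real.sinh (b - a) := by
    rw [Real.sinh_sub]; ring
  rw [this]
  exact Real.sinh_nonneg_iff.2 (by linarith)

theorem tanh_nonneg {u : ℝ} (h : 0 ≤ u) : 0 ≤ Real.tanh u := by
  simpa using tanh_monotone h

theorem abs_tanh (u : ℝ) : |Real.tanh u| = Real.tanh |u| := by
  rcases le_total 0 u with h | h
  · rw [abs_of_nonneg h, abs_of_nonneg (tanh_nonneg h)]
  · rw [abs_of_nonpos h, Real.tanh_neg, abs_of_nonpos]
    have := tanh_nonneg (neg_nonneg.2 h)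
    rw [Real.tanh_neg] at this; linarith

/-! ### Power inequalities -/

theorem step_diff_bounds (k : ℕ) {x : ℝ} (hx : 0 ≤ x) :
    |(x + 1) ^ k - (x - 1) ^ k| ≤ 2 * k * (1 + x) ^ (k - 1) := by
  have h := abs_pow_sub_pow_le (x + 1) (x - 1) k
  have h1 : max |x + 1| |x - 1| = 1 + x := by
    rw [abs_of_nonneg (by linarith : 0 ≤ x + 1), add_comm x 1]
    refine max_eq_left (abs_le.2 ⟨by linarith, by linarith⟩)
  rw [h1, show x + 1 - (x - 1) = 2 by ring, abs_two] at h
  exact h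

/-- Half-sums M and half-differences D of the shifted odd powers satisfy M' = (x² + 1) M + 2xD,
which drives the induction. Later the lower bound serves the cubic deficit and the upper bound the
linear drift. -/
theorem step_avg_bounds (m : ℕ) : ∃ C : ℝ, 0 ≤ C ∧ ∀ x : ℝ, 0 ≤ x →
    x ^ (2 * m + 1) ≤ ((x + 1) ^ (2 * m + 1) + (x - 1) ^ (2 * m + 1)) / 2 ∧
    x * (((x + 1) ^ (2 * m + 1) + (x - 1) ^ (2 * m + 1)) / 2)
      ≤ x ^ (2 * m + 2) + C * (1 + x) ^ (2 * m) := by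
  induction m with
  | zero => exact ⟨0, le_rfl, fun x hx => ⟨by norm_num, by norm_num; nlinarith⟩⟩
  | succ m ih =>
    obtain ⟨C, hC, h⟩ := ih
    refine ⟨C + 1 + 2 * (2 * m + 1), by positivity, fun x hx => ?_⟩
    obtain ⟨hl, hu⟩ := h x hx
    set M := ((x + 1) ^ (2 * m + 1) + (x - 1) ^ (2 * m + 1)) / 2 with hM
    set D := ((x + 1) ^ (2 * m + 1) - (x - 1) ^ (2 * m + 1)) / 2 with hD
    have hrec : ((x + 1) ^ (2 * (m + 1) + 1) + (x - 1) ^ (2 * (m + 1) + 1)) / 2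
        = (x ^ 2 + 1) * M + 2 * x * D := by rw [hM, hD]; ring
    have hD0 : 0 ≤ D := by
      have : (x - 1) ^ (2 * m + 1) ≤ (x + 1) ^ (2 * m + 1) :=
        (Odd.strictMono_pow ⟨m, rfl⟩).monotone (by linarith)
      rw [hD]; linarith
    have hD1 : D ≤ (2 * m + 1) * (1 + x) ^ (2 * m) := by
      have := (le_abs_self _).trans (step_diff_bounds (2 * m + 1) hx)
      simp only [Nat.add_sub_cancel] at this
      push_cast at this
      rw [hD]; linarith
    have hM0 : 0 ≤ M := (pow_nonneg hx _).trans hl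
    have hM1 : M ≤ (1 + x) ^ (2 * m + 1) := by
      have : (x - 1) ^ (2 * m + 1) ≤ (x + 1) ^ (2 * m + 1) :=
        (Odd.strictMono_pow ⟨m, rfl⟩).monotone (by linarith)
      rw [hM, add_comm 1 x]; linarith
    rw [hrec]
    constructor
    · have : x ^ (2 * (m + 1) + 1) = x ^ 2 * x ^ (2 * m + 1) := by ring
      rw [this]
      have := mul_le_mul_of_nonneg_left hl (sq_nonneg x)
      have := mul_nonneg hx hD0
      nlinarith
    · set P := (1 + x) ^ (2 * m) with hP
      have hP0 : 0 ≤ P := by positivity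
      have e1 : (1 + x) ^ (2 * (m + 1)) = (1 + x) ^ 2 * P := by rw [hP]; ring
      have e2 : x ^ (2 * (m + 1) + 2) = x ^ 2 * x ^ (2 * m + 2) := by ring
      have e3 : (1 + x) ^ (2 * m + 1) = (1 + x) * P := by rw [hP]; ring
      rw [e1, e2]
      rw [e3] at hM1
      have a1 : x ^ 2 * (x * M) ≤ x ^ 2 * (x ^ (2 * m + 2) + C * P) :=
        mul_le_mul_of_nonneg_left hu (sq_nonneg x)
      have a2 : x * M ≤ (1 + x) * ((1 + x) * P) :=
        mul_le_mul (by linarith) hM1 hM0 (by linarith)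
      have a3 : x ^ 2 * D ≤ (1 + x) ^ 2 * ((2 * m + 1) * P) :=
        mul_le_mul (by nlinarith) hD1 hD0 (by positivity)
      have a4 : x ^ 2 * (C * P) ≤ (1 + x) ^ 2 * (C * P) :=
        mul_le_mul_of_nonneg_right (by nlinarith) (by positivity)
      nlinarith

/-- Second-order Taylor bound for removing one spin. The linear term stays explicit because its sum
over all spins has a favourable sign. -/
theorem shift_pow_le (k : ℕ) : ∃ C : ℝ, 0 ≤ C ∧ ∀ s y : ℝ, |y| = 1 →
    |(s - y) ^ (k + 2) - s ^ (k + 2) + (k + 2) * y * s ^ (k + 1)| ≤ C * (1 + |s|) ^ k := by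
  induction k with
  | zero =>
    refine ⟨1, zero_le_one, fun s y hy => ?_⟩
    have : (s - y) ^ (0 + 2) - s ^ (0 + 2) + ((0 : ℕ) + 2) * y * s ^ (0 + 1) = y ^ 2 := by
      push_cast; ring
    rw [this, ← sq_abs, hy]; norm_num
  | succ k ih =>
    obtain ⟨C, hC, h⟩ := ih
    refine ⟨C + (k + 2), by positivity, fun s y hy => ?_⟩
    have e : (s - y) ^ (k + 1 + 2) - s ^ (k + 1 + 2) + ((k + 1 : ℕ) + 2) * y * s ^ (k + 1 + 1)
        = (s - y) * ((s - y) ^ (k + 2) - s ^ (k + 2) + (k + 2) * y * s ^ (k + 1))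
          + (k + 2) * y ^ 2 * s ^ (k + 1) := by
      push_cast; ring
    rw [e]
    have hy2 : y ^ 2 = 1 := by rw [← sq_abs, hy]; norm_num
    have h1 : |s - y| ≤ 1 + |s| := by
      have := abs_sub s y; rw [hy] at this; linarith
    have h2 : |(k + 2 : ℝ) * y ^ 2 * s ^ (k + 1)| ≤ (k + 2) * (1 + |s|) ^ (k + 1) := by
      rw [hy2, mul_one, abs_mul, abs_pow, abs_of_nonneg (by positivity : (0 : ℝ) ≤ k + 2)]
      gcongr
      linarith
    refine (abs_add_le _ _).trans ?_
    rw [abs_mul, add_mul C]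
    refine add_le_add ?_ h2
    calc _ ≤ (1 + |s|) * (C * (1 + |s|) ^ k) :=
          mul_le_mul h1 (h s y hy) (abs_nonneg _) (by positivity)
      _ = _ := by ring

/-! ### Moments of the total spin -/

/-- The left side is the integrand that `cwExp_spin_smul` produces for S^(2m+1), with x the cavity
sum. The difference quotient costs O((1+|x|)^(2m)), and tanh u ≤ u - u³/6 yields the other two
terms. -/
theorem step_stein_bound (m : ℕ) : ∃ C : ℝ, 0 ≤ C ∧ ∀ β x N : ℝ, 0 ≤ β → β ≤ 1 → 1 ≤ N → |x| ≤ N →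
    (2 : ℝ)⁻¹ * ((x + 1) ^ (2 * m + 1) - (x + -1) ^ (2 * m + 1))
      + Real.tanh (β / N * x) * 2⁻¹ * ((x + 1) ^ (2 * m + 1) + (x + -1) ^ (2 * m + 1))
      ≤ C * (1 + |x|) ^ (2 * m) + x ^ (2 * m + 2) / N - x ^ (2 * m + 4) / (6 * N ^ 3) := by
  obtain ⟨C, hC, h⟩ := step_avg_bounds m
  refine ⟨(2 * m + 1) + C, by positivity, fun β x N hβ hβ1 hN hxN => ?_⟩
  -- Everything is even in x, since tanh and the powers of exponent 2m + 1 are odd.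
  wlog hx : 0 ≤ x generalizing x with H
  · have := H (-x) (by rwa [abs_neg]) (by linarith)
    have e1 : (-x + 1) ^ (2 * m + 1) = -((x + -1) ^ (2 * m + 1)) := by
      rw [← Odd.neg_pow ⟨m, rfl⟩]; congr 1; ring
    have e2 : (-x + -1) ^ (2 * m + 1) = -((x + 1) ^ (2 * m + 1)) := by
      rw [← Odd.neg_pow ⟨m, rfl⟩]; congr 1; ring
    have e3 : (-x) ^ (2 * m + 2) = x ^ (2 * m + 2) := Even.neg_pow ⟨m + 1, by ring⟩ x
    have e4 : (-x) ^ (2 * m + 4) = x ^ (2 * m + 4) := Even.neg_pow ⟨m + 2, by ring⟩ x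
    rw [e1, e2, e3, e4, abs_neg, mul_neg, Real.tanh_neg] at this
    refine le_trans (le_of_eq ?_) this
    ring
  rw [abs_of_nonneg hx] at hxN ⊢
  obtain ⟨hl, hu⟩ := h x hx
  have hN0 : 0 < N := by linarith
  rw [← sub_eq_add_neg]
  set M := ((x + 1) ^ (2 * m + 1) + (x - 1) ^ (2 * m + 1)) / 2 with hM
  set P := (1 + x) ^ (2 * m) with hP
  have hP0 : 0 ≤ P := by positivity
  have hM0 : 0 ≤ M := (pow_nonneg hx _).trans hl
  have hD : (2 : ℝ)⁻¹ * ((x + 1) ^ (2 * m + 1) - (x - 1) ^ (2 * m + 1)) ≤ (2 * m + 1) * P := by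
    have := (le_abs_self _).trans (step_diff_bounds (2 * m + 1) hx)
    simp only [Nat.add_sub_cancel] at this
    push_cast at this
    linarith
  have ht : Real.tanh (β / N * x) ≤ x / N - (x / N) ^ 3 / 6 := by
    refine (tanh_monotone ?_).trans (tanh_le_self_sub_cube (by positivity)
      ((div_le_one hN0).2 hxN))
    rw [div_mul_eq_mul_div]
    exact div_le_div_of_nonneg_right (mul_le_of_le_one_left hx hβ1) hN0.le
  have h1 : Real.tanh (β / N * x) * 2⁻¹ * ((x + 1) ^ (2 * m + 1) + (x - 1) ^ (2 * m + 1))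
      ≤ (x / N - (x / N) ^ 3 / 6) * M := by
    refine le_trans (le_of_eq ?_) (mul_le_mul_of_nonneg_right ht hM0)
    rw [hM]; ring
  have h2 : (x / N - (x / N) ^ 3 / 6) * M = x * M / N - x ^ 3 * M / (6 * N ^ 3) := by
    field_simp
  have h3 : x * M / N ≤ x ^ (2 * m + 2) / N + C * P := by
    calc x * M / N ≤ (x ^ (2 * m + 2) + C * P) / N := div_le_div_of_nonneg_right hu hN0.le
      _ = x ^ (2 * m + 2) / N + C * P / N := add_div _ _ _
      _ ≤ _ := by gcongr; exact div_le_self (by positivity) hN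
  have h4 : x ^ (2 * m + 4) / (6 * N ^ 3) ≤ x ^ 3 * M / (6 * N ^ 3) := by
    refine div_le_div_of_nonneg_right ?_ (by positivity)
    calc x ^ (2 * m + 4) = x ^ 3 * x ^ (2 * m + 1) := by ring
      _ ≤ _ := mul_le_mul_of_nonneg_left hl (by positivity)
  rw [add_mul]
  linarith

section Moments

variable {ι : Type*} [Fintype ι] [DecidableEq ι]

theorem abs_cavity_le_card {y : ι → ℝ} (hy : y ∈ spinConfigs ι) (e : ι) :
    |cavity e y| ≤ Fintype.card ι := by
  have h : cavity e y = ∑ i ∈ Finset.univ.erase e, y i := by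
    rw [cavity, ← Finset.sum_erase_add _ _ (Finset.mem_univ e)]; ring
  rw [h]
  refine (Finset.abs_sum_le_sum_abs _ _).trans ?_
  simp only [abs_spin hy, Finset.sum_const, nsmul_eq_mul, mul_one]
  exact_mod_cast Finset.card_le_univ _

theorem abs_cavity_le {y : ι → ℝ} (hy : y ∈ spinConfigs ι) (e : ι) :
    |cavity e y| ≤ 1 + |∑ i, y i| := by
  have := abs_sub (∑ i, y i) (y e)
  rw [abs_spin hy] at this
  rw [cavity]; linarith

theorem abs_sum_le_cavity {y : ι → ℝ} (hy : y ∈ spinConfigs ι) (e : ι) :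
    |∑ i, y i| ≤ |cavity e y| + 1 := by
  have := abs_add_le (cavity e y) (y e)
  rw [abs_spin hy, cavity, sub_add_cancel] at this
  exact this

theorem one_add_pow_le {k : ℕ} {x : ℝ} (hx : 0 ≤ x) : (1 + x) ^ k ≤ 2 ^ k * (1 + x ^ k) := by
  rcases le_total x 1 with h | h
  · calc (1 + x) ^ k ≤ 2 ^ k := pow_le_pow_left₀ (by linarith) (by linarith) k
      _ ≤ _ := le_mul_of_one_le_right (by positivity) (by linarith [pow_nonneg hx k])
  · calc (1 + x) ^ k ≤ (2 * x) ^ k := pow_le_pow_left₀ (by linarith) (by linarith) k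
      _ = 2 ^ k * x ^ k := mul_pow _ _ _
      _ ≤ _ := by gcongr; linarith

/-- Write S^(2m+2) = ∑_e y_e S^(2m+1) and integrate each spin by parts. The drift reproduces at most
E S^(2m+2), so the deficit (6N³)⁻¹ ∑_e cavity^(2m+4) must be paid for by terms of order N
E(1+|S|)^(2m). -/
theorem cwExp_total_spin_step (m : ℕ) : ∃ C : ℝ, 0 ≤ C ∧
    ∀ (ι : Type*) [Fintype ι] [DecidableEq ι] [Nonempty ι] (β : ℝ), 0 ≤ β → β ≤ 1 →
      cwExp β (fun y : ι → ℝ => (1 + |∑ i, y i|) ^ (2 * m + 4))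
        ≤ C * (Fintype.card ι : ℝ) ^ 3 *
          cwExp β (fun y : ι → ℝ => (1 + |∑ i, y i|) ^ (2 * m)) := by
  obtain ⟨C₁, hC₁, h₁⟩ := step_stein_bound m
  obtain ⟨C₂, hC₂, h₂⟩ := shift_pow_le (2 * m)
  set K : ℝ := C₁ * 2 ^ (2 * m) + C₂ with hK
  have hK0 : 0 ≤ K := by positivity
  refine ⟨2 ^ (2 * m + 4) * (1 + 2 ^ (2 * m + 4) * (1 + 6 * K)), by positivity, ?_⟩
  intro ι _ _ _ β hβ hβ1
  set N : ℝ := (Fintype.card ι : ℝ) with hN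
  have hN1 : 1 ≤ N := by rw [hN]; exact_mod_cast Fintype.card_pos
  have hN0 : 0 < N := by linarith
  set Q := cwExp β (fun y : ι → ℝ => (1 + |∑ i, y i|) ^ (2 * m)) with hQ
  have hQ1 : 1 ≤ Q := by
    calc (1 : ℝ) = cwExp β (fun _ : ι → ℝ => (1 : ℝ)) := (cwExp_const β 1).symm
      _ ≤ Q := cwExp_mono fun y _ => one_le_pow₀ (by linarith [abs_nonneg (∑ i, y i)])
  have hstein : cwExp β (fun y : ι → ℝ => (∑ i, y i) ^ (2 * m + 2))
      = cwExp β fun y : ι → ℝ => ∑ e, ((2 : ℝ)⁻¹ * ((cavity e y + 1) ^ (2 * m + 1)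
          - (cavity e y + -1) ^ (2 * m + 1)) + Real.tanh (β / N * cavity e y) * 2⁻¹ *
          ((cavity e y + 1) ^ (2 * m + 1) + (cavity e y + -1) ^ (2 * m + 1))) := by
    have : (fun y : ι → ℝ => (∑ i, y i) ^ (2 * m + 2))
        = fun y => ∑ e, y e • (∑ i, y i) ^ (2 * m + 1) := by
      ext y; simp only [smul_eq_mul]; rw [← Finset.sum_mul]; ring
    rw [this, cwExp_sum, cwExp_sum]
    refine Finset.sum_congr rfl fun e _ => ?_
    rw [cwExp_spin_smul β e]
    simp only [sum_update_eq, smul_eq_mul, condSpin, hN]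
  have hpt : ∀ y ∈ spinConfigs ι, ∑ e, ((2 : ℝ)⁻¹ * ((cavity e y + 1) ^ (2 * m + 1)
          - (cavity e y + -1) ^ (2 * m + 1)) + Real.tanh (β / N * cavity e y) * 2⁻¹ *
          ((cavity e y + 1) ^ (2 * m + 1) + (cavity e y + -1) ^ (2 * m + 1)))
      ≤ ((∑ i, y i) ^ (2 * m + 2) + N * K * (1 + |∑ i, y i|) ^ (2 * m))
        - (6 * N ^ 3)⁻¹ * ∑ e, cavity e y ^ (2 * m + 4) := by
    intro y hy
    set s := ∑ i, y i with hs
    have hsum : ∀ e, (2 : ℝ)⁻¹ * ((cavity e y + 1) ^ (2 * m + 1)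
          - (cavity e y + -1) ^ (2 * m + 1)) + Real.tanh (β / N * cavity e y) * 2⁻¹ *
          ((cavity e y + 1) ^ (2 * m + 1) + (cavity e y + -1) ^ (2 * m + 1))
        ≤ C₁ * 2 ^ (2 * m) * (1 + |s|) ^ (2 * m) + (s ^ (2 * m + 2)
          - ((2 * m : ℕ) + 2) * y e * s ^ (2 * m + 1) + C₂ * (1 + |s|) ^ (2 * m)) / N
          - (6 * N ^ 3)⁻¹ * cavity e y ^ (2 * m + 4) := by
      intro e
      have a1 := h₁ β (cavity e y) N hβ hβ1 hN1 (abs_cavity_le_card hy e)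
      have a2 := (abs_le.1 (h₂ s (y e) (abs_spin hy e))).2
      have a3 : (1 + |cavity e y|) ^ (2 * m) ≤ 2 ^ (2 * m) * (1 + |s|) ^ (2 * m) := by
        rw [← mul_pow]
        refine pow_le_pow_left₀ (by positivity) ?_ _
        have := abs_cavity_le hy e
        rw [← hs] at this
        linarith [abs_nonneg s]
      have a4 : cavity e y ^ (2 * m + 2) / N ≤ (s ^ (2 * m + 2)
          - ((2 * m : ℕ) + 2) * y e * s ^ (2 * m + 1) + C₂ * (1 + |s|) ^ (2 * m)) / N := by
        refine div_le_div_of_nonneg_right ?_ hN0.le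
        rw [cavity, ← hs]; linarith
      have a5 := mul_le_mul_of_nonneg_left a3 hC₁
      have a6 : cavity e y ^ (2 * m + 4) / (6 * N ^ 3)
        = (6 * N ^ 3)⁻¹ * cavity e y ^ (2 * m + 4) := by rw [div_eq_inv_mul]
      linarith
    refine (Finset.sum_le_sum fun e _ => hsum e).trans ?_
    rw [Finset.sum_sub_distrib, Finset.sum_add_distrib, ← Finset.sum_div, Finset.sum_add_distrib,
      Finset.sum_sub_distrib, ← Finset.mul_sum Finset.univ (fun e => cavity e y ^ (2 * m + 4))]
    have b0 : ∑ e, ((2 * m : ℕ) + 2 : ℝ) * y e * s ^ (2 * m + 1)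
        = ((2 * m : ℕ) + 2) * s * s ^ (2 * m + 1) := by
      rw [← Finset.sum_mul, ← Finset.mul_sum, ← hs]
    rw [b0]
    simp only [Finset.sum_const, Finset.card_univ, nsmul_eq_mul, ← hN]
    -- Since ∑_e y_e = s, the linear Taylor terms sum to a multiple of an even power of s; they
    -- enter with a minus sign and can be dropped.
    have b1 : 0 ≤ ((2 * m : ℕ) + 2 : ℝ) * s * s ^ (2 * m + 1) := by
      have : ((2 * m : ℕ) + 2 : ℝ) * s * s ^ (2 * m + 1) = ((2 * m : ℕ) + 2) * (s ^ (m + 1)) ^ 2 := by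
        ring
      rw [this]; positivity
    have b2 : (N * s ^ (2 * m + 2) - ((2 * m : ℕ) + 2) * s * s ^ (2 * m + 1)
        + N * (C₂ * (1 + |s|) ^ (2 * m))) / N ≤ s ^ (2 * m + 2) + C₂ * (1 + |s|) ^ (2 * m) := by
      rw [div_le_iff₀ hN0]; linarith
    have b3 : C₂ * (1 + |s|) ^ (2 * m) ≤ N * (C₂ * (1 + |s|) ^ (2 * m)) :=
      le_mul_of_one_le_left (by positivity) hN1
    rw [hK]
    linarith
  -- E S^(2m+2) occurs on both sides with coefficient 1 and cancels, leaving a bound for the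
  -- deficit.
  have hmain := cwExp_mono (β := β) hpt
  rw [← hstein, cwExp_sub, cwExp_add, cwExp_mul_left, cwExp_mul_left, ← hQ] at hmain
  have h4 : cwExp β (fun y : ι → ℝ => ∑ e, cavity e y ^ (2 * m + 4)) ≤ 6 * N ^ 3 * (N * K * Q) := by
    have h5 : (6 * N ^ 3)⁻¹ * cwExp β (fun y : ι → ℝ => ∑ e, cavity e y ^ (2 * m + 4))
      ≤ N * K * Q := by linarith
    rwa [inv_mul_le_iff₀ (by positivity)] at h5
  have h6 : N * cwExp β (fun y : ι → ℝ => |∑ i, y i| ^ (2 * m + 4))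
      ≤ 2 ^ (2 * m + 4) * (N + 6 * N ^ 3 * (N * K * Q)) := by
    have : ∀ y ∈ spinConfigs ι, N * |∑ i, y i| ^ (2 * m + 4)
        ≤ 2 ^ (2 * m + 4) * (N + ∑ e, cavity e y ^ (2 * m + 4)) := by
      intro y hy
      have : ∀ e, |∑ i, y i| ^ (2 * m + 4) ≤ 2 ^ (2 * m + 4) * (1 + cavity e y ^ (2 * m + 4)) := by
        intro e
        have c1 : cavity e y ^ (2 * m + 4) = |cavity e y| ^ (2 * m + 4) :=
          (Even.pow_abs ⟨m + 2, by ring⟩ _).symm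
        rw [c1]
        refine le_trans (pow_le_pow_left₀ (abs_nonneg _) ?_ _) (one_add_pow_le (abs_nonneg _))
        linarith [abs_sum_le_cavity hy e]
      have := Finset.sum_le_sum fun e (_ : e ∈ Finset.univ) => this e
      rw [← Finset.mul_sum, Finset.sum_add_distrib] at this
      simpa [← hN] using this
    have := cwExp_mono (β := β) this
    rw [cwExp_mul_left, cwExp_mul_left, cwExp_add, cwExp_const] at this
    refine this.trans ?_
    gcongr
  have h7 : cwExp β (fun y : ι → ℝ => |∑ i, y i| ^ (2 * m + 4))
      ≤ 2 ^ (2 * m + 4) * (1 + 6 * N ^ 3 * (K * Q)) := by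
    refine le_of_mul_le_mul_left (h6.trans (le_of_eq ?_)) hN0
    ring
  have h8 : cwExp β (fun y : ι → ℝ => (1 + |∑ i, y i|) ^ (2 * m + 4))
      ≤ 2 ^ (2 * m + 4) * (1 + 2 ^ (2 * m + 4) * (1 + 6 * N ^ 3 * (K * Q))) := by
    have := cwExp_mono (β := β) (F := fun y : ι → ℝ => (1 + |∑ i, y i|) ^ (2 * m + 4))
      (F' := fun y => 2 ^ (2 * m + 4) * (1 + |∑ i, y i| ^ (2 * m + 4)))
      fun y _ => one_add_pow_le (abs_nonneg _)
    rw [cwExp_mul_left, cwExp_add, cwExp_const] at this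
    refine this.trans ?_
    gcongr
  refine h8.trans ?_
  have hNQ : 1 ≤ N ^ 3 * Q := one_le_mul_of_one_le_of_one_le (one_le_pow₀ hN1) hQ1
  calc 2 ^ (2 * m + 4) * (1 + 2 ^ (2 * m + 4) * (1 + 6 * N ^ 3 * (K * Q)))
      ≤ 2 ^ (2 * m + 4) * (N ^ 3 * Q + 2 ^ (2 * m + 4) * (N ^ 3 * Q + 6 * N ^ 3 * (K * Q))) := by
        gcongr
    _ = _ := by ring

theorem cwExp_total_spin_pow_four_mul (j : ℕ) : ∃ C : ℝ, 0 ≤ C ∧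
    ∀ (ι : Type*) [Fintype ι] [DecidableEq ι] [Nonempty ι] (β : ℝ), 0 ≤ β → β ≤ 1 →
      cwExp β (fun y : ι → ℝ => (1 + |∑ i, y i|) ^ (4 * j))
        ≤ C * (Fintype.card ι : ℝ) ^ (3 * j) := by
  induction j with
  | zero => exact ⟨1, zero_le_one, fun ι _ _ _ β _ _ => by simp [cwExp_const]⟩
  | succ j ih =>
    obtain ⟨C, hC, h⟩ := ih
    obtain ⟨C', hC', h'⟩ := cwExp_total_spin_step (2 * j)
    refine ⟨C' * C, by positivity, fun ι _ _ _ β hβ hβ1 => ?_⟩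
    have e1 : 4 * (j + 1) = 2 * (2 * j) + 4 := by ring
    have e2 : 2 * (2 * j) = 4 * j := by ring
    have h1 := h' ι β hβ hβ1
    have h2 := h ι β hβ hβ1
    rw [e1]
    refine h1.trans ?_
    rw [e2]
    calc _ ≤ C' * (Fintype.card ι : ℝ) ^ 3 * (C * (Fintype.card ι : ℝ) ^ (3 * j)) :=
          mul_le_mul_of_nonneg_left h2 (by positivity)
      _ = _ := by ring

/-- Moments of the total spin are of order at most `N ^ (3 r / 4)`, uniformly for `β ≤ 1`. -/
theorem cwExp_total_spin_pow (r : ℕ) : ∃ C : ℝ, 0 ≤ C ∧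
    ∀ (ι : Type*) [Fintype ι] [DecidableEq ι] [Nonempty ι] (β : ℝ), 0 ≤ β → β ≤ 1 →
      cwExp β (fun y : ι → ℝ => (1 + |∑ i, y i|) ^ r)
        ≤ C * (Fintype.card ι : ℝ) ^ (3 * (r : ℝ) / 4) := by
  obtain ⟨C, hC, h⟩ := cwExp_total_spin_pow_four_mul r
  -- The comparison is made between fourth powers, and C ≤ (1 + C)⁴.
  refine ⟨1 + C, by positivity, fun ι _ _ _ β hβ hβ1 => ?_⟩
  set a := cwExp β (fun y : ι → ℝ => (1 + |∑ i, y i|) ^ r) with ha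
  have ha0 : 0 ≤ a := cwExp_nonneg fun y _ => by positivity
  have h1 : a ^ 4 ≤ C * (Fintype.card ι : ℝ) ^ (3 * r) := by
    -- Two uses of Cauchy-Schwarz give (E X)⁴ ≤ E X⁴ for X = (1+|S|)^r, whose fourth power has an
    -- exponent divisible by 4.
    have h2 := cwExp_sq_le β (fun y : ι → ℝ => (1 + |∑ i, y i|) ^ r)
    have h3 := cwExp_sq_le β (fun y : ι → ℝ => ((1 + |∑ i, y i|) ^ r) ^ 2)
    have h4 : (fun y : ι → ℝ => (((1 + |∑ i, y i|) ^ r) ^ 2) ^ 2)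
        = fun y => (1 + |∑ i, y i|) ^ (4 * r) := by ext y; ring
    rw [h4] at h3
    refine le_trans ?_ (h3.trans (h ι β hβ hβ1))
    rw [show a ^ 4 = (a ^ 2) ^ 2 by ring]
    exact pow_le_pow_left₀ (by positivity) h2 2
  refine le_of_pow_le_pow_left₀ (n := 4) (by norm_num) (by positivity) (h1.trans ?_)
  rw [mul_pow, ← Real.rpow_natCast ((Fintype.card ι : ℝ) ^ (3 * (r : ℝ) / 4)),
    ← Real.rpow_mul (by positivity)]
  have : 3 * (r : ℝ) / 4 * (4 : ℕ) = (3 * r : ℕ) := by push_cast; ring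
  rw [this, Real.rpow_natCast]
  gcongr
  nlinarith [sq_nonneg C, pow_nonneg hC 3, pow_nonneg hC 4]

/-! ### Correlations -/

theorem cwExp_prod_insert_eq (β : ℝ) (A : Finset ι) (r : ℕ) {e e' : ι} (he : e ∉ A)
    (he' : e' ∉ A) :
    cwExp β (fun y : ι → ℝ => (∏ i ∈ A, y i) * y e * (∑ i, y i) ^ r)
      = cwExp β (fun y : ι → ℝ => (∏ i ∈ A, y i) * y e' * (∑ i, y i) ^ r) := by
  rw [← cwExp_comp_perm β (Equiv.swap e e')]
  congr 1
  ext y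
  have h1 : ∏ i ∈ A, (y ∘ Equiv.swap e e') i = ∏ i ∈ A, y i := by
    refine Finset.prod_congr rfl fun i hi => ?_
    have h1 : i ≠ e := fun h => he (h ▸ hi)
    have h2 : i ≠ e' := fun h => he' (h ▸ hi)
    simp [Equiv.swap_apply_of_ne_of_ne h1 h2]
  have h2 : ∑ i, (y ∘ Equiv.swap e e') i = ∑ i, y i := Equiv.sum_comp (Equiv.swap e e') y
  rw [h1, h2]
  simp

/-- Multiplying a product of spins by the total spin. -/
theorem cwExp_prod_mul_total (β : ℝ) (A : Finset ι) (r : ℕ) {e : ι} (he : e ∉ A) :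
    cwExp β (fun y : ι → ℝ => (∏ i ∈ A, y i) * (∑ i, y i) ^ (r + 1))
      = ∑ j ∈ A, cwExp β (fun y : ι → ℝ => (∏ i ∈ A.erase j, y i) * (∑ i, y i) ^ r)
        + ((Fintype.card ι - A.card : ℕ) : ℝ) *
          cwExp β (fun y : ι → ℝ => (∏ i ∈ insert e A, y i) * (∑ i, y i) ^ r) := by
  have h1 : cwExp β (fun y : ι → ℝ => (∏ i ∈ A, y i) * (∑ i, y i) ^ (r + 1))
      = ∑ j, cwExp β (fun y : ι → ℝ => (∏ i ∈ A, y i) * y j * (∑ i, y i) ^ r) := by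
    rw [← cwExp_sum]
    congr 1; ext y
    rw [← Finset.sum_mul, ← Finset.mul_sum]; ring
  rw [h1, ← Finset.sum_add_sum_compl A]
  congr 1
  -- For j in `A` the spin y_j occurs twice and drops out; for j outside `A` exchangeability makes
  -- all terms equal.
  · refine Finset.sum_congr rfl fun j hj => cwExp_congr fun y hy => ?_
    rw [← Finset.prod_erase_mul _ _ hj]
    have := spin_sq hy j
    linear_combination (∏ x ∈ A.erase j, y x) * (∑ i, y i) ^ r * this
  · have : ∀ j ∈ Aᶜ, cwExp β (fun y : ι → ℝ => (∏ i ∈ A, y i) * y j * (∑ i, y i) ^ r)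
        = cwExp β (fun y : ι → ℝ => (∏ i ∈ insert e A, y i) * (∑ i, y i) ^ r) := by
      intro j hj
      rw [cwExp_prod_insert_eq β A r (Finset.mem_compl.1 hj) he]
      congr 1; ext y
      rw [Finset.prod_insert he]; ring
    rw [Finset.sum_congr rfl this, Finset.sum_const, Finset.card_compl, nsmul_eq_mul]

/-- Mixed moments of `k` spins and the total spin. -/
theorem abs_cwExp_prod_mul_total_le (k : ℕ) : ∀ r : ℕ, ∃ C : ℝ, 0 ≤ C ∧
    ∀ (ι : Type*) [Fintype ι] [DecidableEq ι] [Nonempty ι] (β : ℝ), 0 ≤ β → β ≤ 1 →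
      ∀ A : Finset ι, A.card = k →
      |cwExp β (fun y : ι → ℝ => (∏ i ∈ A, y i) * (∑ i, y i) ^ r)|
        ≤ C * (Fintype.card ι : ℝ) ^ ((3 * (r : ℝ) - k) / 4) := by
  -- `cwExp_prod_mul_total` is solved for the product of k + 1 spins: it is controlled by k spins
  -- with S^(r+1) and k - 1 spins with S^r, divided by N - k. Hence the exponent r must be free and
  -- the induction strong.
  induction k using Nat.strong_induction_on with
  | _ k ih =>
  intro r
  match k, ih with
  | 0, _ =>
    obtain ⟨C, hC, h⟩ := cwExp_total_spin_pow r
    refine ⟨C, hC, fun ι _ _ _ β hβ hβ1 A hA => ?_⟩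
    rw [Finset.card_eq_zero] at hA
    subst hA
    have h1 := h ι β hβ hβ1
    simp only [Finset.prod_empty, one_mul, Nat.cast_zero, sub_zero]
    refine (abs_cwExp_le _ _).trans ((cwExp_mono fun y _ => ?_).trans h1)
    rw [abs_pow]
    gcongr
    linarith
  | k + 1, ih =>
    obtain ⟨C₁, hC₁, h₁⟩ := ih k (Nat.lt_succ_self k) (r + 1)
    -- The exponent uses k - 1 as a real number; for k = 0 there is no j to erase, so the statement
    -- is empty.
    have h₂ : ∃ C : ℝ, 0 ≤ C ∧
        ∀ (ι : Type _) [Fintype ι] [DecidableEq ι] [Nonempty ι] (β : ℝ), 0 ≤ β → β ≤ 1 →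
        ∀ A : Finset ι, A.card = k → ∀ j ∈ A,
        |cwExp β (fun y : ι → ℝ => (∏ i ∈ A.erase j, y i) * (∑ i, y i) ^ r)|
          ≤ C * (Fintype.card ι : ℝ) ^ ((3 * (r : ℝ) - ((k : ℝ) - 1)) / 4) := by
      rcases Nat.eq_zero_or_pos k with hk | hk
      · refine ⟨0, le_rfl, fun ι _ _ _ β _ _ A hA j hj => ?_⟩
        rw [hk, Finset.card_eq_zero] at hA
        simp [hA] at hj
      · obtain ⟨C, hC, h⟩ := ih (k - 1) (by omega) r
        refine ⟨C, hC, fun ι _ _ _ β hβ hβ1 A hA j hj => ?_⟩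
        have := h ι β hβ hβ1 (A.erase j) (by rw [Finset.card_erase_of_mem hj, hA])
        rwa [Nat.cast_sub hk, Nat.cast_one] at this
    obtain ⟨C₂, hC₂, h₂⟩ := h₂
    refine ⟨(k + 1) * (C₁ + k * C₂), by positivity, fun ι _ _ _ β hβ hβ1 A hA => ?_⟩
    obtain ⟨e, A', he, rfl, hA'⟩ := Finset.card_eq_succ.1 hA
    have hrec := cwExp_prod_mul_total β A' r he
    set N : ℝ := (Fintype.card ι : ℝ) with hN
    have hN1 : 1 ≤ N := by rw [hN]; exact_mod_cast Fintype.card_pos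
    have hN0 : 0 < N := by linarith
    set c := cwExp β (fun y : ι → ℝ => (∏ i ∈ insert e A', y i) * (∑ i, y i) ^ r) with hc
    set T : ℝ := N ^ ((3 * ((r + 1 : ℕ) : ℝ) - k) / 4) with hT
    have hT0 : 0 ≤ T := by positivity
    have b1 := h₁ ι β hβ hβ1 A' hA'
    have b2 : |∑ j ∈ A', cwExp β (fun y : ι → ℝ => (∏ i ∈ A'.erase j, y i) * (∑ i, y i) ^ r)|
        ≤ k * (C₂ * T) := by
      refine (Finset.abs_sum_le_sum_abs _ _).trans ?_
      rw [← hA', ← nsmul_eq_mul]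
      refine Finset.sum_le_card_nsmul _ _ _ fun j hj => ?_
      refine (h₂ ι β hβ hβ1 A' hA' j hj).trans ?_
      refine mul_le_mul_of_nonneg_left ?_ hC₂
      refine Real.rpow_le_rpow_of_exponent_le hN1 ?_
      push_cast; linarith
    have hcard : k + 1 ≤ Fintype.card ι := hA ▸ Finset.card_le_univ _
    -- N - k ≥ N/(k + 1) because N ≥ k + 1, the inserted set having k + 1 elements.
    have hd : N ≤ (k + 1) * ((Fintype.card ι - A'.card : ℕ) : ℝ) := by
      rw [hA', hN]
      have : Fintype.card ι ≤ (k + 1) * (Fintype.card ι - k) := by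
        obtain ⟨d, hd⟩ := Nat.exists_eq_add_of_le hcard
        rw [hd, show k + 1 + d - k = d + 1 by omega]
        nlinarith [Nat.zero_le (k * d)]
      exact_mod_cast this
    have b3 : ((Fintype.card ι - A'.card : ℕ) : ℝ) * |c| ≤ (C₁ + k * C₂) * T := by
      have : ((Fintype.card ι - A'.card : ℕ) : ℝ) * c
          = cwExp β (fun y : ι → ℝ => (∏ i ∈ A', y i) * (∑ i, y i) ^ (r + 1))
          - ∑ j ∈ A', cwExp β (fun y : ι → ℝ => (∏ i ∈ A'.erase j, y i) * (∑ i, y i) ^ r) := by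
        rw [hrec]; ring
      rw [← abs_of_nonneg (Nat.cast_nonneg (α := ℝ) (Fintype.card ι - A'.card)), ← abs_mul, this]
      refine (abs_sub _ _).trans ?_
      linarith
    have b4 : N * |c| ≤ (k + 1) * ((C₁ + k * C₂) * T) := by
      calc N * |c| ≤ (k + 1) * ((Fintype.card ι - A'.card : ℕ) : ℝ) * |c| :=
            mul_le_mul_of_nonneg_right hd (abs_nonneg _)
        _ = (k + 1) * (((Fintype.card ι - A'.card : ℕ) : ℝ) * |c|) := by ring
        _ ≤ _ := mul_le_mul_of_nonneg_left b3 (by positivity)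
    have hTe : T = N * N ^ ((3 * (r : ℝ) - ((k + 1 : ℕ) : ℝ)) / 4) := by
      rw [hT]
      nth_rewrite 2 [← Real.rpow_one N]
      rw [← Real.rpow_add hN0]
      congr 1; push_cast; ring
    refine le_of_mul_le_mul_left (b4.trans (le_of_eq ?_)) hN0
    rw [hTe]; ring

end Moments

/-! ### Expectations of functions of Curie-Weiss distributed random variables -/

section Law

variable {Ω : Type*} [MeasurableSpace Ω] {μ : Measure Ω} {ι : Type*} [Fintype ι] [DecidableEq ι]
  {β : ℝ} {Y : ι → Ω → ℝ}

theorem IsCurieWeiss.measurableSet_eq (h : IsCurieWeiss β Y μ) (y : ι → ℝ) :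
    MeasurableSet {ω | (fun i => Y i ω) = y} := by
  have : {ω | (fun i => Y i ω) = y} = ⋂ i, Y i ⁻¹' {y i} := by
    ext ω; simp [funext_iff]
  rw [this]
  exact MeasurableSet.iInter fun i => h.1 i (measurableSet_singleton _)

theorem IsCurieWeiss.measureReal_eq (h : IsCurieWeiss β Y μ) {y : ι → ℝ} (hy : y ∈ spinConfigs ι) :
    μ.real {ω | (fun i => Y i ω) = y} = (curieWeissZ ι β)⁻¹ * curieWeissWeight β y := by
  have h1 := h.2 y hy
  simp only [funext_iff]
  rw [Measure.real, h1, ENNReal.toReal_ofReal, div_eq_inv_mul]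
  exact div_nonneg (curieWeissWeight_pos β y).le (curieWeissZ_pos ι β).le

/-- The prescribed masses of the ±1 configurations already sum to 1, so nothing remains for other
values. -/
theorem IsCurieWeiss.ae_mem [IsProbabilityMeasure μ] (h : IsCurieWeiss β Y μ) :
    ∀ᵐ ω ∂μ, (fun i => Y i ω) ∈ spinConfigs ι := by
  have e : {ω | (fun i => Y i ω) ∈ spinConfigs ι}
      = ⋃ y ∈ spinConfigs ι, {ω | (fun i => Y i ω) = y} := by
    ext ω; simp
  have hm : MeasurableSet {ω | (fun i => Y i ω) ∈ spinConfigs ι} := by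
    rw [e]; exact Finset.measurableSet_biUnion _ fun y _ => h.measurableSet_eq y
  have h1 : μ.real {ω | (fun i => Y i ω) ∈ spinConfigs ι} = 1 := by
    rw [e, measureReal_biUnion_finset]
    · rw [Finset.sum_congr rfl fun y hy => h.measureReal_eq hy, ← Finset.mul_sum]
      exact inv_mul_cancel₀ (curieWeissZ_pos ι β).ne'
    · intro y _ y' _ hne
      refine Set.disjoint_left.2 fun ω (h1 : _ = y) (h2 : _ = y') => hne (h1.symm.trans h2)
    · exact fun y _ => h.measurableSet_eq y
  refine (mem_ae_iff_prob_eq_one hm).2 ?_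
  rw [← ENNReal.toReal_eq_one_iff]
  exact h1

/-- Almost surely any function of the spins is a finite sum of indicators, which gives integrability
without assuming that `F` is measurable. -/
theorem IsCurieWeiss.ae_eq_sum {V : Type*} [AddCommMonoid V] [IsProbabilityMeasure μ] (h : IsCurieWeiss β Y μ)
    (F : (ι → ℝ) → V) :
    (fun ω => F fun i => Y i ω) =ᵐ[μ] fun ω => ∑ y ∈ spinConfigs ι,
      {ω | (fun i => Y i ω) = y}.indicator (fun _ => F y) ω := by
  filter_upwards [h.ae_mem] with ω hω
  rw [Finset.sum_eq_single (fun i => Y i ω)]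
  · simp
  · intro y _ hy
    exact Set.indicator_of_notMem (fun h' => hy (Eq.symm h')) _
  · intro h'; exact absurd hω h'

variable {V : Type*} [NormedAddCommGroup V]

theorem IsCurieWeiss.integrable [IsProbabilityMeasure μ] (h : IsCurieWeiss β Y μ)
    (F : (ι → ℝ) → V) : Integrable (fun ω => F fun i => Y i ω) μ := by
  refine Integrable.congr ?_ (h.ae_eq_sum F).symm
  exact integrable_finsetSum _ fun y _ => (integrable_const _).indicator (h.measurableSet_eq y)

theorem IsCurieWeiss.integral_eq [NormedSpace ℝ V] [CompleteSpace V] [IsProbabilityMeasure μ]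
    (h : IsCurieWeiss β Y μ) (F : (ι → ℝ) → V) :
    ∫ ω, F (fun i => Y i ω) ∂μ = cwExp β F := by
  rw [integral_congr_ae (h.ae_eq_sum F), integral_finsetSum]
  · rw [cwExp, Finset.smul_sum]
    refine Finset.sum_congr rfl fun y hy => ?_
    rw [integral_indicator (h.measurableSet_eq y), setIntegral_const, h.measureReal_eq hy, mul_smul]
  · exact fun y _ => (integrable_const _).indicator (h.measurableSet_eq y)

end Law

/-! ### Curie-Weiss schemes are almost uncorrelated -/

theorem symmetrize_eq {Ω : Type*} (a' : (n : ℕ) → Fin n × Fin n → Ω → ℝ) (n : ℕ) (i j : Fin n)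
    (ω : Ω) : symmetrize a' n i j ω = a' n (if i ≤ j then (i, j) else (j, i)) ω := by
  unfold symmetrize
  split_ifs <;> rfl

theorem sym2_ordered {n : ℕ} (i j : Fin n) :
    Sym2.mk (if i ≤ j then (i, j) else (j, i)).1 (if i ≤ j then (i, j) else (j, i)).2 = s(i, j) := by
  split_ifs
  · rfl
  · exact Sym2.eq_swap

theorem prod_pow_eq_prod_odd {κ : Type*} (s : Finset κ) (x : κ → ℝ) (hx : ∀ i ∈ s, x i ^ 2 = 1)
    (δ : κ → ℕ) : ∏ i ∈ s, x i ^ δ i = ∏ i ∈ s with Odd (δ i), x i := by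
  rw [Finset.prod_filter]
  refine Finset.prod_congr rfl fun i hi => ?_
  split_ifs with h
  · obtain ⟨m, hm⟩ := h
    rw [hm, pow_add, pow_mul, hx i hi]; simp
  · obtain ⟨m, hm⟩ := Nat.not_odd_iff_even.1 h
    rw [hm, ← two_mul, pow_mul, hx i hi]; simp

/-- An entry product equals almost surely the product of the k distinct spins with odd exponent. Its
expectation is O(N^(-k/4)) = O(n^(-k/2)), and k is at least the number of exponents equal to 1. -/
theorem isAlmostUncorrelated_curieWeiss {Ω : Type*} [MeasurableSpace Ω] (μ : Measure Ω)
    [IsProbabilityMeasure μ] (β : ℝ) (hβ : 0 ≤ β) (hβ1 : β ≤ 1)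
    (a' : (n : ℕ) → Fin n × Fin n → Ω → ℝ) (ha' : ∀ n, 1 ≤ n → IsCurieWeiss β (a' n) μ) :
    IsAlmostUncorrelated μ (1 / 2) (symmetrize a') := by
  have hcorr := fun k => abs_cwExp_prod_mul_total_le.{0} k 0
  choose c hc0 hc using hcorr
  -- The number k of odd exponents is at most their sum s, so adding the constants for all k ≤ s
  -- suffices. The second family of constants is 0, since squared spins are 1.
  refine ⟨⟨fun n i j => ?_, fun n i j ω => symmetrize_symm a' n i j ω⟩,
    fun s => ∑ k ∈ Finset.range (s + 1), c k, fun _ _ => 0, fun _ => tendsto_const_nhds, ?_⟩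
  · have hn : 1 ≤ n := by have := i.2; omega
    have : symmetrize a' n i j = a' n (if i ≤ j then (i, j) else (j, i)) :=
      funext fun ω => symmetrize_eq a' n i j ω
    rw [this]
    exact (ha' n hn).1 _
  intro N l hN hl P hP
  have key : ∀ δ : Fin l → ℕ, ∀ (n : ℕ) (h : N ≤ n), ∃ A : Finset (Fin n × Fin n),
      A.card = (Finset.univ.filter fun i => Odd (δ i)).card ∧
      Integrable (entryProd (symmetrize a') h P δ) μ ∧
      ∫ ω, entryProd (symmetrize a') h P δ ω ∂μ
        = cwExp β (fun y : Fin n × Fin n → ℝ => ∏ i ∈ A, y i) := by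
    intro δ n h
    have hcw := ha' n (hN.trans h)
    set e : Fin l → Fin n × Fin n := fun i =>
      if Fin.castLE h (P i).1 ≤ Fin.castLE h (P i).2
        then (Fin.castLE h (P i).1, Fin.castLE h (P i).2)
        else (Fin.castLE h (P i).2, Fin.castLE h (P i).1) with he
    -- A sorted pair determines the unordered pair, and these are distinct by assumption.
    have hinj : Function.Injective e := by
      intro i j hij
      by_contra hne
      refine hP i j hne ?_
      have h1 := congrArg (fun p : Fin n × Fin n => s(p.1, p.2)) hij
      simp only [he] at h1
      rw [sym2_ordered, sym2_ordered] at h1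
      exact Sym2.map.injective (Fin.castLE_injective h) (by simpa using h1)
    have hF : entryProd (symmetrize a') h P δ
        = fun ω => (fun y : Fin n × Fin n → ℝ => ∏ i, y (e i) ^ δ i) fun p => a' n p ω := by
      ext ω
      simp only [entryProd, symmetrize_eq, he]
    refine ⟨(Finset.univ.filter fun i => Odd (δ i)).image e,
      Finset.card_image_of_injective _ hinj, ?_, ?_⟩
    · rw [hF]
      exact hcw.integrable (fun y : Fin n × Fin n → ℝ => ∏ i, y (e i) ^ δ i)
    · rw [hF, hcw.integral_eq (fun y : Fin n × Fin n → ℝ => ∏ i, y (e i) ^ δ i)]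
      refine cwExp_congr fun y hy => ?_
      rw [Finset.prod_image hinj.injOn]
      exact prod_pow_eq_prod_odd _ _ (fun i _ => spin_sq hy (e i)) δ
  refine ⟨fun δ hδ n h => ?_, fun n h => ?_⟩
  · obtain ⟨A, hA, hAint, hval⟩ := key δ n h
    refine ⟨hAint, ?_⟩
    have hn1 : 1 ≤ n := hN.trans h
    have : Nonempty (Fin n × Fin n) := ⟨(⟨0, hn1⟩, ⟨0, hn1⟩)⟩
    have hn : (1 : ℝ) ≤ n := by exact_mod_cast hn1
    have hb := hc A.card (Fin n × Fin n) β hβ hβ1 A rfl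
    simp only [pow_zero, mul_one] at hb
    rw [hval]
    have hcard : (Fintype.card (Fin n × Fin n) : ℝ) = (n : ℝ) ^ (2 : ℝ) := by
      simp [sq]
    rw [hcard, ← Real.rpow_mul (by positivity)] at hb
    refine hb.trans ?_
    beta_reduce
    rw [div_eq_mul_inv (∑ k ∈ _, _), ← Real.rpow_neg (by positivity)]
    refine mul_le_mul ?_ ?_ (by positivity) (Finset.sum_nonneg fun k _ => hc0 k)
    · refine Finset.single_le_sum (f := c) (fun k _ => hc0 k) ?_
      rw [Finset.mem_range, hA, Nat.lt_succ_iff, Finset.card_filter]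
      refine Finset.sum_le_sum fun i _ => ?_
      split_ifs
      · exact hδ i
      · exact Nat.zero_le _
    · refine Real.rpow_le_rpow_of_exponent_le hn ?_
      have : ((Finset.univ.filter fun i => δ i = 1).card : ℝ) ≤ A.card := by
        rw [hA]
        exact_mod_cast Finset.card_le_card (Finset.monotone_filter_right _ fun i _ hi => by
          rw [hi]; exact odd_one)
      push_cast
      linarith
  · obtain ⟨A, hA, _, hval⟩ := key (fun _ => 2) n h
    have : A = ∅ := by
      rw [← Finset.card_eq_zero, hA, Finset.card_eq_zero, Finset.filter_eq_empty_iff]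
      intro i _ h2
      exact absurd h2 (by decide)
    rw [hval, this]
    simp [cwExp_const]

/-! ### Resolvents of real symmetric matrices -/

section Resolvent

variable {m : Type*} [Fintype m] [DecidableEq m]

/-- The matrix `A - i η`. -/
def shifted (η : ℝ) (A : Matrix m m ℝ) : Matrix m m ℂ :=
  A.map Complex.ofReal - (η * Complex.I : ℂ) • 1

/-- The resolvent `(A - i η)⁻¹`. -/
def resolv (η : ℝ) (A : Matrix m m ℝ) : Matrix m m ℂ := (shifted η A)⁻¹

theorem map_ofReal_conjTranspose {m : Type*} {A : Matrix m m ℝ} (hA : A.IsHermitian) :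
    (A.map Complex.ofReal).conjTranspose = A.map Complex.ofReal := by
  ext i j
  simp only [Matrix.conjTranspose_apply, Matrix.map_apply]
  rw [← hA.apply i j]
  simp

theorem shifted_conjTranspose {m : Type*} [DecidableEq m] (η : ℝ) {A : Matrix m m ℝ} (hA : A.IsHermitian) :
    (shifted η A).conjTranspose = A.map Complex.ofReal + (η * Complex.I : ℂ) • 1 := by
  rw [shifted, Matrix.conjTranspose_sub, map_ofReal_conjTranspose hA, Matrix.conjTranspose_smul,
    Matrix.conjTranspose_one]
  simp

theorem shifted_mul_conjTranspose (η : ℝ) {A : Matrix m m ℝ} (hA : A.IsHermitian) :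
    shifted η A * (shifted η A).conjTranspose
      = A.map Complex.ofReal * (A.map Complex.ofReal).conjTranspose + ((η ^ 2 : ℝ) : ℂ) • 1 := by
  rw [shifted_conjTranspose η hA, map_ofReal_conjTranspose hA, shifted]
  rw [Matrix.sub_mul, Matrix.mul_add, Matrix.mul_add, Matrix.smul_mul, Matrix.smul_mul,
    Matrix.mul_smul, Matrix.one_mul, Matrix.one_mul, Matrix.mul_one, smul_smul]
  have : (η * Complex.I : ℂ) * (η * Complex.I) = -((η ^ 2 : ℝ) : ℂ) := by
    push_cast; linear_combination (η : ℂ) ^ 2 * Complex.I_sq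
  rw [this, neg_smul]
  abel

-- (A - iη)(A - iη)* = AA* + η² is positive definite.
open scoped ComplexOrder in
theorem isUnit_det_shifted {η : ℝ} (hη : 0 < η) {A : Matrix m m ℝ} (hA : A.IsHermitian) :
    IsUnit (shifted η A).det := by
  have hpd : (shifted η A * (shifted η A).conjTranspose).PosDef := by
    rw [shifted_mul_conjTranspose η hA]
    refine Matrix.PosDef.posSemidef_add (Matrix.posSemidef_self_mul_conjTranspose _) ?_
    exact Matrix.PosDef.smul Matrix.PosDef.one (by exact_mod_cast pow_pos hη 2)
  have h := (Matrix.isUnit_iff_isUnit_det _).1 hpd.isUnit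
  rw [Matrix.det_mul] at h
  exact isUnit_of_mul_isUnit_left h

theorem shifted_mul_resolv {η : ℝ} (hη : 0 < η) {A : Matrix m m ℝ} (hA : A.IsHermitian) :
    shifted η A * resolv η A = 1 :=
  Matrix.mul_nonsing_inv _ (isUnit_det_shifted hη hA)

theorem resolv_mul_shifted {η : ℝ} (hη : 0 < η) {A : Matrix m m ℝ} (hA : A.IsHermitian) :
    resolv η A * shifted η A = 1 :=
  Matrix.nonsing_inv_mul _ (isUnit_det_shifted hη hA)

/-- For real symmetric A the matrix A - iη is complex symmetric, not Hermitian, so no conjugate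
appears. -/
theorem resolv_symm (η : ℝ) {A : Matrix m m ℝ} (hA : A.IsHermitian) (i j : m) :
    resolv η A i j = resolv η A j i := by
  have h : (shifted η A).transpose = shifted η A := by
    ext i j
    simp only [shifted, Matrix.transpose_apply, Matrix.sub_apply, Matrix.map_apply,
      Matrix.smul_apply, Matrix.one_apply]
    rw [← hA.apply i j]
    simp [eq_comm]
  have h2 : (resolv η A).transpose = resolv η A := by
    rw [resolv, Matrix.transpose_nonsing_inv, h]
  nth_rewrite 1 [← h2]
  rfl

theorem conj_mul_diag {m : Type*} [Fintype m] (G B : Matrix m m ℂ) (i : m) :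
    (G * B * (G * B).conjTranspose) i i = ((∑ j, ‖(G * B) i j‖ ^ 2 : ℝ) : ℂ) := by
  rw [Matrix.mul_apply]
  push_cast
  refine Finset.sum_congr rfl fun j _ => ?_
  rw [Matrix.conjTranspose_apply]
  exact Complex.mul_conj' _

/-- Expanding G (A - iη)(A - iη)* G* = 1 gives (GA)(GA)* + η² GG* = 1, and a diagonal entry of this
is the claim up to a nonnegative term. This row bound is what makes sums over b spins affordable. -/
theorem sum_norm_sq_resolv_le {η : ℝ} (hη : 0 < η) {A : Matrix m m ℝ} (hA : A.IsHermitian)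
    (i : m) : ∑ j, ‖resolv η A i j‖ ^ 2 ≤ (η ^ 2)⁻¹ := by
  set G := resolv η A with hG
  have h1 : G * (shifted η A * (shifted η A).conjTranspose) * G.conjTranspose = 1 := by
    rw [← Matrix.mul_assoc, resolv_mul_shifted hη hA, Matrix.one_mul, ← Matrix.conjTranspose_mul,
      resolv_mul_shifted hη hA, Matrix.conjTranspose_one]
  rw [shifted_mul_conjTranspose η hA, Matrix.mul_add, Matrix.add_mul, Matrix.mul_smul,
    Matrix.mul_one, Matrix.smul_mul, ← Matrix.mul_assoc, Matrix.mul_assoc,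
    ← Matrix.conjTranspose_mul] at h1
  have h2 := congrFun (congrFun h1 i) i
  rw [Matrix.add_apply, Matrix.smul_apply, conj_mul_diag, Matrix.one_apply_eq] at h2
  have h3 := conj_mul_diag G 1 i
  rw [Matrix.mul_one] at h3
  rw [h3, smul_eq_mul] at h2
  have h4 : (∑ j, ‖(G * A.map Complex.ofReal) i j‖ ^ 2) + η ^ 2 * ∑ j, ‖G i j‖ ^ 2 = 1 := by
    exact_mod_cast h2
  have h5 : 0 ≤ ∑ j, ‖(G * A.map Complex.ofReal) i j‖ ^ 2 :=
    Finset.sum_nonneg fun j _ => by positivity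
  rw [← one_div, le_div_iff₀ (by positivity)]
  linarith

theorem norm_resolv_le {η : ℝ} (hη : 0 < η) {A : Matrix m m ℝ} (hA : A.IsHermitian) (i j : m) :
    ‖resolv η A i j‖ ≤ η⁻¹ := by
  have h1 := sum_norm_sq_resolv_le hη hA i
  have h2 : ‖resolv η A i j‖ ^ 2 ≤ ∑ j, ‖resolv η A i j‖ ^ 2 :=
    Finset.single_le_sum (f := fun j => ‖resolv η A i j‖ ^ 2) (fun _ _ => by positivity)
      (Finset.mem_univ j)
  refine le_of_sq_le_sq ?_ (by positivity)
  rw [inv_pow]; exact h2.trans h1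

/-- G - G* = 2iη GG*. The sign keeps |iη + H| ≥ η for averages H of diagonal entries. -/
theorem resolv_diag_im_nonneg {η : ℝ} (hη : 0 < η) {A : Matrix m m ℝ} (hA : A.IsHermitian) (i : m) :
    0 ≤ (resolv η A i i).im := by
  set G := resolv η A with hG
  have h1 : G - G.conjTranspose = (2 * η * Complex.I : ℂ) • (G * G.conjTranspose) := by
    have e1 : G * ((shifted η A).conjTranspose - shifted η A) * G.conjTranspose
        = G - G.conjTranspose := by
      rw [Matrix.mul_sub, Matrix.sub_mul, resolv_mul_shifted hη hA, Matrix.one_mul,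
        Matrix.mul_assoc, ← Matrix.conjTranspose_mul, resolv_mul_shifted hη hA,
        Matrix.conjTranspose_one, Matrix.mul_one]
    rw [← e1, shifted_conjTranspose η hA, shifted]
    have e2 : A.map Complex.ofReal + (η * Complex.I : ℂ) • (1 : Matrix m m ℂ)
        - (A.map Complex.ofReal - (η * Complex.I : ℂ) • 1) = (2 * η * Complex.I : ℂ) • 1 := by
      module
    rw [e2, Matrix.mul_smul, Matrix.mul_one, Matrix.smul_mul]
  have h2 := congrFun (congrFun h1 i) i
  have h3 := conj_mul_diag G 1 i
  rw [Matrix.mul_one] at h3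
  rw [Matrix.sub_apply, Matrix.conjTranspose_apply, Matrix.smul_apply, h3, smul_eq_mul] at h2
  have h5 : 0 ≤ ∑ j, ‖G i j‖ ^ 2 := Finset.sum_nonneg fun j _ => by positivity
  generalize ∑ j, ‖G i j‖ ^ 2 = r at h2 h5
  have h4 := congrArg Complex.im h2
  rw [Complex.sub_im, Complex.star_def, Complex.conj_im] at h4
  have h7 : ((2 * η * Complex.I : ℂ) * (r : ℂ)).im = 2 * η * r := by simp
  have h6 : (G i i).im = η * r := by linarith
  rw [h6]
  positivity

theorem resolv_sub {η : ℝ} (hη : 0 < η) {A B : Matrix m m ℝ} (hA : A.IsHermitian)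
    (hB : B.IsHermitian) :
    resolv η A - resolv η B = -(resolv η A * (A - B).map Complex.ofReal * resolv η B) := by
  have h : (A - B).map Complex.ofReal = shifted η A - shifted η B := by
    ext i j; simp [shifted]
  rw [h, Matrix.mul_sub, Matrix.sub_mul, resolv_mul_shifted hη hA, Matrix.one_mul,
    Matrix.mul_assoc, shifted_mul_resolv hη hB, Matrix.mul_one]
  abel

theorem sum_mul_resolv {η : ℝ} (hη : 0 < η) {A : Matrix m m ℝ} (hA : A.IsHermitian) (i : m) :
    ∑ j, (A i j : ℂ) * resolv η A j i = 1 + η * Complex.I * resolv η A i i := by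
  have h := congrFun (congrFun (shifted_mul_resolv hη hA) i) i
  rw [shifted, Matrix.sub_mul, Matrix.smul_mul, Matrix.one_mul, Matrix.sub_apply,
    Matrix.smul_apply, Matrix.mul_apply, Matrix.one_apply_eq, smul_eq_mul] at h
  simp only [Matrix.map_apply] at h
  linear_combination h

theorem trace_resolv {η : ℝ} (hη : 0 < η) {A : Matrix m m ℝ} (hA : A.IsHermitian) :
    ∑ i, resolv η A i i = ∑ i, ((hA.eigenvalues i : ℂ) - η * Complex.I)⁻¹ := by
  set U : Matrix m m ℂ := (hA.eigenvectorUnitary : Matrix m m ℝ).map Complex.ofReal with hU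
  set V : Matrix m m ℂ := (star (hA.eigenvectorUnitary : Matrix m m ℝ)).map Complex.ofReal with hV
  have hUV : U * V = 1 := by
    have := Matrix.map_mul (f := Complex.ofRealHom) (L := (hA.eigenvectorUnitary : Matrix m m ℝ))
      (M := star (hA.eigenvectorUnitary : Matrix m m ℝ))
    rw [Unitary.mul_star_self_of_mem hA.eigenvectorUnitary.2] at this
    rw [hU, hV]
    refine Eq.trans this.symm ?_
    exact Matrix.map_one _ (map_zero _) (map_one _)
  have hVU : V * U = 1 := mul_eq_one_comm.1 hUV
  have hspec : A.map Complex.ofReal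
      = U * Matrix.diagonal (fun i => (hA.eigenvalues i : ℂ)) * V := by
    have h1 := hA.spectral_theorem
    rw [Unitary.conjStarAlgAut_apply] at h1
    have h2 := congrArg (fun M : Matrix m m ℝ => M.map Complex.ofRealHom) h1
    simp only [Matrix.map_mul] at h2
    refine Eq.trans h2 ?_
    rw [Matrix.diagonal_map (map_zero _)]
    rfl
  have hne : ∀ i, (hA.eigenvalues i : ℂ) - η * Complex.I ≠ 0 := by
    intro i h
    have := congrArg Complex.im h
    simp at this
    exact hη.ne' this
  set D : Matrix m m ℂ :=
    Matrix.diagonal (fun i => ((hA.eigenvalues i : ℂ) - η * Complex.I)⁻¹) with hD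
  have hsh : shifted η A
      = U * Matrix.diagonal (fun i => (hA.eigenvalues i : ℂ) - η * Complex.I) * V := by
    have : Matrix.diagonal (fun i => (hA.eigenvalues i : ℂ) - η * Complex.I)
        = Matrix.diagonal (fun i => (hA.eigenvalues i : ℂ)) - (η * Complex.I : ℂ) • 1 := by
      rw [← Matrix.diagonal_one, ← Matrix.diagonal_smul, Matrix.diagonal_sub]
      simp
    rw [shifted, hspec, this, Matrix.mul_sub, Matrix.sub_mul, Matrix.mul_smul, Matrix.mul_one,
      Matrix.smul_mul, hUV]
  have hdd : Matrix.diagonal (fun i => (hA.eigenvalues i : ℂ) - η * Complex.I) * D = 1 := by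
    rw [hD, Matrix.diagonal_mul_diagonal, ← Matrix.diagonal_one]
    congr 1; ext i; exact mul_inv_cancel₀ (hne i)
  have hres : resolv η A = U * D * V := by
    refine Matrix.inv_eq_right_inv ?_
    rw [hsh]
    calc _ = U * (Matrix.diagonal (fun i => (hA.eigenvalues i : ℂ) - η * Complex.I)
          * ((V * U) * D)) * V := by simp only [Matrix.mul_assoc]
      _ = 1 := by rw [hVU, Matrix.one_mul, hdd, Matrix.mul_one, hUV]
  calc ∑ i, resolv η A i i = (resolv η A).trace := rfl
    _ = D.trace := by
      rw [hres, Matrix.trace_mul_comm, ← Matrix.mul_assoc, hVU, Matrix.one_mul]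
    _ = _ := by rw [hD, Matrix.trace_diagonal]

end Resolvent

/-! ### Band matrices as functions of the spins -/

section Band

variable {n : ℕ}

/-- The ordered version of the pair `(i, j)`. -/
def ordPair (i j : Fin n) : Fin n × Fin n := if i ≤ j then (i, j) else (j, i)

theorem ordPair_eq_iff (i j k l : Fin n) :
    ordPair k l = ordPair i j ↔ (k = i ∧ l = j) ∨ (k = j ∧ l = i) := by
  unfold ordPair
  split_ifs with h1 h2 h2 <;> simp only [Prod.mk.injEq, Fin.ext_iff, Fin.le_def] at * <;> omega

/-- The periodic band matrix of a spin configuration. -/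
def bandOf (b : ℕ) (y : Fin n × Fin n → ℝ) : Matrix (Fin n) (Fin n) ℝ :=
  Matrix.of fun i j => 1 / √(b : ℝ) * (if Relevant b i j then y (ordPair i j) else 0)

theorem bandMatrix_symmetrize {Ω : Type*} (a' : (n : ℕ) → Fin n × Fin n → Ω → ℝ) (b : ℕ → ℕ)
    (n : ℕ) (ω : Ω) :
    bandMatrix (symmetrize a') b n ω = bandOf (b n) fun p => a' n p ω := by
  ext i j
  simp only [bandMatrix, bandOf, Matrix.of_apply, symmetrize_eq, ordPair]

theorem bandOf_isHermitian (b : ℕ) (y : Fin n × Fin n → ℝ) : (bandOf b y).IsHermitian := by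
  ext i j
  have : ordPair j i = ordPair i j := (ordPair_eq_iff i j j i).2 (Or.inr ⟨rfl, rfl⟩)
  simp only [bandOf, Matrix.conjTranspose_apply, Matrix.of_apply, star_trivial, this,
    relevant_comm b j i]

/-- The indices relevant to row `i`. -/
def rowSet (b : ℕ) (i : Fin n) : Finset (Fin n) := Finset.univ.filter fun j => Relevant b i j

/-- For b = 2k + 1 < n, row i consists of i - k, …, i + k modulo n. Every row having exactly b
entries makes `localAvg` a genuine average. -/
theorem card_rowSet {b : ℕ} (hb : IsBandwidth n b) (i : Fin n) : (rowSet b i).card = b := by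
  rcases hb with ⟨hbn, k, hk⟩ | rfl
  · have hn : 0 < n := by omega
    have h2 : ((b : ℤ) - 1) / 2 = k := by omega
    have hi := i.2
    -- The added n prevents truncation in the subtraction of k; values stay below 3n.
    let f : Fin b → Fin n := fun t => ⟨(i + n + t - k) % n, Nat.mod_lt _ hn⟩
    have hfv : ∀ t : Fin b, ((f t : ℕ) : ℤ) = i + t - k ∨ ((f t : ℕ) : ℤ) = i + t - k + n
        ∨ ((f t : ℕ) : ℤ) = i + t - k - n := by
      intro t
      have ht := t.2
      change (((i + n + t - k) % n : ℕ) : ℤ) = _ ∨ (((i + n + t - k) % n : ℕ) : ℤ) = _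
        ∨ (((i + n + t - k) % n : ℕ) : ℤ) = _
      rcases lt_or_ge (i + n + t - k : ℕ) n with h | h
      · rw [Nat.mod_eq_of_lt h]; omega
      · rcases lt_or_ge (i + n + t - k : ℕ) (2 * n) with h' | h'
        · rw [Nat.mod_eq_sub_mod h, Nat.mod_eq_of_lt (by omega)]; omega
        · rw [Nat.mod_eq_sub_mod h, Nat.mod_eq_sub_mod (by omega), Nat.mod_eq_of_lt (by omega)]
          omega
    have hinj : Function.Injective f := by
      intro t t' h
      have h1 := hfv t
      have h1' := hfv t'
      rw [h] at h1
      have ht := t.2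
      have ht' := t'.2
      ext
      omega
    have : rowSet b i = Finset.univ.image f := by
      ext j
      have hj := j.2
      simp only [rowSet, Finset.mem_filter, Finset.mem_univ, true_and, Finset.mem_image, Relevant, h2]
      constructor
      · intro h
        have hcase : ∃ t : ℕ, t < b ∧ ((j : ℤ) = i + t - k ∨ (j : ℤ) = i + t - k + n
            ∨ (j : ℤ) = i + t - k - n) := by
          rcases h with h | h | h
          · omega
          · rw [abs_le] at h
            exact ⟨((j : ℤ) - i + k).toNat, by omega, by omega⟩
          · rcases le_abs.1 h with h | h
            · exact ⟨((j : ℤ) - i + k + n).toNat, by omega, by omega⟩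
            · exact ⟨((j : ℤ) - i + k - n).toNat, by omega, by omega⟩
        obtain ⟨t, ht, htj⟩ := hcase
        refine ⟨⟨t, ht⟩, ?_⟩
        have h1 := hfv ⟨t, ht⟩
        have h3 := (f ⟨t, ht⟩).2
        ext
        simp only at h1
        omega
      · rintro ⟨t, rfl⟩
        have h1 := hfv t
        have h3 := (f t).2
        have ht := t.2
        right
        rcases h1 with h1 | h1 | h1
        · left; rw [abs_le]; omega
        · right; rw [h1]; refine le_trans ?_ (neg_le_abs _); omega
        · right; rw [h1]; refine le_trans ?_ (le_abs_self _); omega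
    rw [this, Finset.card_image_of_injective _ hinj, Finset.card_univ, Fintype.card_fin]
  · simp [rowSet, Relevant]

theorem bandwidth_pos {b : ℕ} (hn : 1 ≤ n) (hb : IsBandwidth n b) : 1 ≤ b := by
  rcases hb with ⟨_, k, hk⟩ | rfl <;> omega

theorem bandwidth_le {b : ℕ} (hb : IsBandwidth n b) : b ≤ n := by
  rcases hb with ⟨h, _⟩ | rfl <;> omega

/-- The resolvent of the band matrix of a spin configuration. -/
def bandRes (η : ℝ) (b : ℕ) (y : Fin n × Fin n → ℝ) : Matrix (Fin n) (Fin n) ℂ :=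
  resolv η (bandOf b y)

theorem bandOf_update_sub (b : ℕ) (y : Fin n × Fin n → ℝ) {i j : Fin n} (h : Relevant b i j) :
    bandOf b (Function.update y (ordPair i j) 1) - bandOf b (Function.update y (ordPair i j) (-1))
      = Matrix.single i j (2 * (1 / √(b : ℝ)))
        + if i = j then 0 else Matrix.single j i (2 * (1 / √(b : ℝ))) := by
  ext k l
  simp only [bandOf, Matrix.sub_apply, Matrix.of_apply, Matrix.add_apply]
  by_cases hkl : ordPair k l = ordPair i j
  · have hr : Relevant b k l := by
      rcases (ordPair_eq_iff i j k l).1 hkl with ⟨rfl, rfl⟩ | ⟨rfl, rfl⟩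
      · exact h
      · exact (relevant_comm b _ _).1 h
    simp only [hkl, hr, if_true, Function.update_self]
    rcases (ordPair_eq_iff i j k l).1 hkl with ⟨rfl, rfl⟩ | ⟨rfl, rfl⟩
    · rw [Matrix.single_apply_same]
      split_ifs with hij
      · simp; ring
      · rw [Matrix.single_apply_of_ne _ _ _ _ _ (fun h => hij h.1.symm)]; ring
    · split_ifs with hij
      · subst hij; rw [Matrix.single_apply_same]; simp; ring
      · rw [Matrix.single_apply_same, Matrix.single_apply_of_ne _ _ _ _ _ (fun h => hij h.1)]; ring
  · simp only [Function.update_of_ne hkl, sub_self]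
    have h1 : ¬ (i = k ∧ j = l) := fun h => hkl ((ordPair_eq_iff i j k l).2 (Or.inl ⟨h.1.symm, h.2.symm⟩))
    have h2 : ¬ (j = k ∧ i = l) := fun h => hkl ((ordPair_eq_iff i j k l).2 (Or.inr ⟨h.1.symm, h.2.symm⟩))
    rw [Matrix.single_apply_of_ne _ _ _ _ _ h1]
    split_ifs
    · simp
    · rw [Matrix.single_apply_of_ne _ _ _ _ _ h2]; simp

theorem mul_single_mul_apply {m : Type*} [Fintype m] [DecidableEq m] (G K : Matrix m m ℂ)
    (i j k l : m) (c : ℂ) : (G * Matrix.single i j c * K) k l = c * (G k i * K j l) := by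
  rw [Matrix.mul_assoc, Matrix.mul_apply, Finset.sum_eq_single i]
  · rw [Matrix.single_mul_apply_same]; ring
  · intro p _ hp
    rw [Matrix.single_mul_apply_of_ne _ _ _ _ _ hp, mul_zero]
  · simp

/-- The resolvent identity for a perturbation of rank at most two; a diagonal spin changes only one
matrix entry, hence the case distinction. -/
theorem bandRes_flip {η : ℝ} (hη : 0 < η) (b : ℕ) (y : Fin n × Fin n → ℝ) {i j : Fin n}
    (h : Relevant b i j) (k l : Fin n) :
    bandRes η b (Function.update y (ordPair i j) 1) k l
        - bandRes η b (Function.update y (ordPair i j) (-1)) k l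
      = -(2 * (1 / √(b : ℝ) : ℝ) *
        (bandRes η b (Function.update y (ordPair i j) 1) k i
            * bandRes η b (Function.update y (ordPair i j) (-1)) j l
          + if i = j then 0 else bandRes η b (Function.update y (ordPair i j) 1) k j
            * bandRes η b (Function.update y (ordPair i j) (-1)) i l)) := by
  have h1 := congrFun (congrFun (resolv_sub hη
    (bandOf_isHermitian b (Function.update y (ordPair i j) 1))
    (bandOf_isHermitian b (Function.update y (ordPair i j) (-1)))) k) l
  rw [bandOf_update_sub b y h, Matrix.sub_apply, Matrix.neg_apply] at h1
  rw [bandRes, bandRes, h1]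
  congr 1
  have hs : ∀ p q : Fin n, (Matrix.single p q (2 * (1 / √(b : ℝ)))).map Complex.ofReal
      = Matrix.single p q ((2 * (1 / √(b : ℝ) : ℝ) : ℂ)) := by
    intro p q
    ext r s
    simp only [Matrix.map_apply, Matrix.single_apply]
    split_ifs <;> simp
  split_ifs with hij
  · rw [add_zero, add_zero, hs, mul_single_mul_apply]
  · have : (Matrix.single i j (2 * (1 / √(b : ℝ))) + Matrix.single j i (2 * (1 / √(b : ℝ)))).map
        Complex.ofReal = Matrix.single i j ((2 * (1 / √(b : ℝ) : ℝ) : ℂ))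
          + Matrix.single j i ((2 * (1 / √(b : ℝ) : ℝ) : ℂ)) := by
      rw [← hs, ← hs]; ext r s; simp
    rw [this, Matrix.mul_add, Matrix.add_mul, Matrix.add_apply, mul_single_mul_apply,
      mul_single_mul_apply]
    ring

theorem norm_bandRes_le {η : ℝ} (hη : 2 ≤ η) (b : ℕ) (y : Fin n × Fin n → ℝ) (k l : Fin n) :
    ‖bandRes η b y k l‖ ≤ 1 / 2 := by
  refine (norm_resolv_le (by linarith) (bandOf_isHermitian b y) k l).trans ?_
  rw [one_div]
  exact inv_anti₀ two_pos hη

theorem sum_norm_sq_bandRes_le {η : ℝ} (hη : 2 ≤ η) (b : ℕ) (y : Fin n × Fin n → ℝ) (k : Fin n)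
    (s : Finset (Fin n)) : ∑ l ∈ s, ‖bandRes η b y k l‖ ^ 2 ≤ 1 / 4 := by
  refine (Finset.sum_le_univ_sum_of_nonneg fun l => by positivity).trans
    ((sum_norm_sq_resolv_le (by linarith) (bandOf_isHermitian b y) k).trans ?_)
  rw [show (1 / 4 : ℝ) = (2 ^ 2)⁻¹ by norm_num]
  exact inv_anti₀ (by norm_num) (pow_le_pow_left₀ two_pos.le hη 2)

theorem bandRes_symm (η : ℝ) (b : ℕ) (y : Fin n × Fin n → ℝ) (k l : Fin n) :
    bandRes η b y k l = bandRes η b y l k :=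
  resolv_symm η (bandOf_isHermitian b y) k l

end Band

/-! ### Sensitivity of the resolvent to a single spin -/

section Sensitivity

variable {n : ℕ}

/-- The average of the diagonal resolvent entries over the indices relevant to row `i`. -/
def localAvg (η : ℝ) (b : ℕ) (y : Fin n × Fin n → ℝ) (i : Fin n) : ℂ :=
  (b : ℂ)⁻¹ * ∑ j ∈ rowSet b i, bandRes η b y j j

/-- The error in the self-consistent equation for the diagonal resolvent entry at `i`. -/
def selfErr (η : ℝ) (b : ℕ) (y : Fin n × Fin n → ℝ) (i : Fin n) : ℂ :=
  (η * Complex.I + localAvg η b y i) * bandRes η b y i i + 1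

theorem norm_bandRes_flip_le {η : ℝ} (hη : 2 ≤ η) (b : ℕ) (y : Fin n × Fin n → ℝ) {i j : Fin n}
    (h : Relevant b i j) (k l : Fin n) :
    ‖bandRes η b (Function.update y (ordPair i j) 1) k l
        - bandRes η b (Function.update y (ordPair i j) (-1)) k l‖ ≤ 1 / √(b : ℝ) := by
  rw [bandRes_flip (by linarith) b y h]
  set G₁ := bandRes η b (Function.update y (ordPair i j) 1)
  set G₂ := bandRes η b (Function.update y (ordPair i j) (-1))
  set κ : ℝ := 1 / √(b : ℝ) with hκ
  have hκ0 : 0 ≤ κ := by positivity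
  have b1 : ∀ p q, ‖G₁ p q‖ ≤ 1 / 2 := norm_bandRes_le hη b _
  have b2 : ∀ p q, ‖G₂ p q‖ ≤ 1 / 2 := norm_bandRes_le hη b _
  have hp : ∀ p q r s, ‖G₁ p q * G₂ r s‖ ≤ 1 / 4 := by
    intro p q r s
    rw [norm_mul]
    nlinarith [b1 p q, b2 r s, norm_nonneg (G₁ p q), norm_nonneg (G₂ r s)]
  have h2 : ‖if i = j then 0 else G₁ k j * G₂ i l‖ ≤ 1 / 4 := by
    split_ifs
    · simp
    · exact hp _ _ _ _
  rw [norm_neg, norm_mul, norm_mul, Complex.norm_real, Real.norm_of_nonneg hκ0, Complex.norm_ofNat]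
  have := (norm_add_le (G₁ k i * G₂ j l) (if i = j then 0 else G₁ k j * G₂ i l)).trans
    (add_le_add (hp k i j l) h2)
  nlinarith

theorem norm_bandRes_update_sub_le {η : ℝ} (hη : 2 ≤ η) (b : ℕ) {y : Fin n × Fin n → ℝ}
    (hy : y ∈ spinConfigs (Fin n × Fin n)) {i j : Fin n} (h : Relevant b i j) (k l : Fin n) {c : ℝ}
    (hc : c = 1 ∨ c = -1) :
    ‖bandRes η b (Function.update y (ordPair i j) c) k l - bandRes η b y k l‖ ≤ 1 / √(b : ℝ) := by
  have h1 := norm_bandRes_flip_le hη b y h k l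
  have h0 : (0 : ℝ) ≤ 1 / √(b : ℝ) := by positivity
  rcases eq_update_or hy (ordPair i j) with hy' | hy' <;> rcases hc with rfl | rfl
  · rw [← hy', sub_self, norm_zero]; exact h0
  · rw [← hy', norm_sub_rev] at h1; exact h1
  · rw [← hy'] at h1; exact h1
  · rw [← hy', sub_self, norm_zero]; exact h0

theorem norm_bandRes_update_le {η : ℝ} (hη : 2 ≤ η) (b : ℕ) {y : Fin n × Fin n → ℝ}
    (hy : y ∈ spinConfigs (Fin n × Fin n)) {i j : Fin n} (h : Relevant b i j) (k l : Fin n) {c : ℝ}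
    (hc : c = 1 ∨ c = -1) :
    ‖bandRes η b (Function.update y (ordPair i j) c) k l‖
      ≤ ‖bandRes η b y k l‖ + 1 / √(b : ℝ) := by
  have h1 := norm_bandRes_update_sub_le hη b hy h k l hc
  have h2 := norm_le_norm_add_norm_sub' (bandRes η b (Function.update y (ordPair i j) c) k l)
    (bandRes η b y k l)
  linarith

/-- The factor |G_ij| is kept, not bounded by 1/2: its squares sum over j to at most 1/4. -/
theorem norm_bandRes_diag_flip_le {η : ℝ} (hη : 2 ≤ η) (b : ℕ) {y : Fin n × Fin n → ℝ}
    (hy : y ∈ spinConfigs (Fin n × Fin n)) {i j : Fin n} (h : Relevant b i j) :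
    ‖bandRes η b (Function.update y (ordPair i j) 1) i i
        - bandRes η b (Function.update y (ordPair i j) (-1)) i i‖
      ≤ 2 * (1 / √(b : ℝ)) * (‖bandRes η b y i j‖ + 1 / √(b : ℝ)) := by
  have u1 := norm_bandRes_update_le hη b hy h i j (c := 1) (Or.inl rfl)
  have u2 := norm_bandRes_update_le hη b hy h j i (c := -1) (Or.inr rfl)
  rw [bandRes_symm η b y j i] at u2
  rw [bandRes_flip (by linarith) b y h]
  set G₁ := bandRes η b (Function.update y (ordPair i j) 1)
  set G₂ := bandRes η b (Function.update y (ordPair i j) (-1))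
  set κ : ℝ := 1 / √(b : ℝ) with hκ
  set g := ‖bandRes η b y i j‖
  have hg : 0 ≤ g := norm_nonneg _
  have hκ0 : 0 ≤ κ := by positivity
  have b1 : ‖G₁ i i‖ ≤ 1 / 2 := norm_bandRes_le hη b _ _ _
  have b2 : ‖G₂ i i‖ ≤ 1 / 2 := norm_bandRes_le hη b _ _ _
  have h1 : ‖G₁ i i * G₂ j i‖ ≤ 1 / 2 * (g + κ) := by
    rw [norm_mul]; exact mul_le_mul b1 u2 (norm_nonneg _) (by norm_num)
  have h2 : ‖if i = j then 0 else G₁ i j * G₂ i i‖ ≤ 1 / 2 * (g + κ) := by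
    split_ifs
    · rw [norm_zero]; positivity
    · rw [norm_mul, mul_comm (1 / 2 : ℝ)]; exact mul_le_mul u1 b2 (norm_nonneg _) (by positivity)
  rw [norm_neg, norm_mul, norm_mul, Complex.norm_real, Real.norm_of_nonneg hκ0, Complex.norm_ofNat]
  refine mul_le_mul_of_nonneg_left ?_ (by positivity)
  have := norm_add_le (G₁ i i * G₂ j i) (if i = j then 0 else G₁ i j * G₂ i i)
  linarith

theorem inv_sqrt_sq (b : ℕ) : (1 / √(b : ℝ)) ^ 2 = (b : ℝ)⁻¹ := by
  rw [div_pow, Real.sq_sqrt (Nat.cast_nonneg b), one_pow, one_div]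

theorem inv_sqrt_le_one {b : ℕ} (hb : 1 ≤ b) : 1 / √(b : ℝ) ≤ 1 := by
  rw [div_le_one (Real.sqrt_pos.2 (by exact_mod_cast hb))]
  exact Real.one_le_sqrt.2 (by exact_mod_cast hb)

/-- Summing the flip formula over diagonal entries with the row bound ∑_k |G_ik|² ≤ 1/4 shows that
the average moves by at most 1/b, whereas entrywise bounds would only give b^(-1/2). -/
theorem norm_localAvg_flip_le {η : ℝ} (hη : 2 ≤ η) {b : ℕ} (hb : 1 ≤ b) (y : Fin n × Fin n → ℝ)
    {i j : Fin n} (h : Relevant b i j) :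
    ‖localAvg η b (Function.update y (ordPair i j) 1) i
        - localAvg η b (Function.update y (ordPair i j) (-1)) i‖ ≤ (1 / √(b : ℝ)) ^ 2 := by
  rw [localAvg, localAvg, ← mul_sub, ← Finset.sum_sub_distrib, norm_mul, norm_inv,
    Complex.norm_natCast, inv_sqrt_sq]
  refine mul_le_of_le_one_right (by positivity) ((norm_sum_le _ _).trans ?_)
  set G₁ := bandRes η b (Function.update y (ordPair i j) 1) with hG₁
  set G₂ := bandRes η b (Function.update y (ordPair i j) (-1)) with hG₂
  have hκ1 := inv_sqrt_le_one hb
  have hpt : ∀ k, ‖G₁ k k - G₂ k k‖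
      ≤ ‖G₁ i k‖ ^ 2 + ‖G₂ j k‖ ^ 2 + (‖G₁ j k‖ ^ 2 + ‖G₂ i k‖ ^ 2) := by
    intro k
    rw [hG₁, hG₂, bandRes_flip (by linarith) b y h, ← hG₁, ← hG₂]
    set κ : ℝ := 1 / √(b : ℝ) with hκ
    have hκ0 : 0 ≤ κ := by positivity
    have s1 : G₁ k i = G₁ i k := bandRes_symm _ _ _ _ _
    have s2 : G₁ k j = G₁ j k := bandRes_symm _ _ _ _ _
    rw [s1, s2]
    have h1 : ‖G₁ i k * G₂ j k‖ ≤ (‖G₁ i k‖ ^ 2 + ‖G₂ j k‖ ^ 2) / 2 := by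
      rw [norm_mul]; nlinarith [sq_nonneg (‖G₁ i k‖ - ‖G₂ j k‖)]
    have h2 : ‖if i = j then 0 else G₁ j k * G₂ i k‖ ≤ (‖G₁ j k‖ ^ 2 + ‖G₂ i k‖ ^ 2) / 2 := by
      split_ifs
      · rw [norm_zero]; positivity
      · rw [norm_mul]; nlinarith [sq_nonneg (‖G₁ j k‖ - ‖G₂ i k‖)]
    rw [norm_neg, norm_mul, norm_mul, Complex.norm_real, Real.norm_of_nonneg hκ0,
      Complex.norm_ofNat]
    have h3 := norm_add_le (G₁ i k * G₂ j k) (if i = j then 0 else G₁ j k * G₂ i k)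
    set X := ‖G₁ i k * G₂ j k + if i = j then 0 else G₁ j k * G₂ i k‖
    have hX : 0 ≤ X := norm_nonneg _
    nlinarith
  refine (Finset.sum_le_sum fun k _ => hpt k).trans ?_
  rw [Finset.sum_add_distrib, Finset.sum_add_distrib, Finset.sum_add_distrib]
  have q1 := sum_norm_sq_bandRes_le hη b (Function.update y (ordPair i j) 1) i (rowSet b i)
  have q2 := sum_norm_sq_bandRes_le hη b (Function.update y (ordPair i j) (-1)) j (rowSet b i)
  have q3 := sum_norm_sq_bandRes_le hη b (Function.update y (ordPair i j) 1) j (rowSet b i)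
  have q4 := sum_norm_sq_bandRes_le hη b (Function.update y (ordPair i j) (-1)) i (rowSet b i)
  linarith

theorem norm_localAvg_le {η : ℝ} (hη : 2 ≤ η) {b : ℕ} (hb : IsBandwidth n b)
    (y : Fin n × Fin n → ℝ) (i : Fin n) : ‖localAvg η b y i‖ ≤ 1 / 2 := by
  rw [localAvg, norm_mul, norm_inv, Complex.norm_natCast]
  have h1 : ‖∑ j ∈ rowSet b i, bandRes η b y j j‖ ≤ b * (1 / 2) := by
    refine (norm_sum_le _ _).trans ?_
    rw [← card_rowSet hb i, ← nsmul_eq_mul, card_rowSet hb i]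
    have := Finset.sum_le_card_nsmul (rowSet b i) (fun j => ‖bandRes η b y j j‖) (1 / 2)
      fun j _ => norm_bandRes_le hη b y j j
    rwa [card_rowSet hb i] at this
  rcases Nat.eq_zero_or_pos b with h0 | h0
  · simp [h0]
  · rw [inv_mul_le_iff₀ (by exact_mod_cast h0)]; exact h1

theorem norm_selfErr_flip_le {η : ℝ} (hη : 2 ≤ η) {b : ℕ} (hb1 : 1 ≤ b) (hb : IsBandwidth n b)
    {y : Fin n × Fin n → ℝ} (hy : y ∈ spinConfigs (Fin n × Fin n)) {i j : Fin n}
    (h : Relevant b i j) :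
    ‖selfErr η b (Function.update y (ordPair i j) 1) i
        - selfErr η b (Function.update y (ordPair i j) (-1)) i‖
      ≤ 3 * (η + 1) * (1 / √(b : ℝ)) * (‖bandRes η b y i j‖ + 1 / √(b : ℝ)) := by
  have h1 := norm_bandRes_diag_flip_le hη b hy h
  have h2 := norm_localAvg_flip_le hη hb1 y h
  have h3 := norm_localAvg_le hη hb (Function.update y (ordPair i j) (-1)) i
  have h4 := norm_bandRes_le hη b (Function.update y (ordPair i j) 1) i i
  rw [selfErr, selfErr]
  set G₁ := bandRes η b (Function.update y (ordPair i j) 1) i i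
  set G₂ := bandRes η b (Function.update y (ordPair i j) (-1)) i i
  set H₁ := localAvg η b (Function.update y (ordPair i j) 1) i
  set H₂ := localAvg η b (Function.update y (ordPair i j) (-1)) i
  set κ : ℝ := 1 / √(b : ℝ) with hκ
  set g := ‖bandRes η b y i j‖
  have hg : 0 ≤ g := norm_nonneg _
  have hκ0 : 0 ≤ κ := by positivity
  have e : (η * Complex.I + H₁) * G₁ + 1 - ((η * Complex.I + H₂) * G₂ + 1)
      = (η * Complex.I + H₂) * (G₁ - G₂) + (H₁ - H₂) * G₁ := by ring
  have h5 : ‖(η * Complex.I + H₂ : ℂ)‖ ≤ η + 1 / 2 := by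
    refine (norm_add_le _ _).trans (add_le_add (le_of_eq ?_) h3)
    simp [abs_of_nonneg (by linarith : (0 : ℝ) ≤ η)]
  rw [e]
  refine (norm_add_le _ _).trans ?_
  rw [norm_mul, norm_mul]
  have h6 : ‖(η * Complex.I + H₂ : ℂ)‖ * ‖G₁ - G₂‖ ≤ (η + 1 / 2) * (2 * κ * (g + κ)) :=
    mul_le_mul h5 h1 (norm_nonneg _) (by linarith)
  have h7 : ‖H₁ - H₂‖ * ‖G₁‖ ≤ κ ^ 2 * (1 / 2) := mul_le_mul h2 h4 (norm_nonneg _) (by positivity)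
  have h8 : 0 ≤ κ * g := by positivity
  nlinarith [mul_nonneg (by linarith : (0 : ℝ) ≤ η) h8, mul_nonneg (by linarith : (0 : ℝ) ≤ η) (sq_nonneg κ)]

theorem norm_selfErr_update_le {η : ℝ} (hη : 2 ≤ η) {b : ℕ} (hb1 : 1 ≤ b) (hb : IsBandwidth n b)
    {y : Fin n × Fin n → ℝ} (hy : y ∈ spinConfigs (Fin n × Fin n)) {i j : Fin n}
    (h : Relevant b i j) {c : ℝ} (hc : c = 1 ∨ c = -1) :
    ‖selfErr η b (Function.update y (ordPair i j) c) i‖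
      ≤ ‖selfErr η b y i‖ + 6 * (η + 1) * (1 / √(b : ℝ)) := by
  have h1 := norm_selfErr_flip_le hη hb1 hb hy h
  have h2 : ‖selfErr η b (Function.update y (ordPair i j) 1) i
        - selfErr η b (Function.update y (ordPair i j) (-1)) i‖ ≤ 6 * (η + 1) * (1 / √(b : ℝ)) := by
    refine h1.trans ?_
    have h3 := norm_bandRes_le hη b y i j
    have h4 := inv_sqrt_le_one hb1
    have h5 : 0 ≤ 3 * (η + 1) * (1 / √(b : ℝ)) := by positivity
    nlinarith
  have h0 : 0 ≤ 6 * (η + 1) * (1 / √(b : ℝ)) := by positivity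
  rcases eq_update_or hy (ordPair i j) with hy' | hy' <;> rcases hc with rfl | rfl
  · rw [← hy']; linarith
  · rw [← hy'] at h2
    have := norm_le_norm_add_norm_sub (selfErr η b y i)
      (selfErr η b (Function.update y (ordPair i j) (-1)) i)
    linarith
  · rw [← hy'] at h2
    have := norm_le_norm_add_norm_sub' (selfErr η b (Function.update y (ordPair i j) 1) i)
      (selfErr η b y i)
    linarith
  · rw [← hy']; linarith

/-- The test function `w ↦ conj w * |w|⁴`. -/
def conjQuint (w : ℂ) : ℂ := (starRingEnd ℂ) w * (‖w‖ : ℂ) ^ 4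

theorem mul_conjQuint (w : ℂ) : w * conjQuint w = ((‖w‖ ^ 6 : ℝ) : ℂ) := by
  rw [conjQuint, ← mul_assoc, Complex.mul_conj']; push_cast; ring

theorem norm_conjQuint (w : ℂ) : ‖conjQuint w‖ = ‖w‖ ^ 5 := by
  rw [conjQuint, norm_mul, RCLike.norm_conj, norm_pow, Complex.norm_real, norm_norm]; ring

theorem norm_conjQuint_sub_le {v w : ℂ} {M : ℝ} (hv : ‖v‖ ≤ M) (hw : ‖w‖ ≤ M) :
    ‖conjQuint v - conjQuint w‖ ≤ 5 * ‖v - w‖ * M ^ 4 := by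
  have hM : 0 ≤ M := (norm_nonneg v).trans hv
  have e : conjQuint v - conjQuint w = (starRingEnd ℂ) (v - w) * (‖v‖ : ℂ) ^ 4
      + (starRingEnd ℂ) w * ((‖v‖ ^ 4 - ‖w‖ ^ 4 : ℝ) : ℂ) := by
    rw [conjQuint, conjQuint, map_sub]; push_cast; ring
  have h1 : |‖v‖ ^ 4 - ‖w‖ ^ 4| ≤ ‖v - w‖ * 4 * M ^ 3 := by
    have h := abs_pow_sub_pow_le ‖v‖ ‖w‖ 4
    rw [abs_norm, abs_norm] at h
    refine h.trans ?_
    have h2 := abs_norm_sub_norm_le v w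
    have h3 : max ‖v‖ ‖w‖ ≤ M := max_le hv hw
    push_cast
    gcongr
  rw [e]
  refine (norm_add_le _ _).trans ?_
  rw [norm_mul, norm_mul, RCLike.norm_conj, RCLike.norm_conj, norm_pow, Complex.norm_real,
    Complex.norm_real, norm_norm, Real.norm_eq_abs]
  have h2 : ‖v - w‖ * ‖v‖ ^ 4 ≤ ‖v - w‖ * M ^ 4 := by gcongr
  have h3 : ‖w‖ * |‖v‖ ^ 4 - ‖w‖ ^ 4| ≤ M * (‖v - w‖ * 4 * M ^ 3) :=
    mul_le_mul hw h1 (abs_nonneg _) hM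
  calc _ ≤ ‖v - w‖ * M ^ 4 + M * (‖v - w‖ * 4 * M ^ 3) := add_le_add h2 h3
    _ = _ := by ring

end Sensitivity

/-! ### Sixth moment of the error in the self-consistent equation -/

/-- One spin (i, j) of the expansion of E|W_i|⁶: here κ = b^(-1/2), g = |G_ij|, d and e stand for
G_jj and G_ii, F for the test function, and indices 1, 2 mark the spin set to +1, -1. The bound is
shaped so that it can be summed over a row using ∑ g² ≤ 1/4 and bκ² = 1. -/
theorem norm_stein_term_le {κ c A t τ g : ℝ} {G₁ G₂ d d₁ e e₂ x F F₁ F₂ : ℂ}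
    (hκ : 0 ≤ κ) (hA : 0 ≤ A) (hg : 0 ≤ g) (hc : 0 ≤ c)
    (hG : G₁ - G₂ = -(2 * κ * (d₁ * e₂ + x))) (hx : ‖x‖ ≤ (g + κ) ^ 2)
    (hd₁ : ‖d₁ - d‖ ≤ κ) (he₂ : ‖e₂ - e‖ ≤ κ) (hd : ‖d‖ ≤ 1 / 2) (he : ‖e₂‖ ≤ 1 / 2)
    (hG₁ : ‖G₁‖ ≤ g + κ) (hG₂ : ‖G₂‖ ≤ g + κ)
    (hF : ‖F‖ ≤ A ^ 5) (hF₁ : ‖F₁‖ ≤ A ^ 5) (hF₂ : ‖F₂‖ ≤ A ^ 5)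
    (hF₁₂ : ‖F₁ - F₂‖ ≤ 5 * (c * κ * (g + κ)) * A ^ 4)
    (hF₁' : ‖F₁ - F‖ ≤ 5 * (c * κ * (g + κ)) * A ^ 4) (ht : |t| ≤ τ) :
    ‖((2 : ℝ)⁻¹ • ((κ : ℂ) * (G₁ * F₁) - κ * (G₂ * F₂))
        + (t * 2⁻¹) • ((κ : ℂ) * (G₁ * F₁) + κ * (G₂ * F₂))) + (κ : ℂ) ^ 2 * (d * e * F)‖
      ≤ A ^ 5 * (κ ^ 3 + 2 * κ ^ 2 * g ^ 2 + 2 * κ ^ 4) + 15 * c * κ ^ 2 * A ^ 4 * (g ^ 2 + κ ^ 2)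
        + τ * A ^ 5 * (g ^ 2 + 2 * κ ^ 2) := by
  have hτ : 0 ≤ τ := (abs_nonneg t).trans ht
  have hgκ : 0 ≤ g + κ := by positivity
  have split : ((2 : ℝ)⁻¹ • ((κ : ℂ) * (G₁ * F₁) - κ * (G₂ * F₂))
        + (t * 2⁻¹) • ((κ : ℂ) * (G₁ * F₁) + κ * (G₂ * F₂))) + (κ : ℂ) ^ 2 * (d * e * F)
      = ((κ : ℂ) ^ 2 * (((d - d₁) * e₂ - d * (e₂ - e) - x) * F)
        + (κ : ℂ) / 2 * ((G₁ - G₂) * (F₁ - F) + G₂ * (F₁ - F₂)))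
        + ((κ * t / 2 : ℝ) : ℂ) * (G₁ * F₁ + G₂ * F₂) := by
    -- The crucial cancellation: the derivative of G_ji contributes -κ² d₁e₂F, which meets the
    -- counterterm κ² deF up to O(κ³).
    have h2 : (κ : ℂ) / 2 * ((G₁ - G₂) * F) = -((κ : ℂ) ^ 2 * ((d₁ * e₂ + x) * F)) := by
      rw [hG]; ring
    simp only [Complex.real_smul]
    push_cast
    linear_combination h2
  rw [split]
  have n1 : ‖(κ : ℂ) ^ 2 * (((d - d₁) * e₂ - d * (e₂ - e) - x) * F)‖
      ≤ κ ^ 2 * ((κ + (g + κ) ^ 2) * A ^ 5) := by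
    rw [norm_mul, norm_pow, Complex.norm_real, Real.norm_of_nonneg hκ, norm_mul]
    have a1 : ‖(d - d₁) * e₂‖ ≤ κ * (1 / 2) := by
      rw [norm_mul, norm_sub_rev]; exact mul_le_mul hd₁ he (norm_nonneg _) hκ
    have a2 : ‖d * (e₂ - e)‖ ≤ 1 / 2 * κ := by
      rw [norm_mul]; exact mul_le_mul hd he₂ (norm_nonneg _) (by norm_num)
    have a3 : ‖(d - d₁) * e₂ - d * (e₂ - e) - x‖ ≤ κ + (g + κ) ^ 2 := by
      have := norm_sub_le ((d - d₁) * e₂ - d * (e₂ - e)) x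
      have := norm_sub_le ((d - d₁) * e₂) (d * (e₂ - e))
      linarith
    gcongr
  have n2 : ‖(κ : ℂ) / 2 * ((G₁ - G₂) * (F₁ - F) + G₂ * (F₁ - F₂))‖
      ≤ κ / 2 * (3 * (g + κ) * (5 * (c * κ * (g + κ)) * A ^ 4)) := by
    rw [norm_mul, norm_div, Complex.norm_real, Real.norm_of_nonneg hκ, Complex.norm_ofNat]
    refine mul_le_mul_of_nonneg_left ?_ (by positivity)
    have a1 : ‖G₁ - G₂‖ ≤ 2 * (g + κ) := by have := norm_sub_le G₁ G₂; linarith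
    have a2 : ‖(G₁ - G₂) * (F₁ - F)‖ ≤ 2 * (g + κ) * (5 * (c * κ * (g + κ)) * A ^ 4) := by
      rw [norm_mul]; exact mul_le_mul a1 hF₁' (norm_nonneg _) (by positivity)
    have a3 : ‖G₂ * (F₁ - F₂)‖ ≤ (g + κ) * (5 * (c * κ * (g + κ)) * A ^ 4) := by
      rw [norm_mul]; exact mul_le_mul hG₂ hF₁₂ (norm_nonneg _) (by positivity)
    refine (norm_add_le _ _).trans ?_
    linarith
  have n3 : ‖((κ * t / 2 : ℝ) : ℂ) * (G₁ * F₁ + G₂ * F₂)‖ ≤ κ * τ * ((g + κ) * A ^ 5) := by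
    rw [norm_mul, Complex.norm_real, Real.norm_eq_abs, abs_div, abs_mul, abs_of_nonneg hκ, abs_two]
    have a1 : ‖G₁ * F₁‖ ≤ (g + κ) * A ^ 5 := by
      rw [norm_mul]; exact mul_le_mul hG₁ hF₁ (norm_nonneg _) hgκ
    have a2 : ‖G₂ * F₂‖ ≤ (g + κ) * A ^ 5 := by
      rw [norm_mul]; exact mul_le_mul hG₂ hF₂ (norm_nonneg _) hgκ
    have a3 : ‖G₁ * F₁ + G₂ * F₂‖ ≤ 2 * ((g + κ) * A ^ 5) := by
      have := norm_add_le (G₁ * F₁) (G₂ * F₂); linarith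
    calc κ * |t| / 2 * ‖G₁ * F₁ + G₂ * F₂‖ ≤ κ * τ / 2 * (2 * ((g + κ) * A ^ 5)) := by gcongr
      _ = _ := by ring
  have hsq : (g + κ) ^ 2 ≤ 2 * g ^ 2 + 2 * κ ^ 2 := by nlinarith [sq_nonneg (g - κ)]
  have m1 : κ ^ 2 * ((κ + (g + κ) ^ 2) * A ^ 5)
      ≤ A ^ 5 * (κ ^ 3 + 2 * κ ^ 2 * g ^ 2 + 2 * κ ^ 4) := by
    calc _ ≤ κ ^ 2 * ((κ + (2 * g ^ 2 + 2 * κ ^ 2)) * A ^ 5) := by gcongr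
      _ = _ := by ring
  have m2 : κ / 2 * (3 * (g + κ) * (5 * (c * κ * (g + κ)) * A ^ 4))
      ≤ 15 * c * κ ^ 2 * A ^ 4 * (g ^ 2 + κ ^ 2) := by
    calc _ = 15 / 2 * c * κ ^ 2 * A ^ 4 * (g + κ) ^ 2 := by ring
      _ ≤ 15 / 2 * c * κ ^ 2 * A ^ 4 * (2 * g ^ 2 + 2 * κ ^ 2) := by gcongr
      _ = _ := by ring
  have m3 : κ * τ * ((g + κ) * A ^ 5) ≤ τ * A ^ 5 * (g ^ 2 + 2 * κ ^ 2) := by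
    have : κ * (g + κ) ≤ g ^ 2 + 2 * κ ^ 2 := by nlinarith [sq_nonneg (g - κ)]
    calc _ = τ * A ^ 5 * (κ * (g + κ)) := by ring
      _ ≤ _ := by gcongr
  refine (norm_add_le _ _).trans ?_
  have := norm_add_le ((κ : ℂ) ^ 2 * (((d - d₁) * e₂ - d * (e₂ - e) - x) * F))
    ((κ : ℂ) / 2 * ((G₁ - G₂) * (F₁ - F) + G₂ * (F₁ - F₂)))
  linarith

theorem cwExp_ofReal {ι : Type*} [Fintype ι] [DecidableEq ι] (β : ℝ) (f : (ι → ℝ) → ℝ) :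
    cwExp β (fun y => (f y : ℂ)) = ((cwExp β f : ℝ) : ℂ) := by
  simp [cwExp]

section Main

variable {n : ℕ}

theorem abs_condSpin_le {ι : Type*} [Fintype ι] [DecidableEq ι] [Nonempty ι] {β : ℝ} (hβ : 0 ≤ β)
    (hβ1 : β ≤ 1) (e : ι) {y : ι → ℝ} (hy : y ∈ spinConfigs ι) :
    |condSpin β e y| ≤ (1 + |∑ i, y i|) / Fintype.card ι := by
  have hN : (0 : ℝ) < Fintype.card ι := by exact_mod_cast Fintype.card_pos
  rw [condSpin, abs_tanh]
  set u := |β / Fintype.card ι * cavity e y| with hu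
  have hu0 : 0 ≤ u := abs_nonneg _
  have h1 : u ≤ |cavity e y| / Fintype.card ι := by
    rw [hu, abs_mul, abs_div, abs_of_nonneg hβ, abs_of_pos hN, div_mul_eq_mul_div]
    exact div_le_div_of_nonneg_right (mul_le_of_le_one_left (abs_nonneg _) hβ1) hN.le
  have hu1 : u ≤ 1 := h1.trans ((div_le_one hN).2 (abs_cavity_le_card hy e))
  have h2 := tanh_le_self_sub_cube hu0 hu1
  have h3 : |cavity e y| / Fintype.card ι ≤ (1 + |∑ i, y i|) / Fintype.card ι :=
    div_le_div_of_nonneg_right (abs_cavity_le hy e) hN.le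
  have h4 := pow_nonneg hu0 3
  linarith

/-- This is row i of (X - iη) G = 1, with H_i G_ii spread over the row, so that each spin carries
the counterterm which its integration by parts produces. -/
theorem selfErr_eq {η : ℝ} (hη : 0 < η) (b : ℕ) (y : Fin n × Fin n → ℝ) (i : Fin n) :
    selfErr η b y i = ∑ j ∈ rowSet b i, ((y (ordPair i j) : ℂ) *
        ((1 / √(b : ℝ) : ℝ) * bandRes η b y j i)
      + ((1 / √(b : ℝ) : ℝ) : ℂ) ^ 2 * (bandRes η b y j j * bandRes η b y i i)) := by
  have h1 := sum_mul_resolv hη (bandOf_isHermitian b y) i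
  have h2 : ∑ j, ((bandOf b y i j : ℝ) : ℂ) * resolv η (bandOf b y) j i
      = ∑ j ∈ rowSet b i, (y (ordPair i j) : ℂ) * ((1 / √(b : ℝ) : ℝ) * bandRes η b y j i) := by
    rw [rowSet, Finset.sum_filter]
    refine Finset.sum_congr rfl fun j _ => ?_
    simp only [bandOf, Matrix.of_apply, bandRes]
    split_ifs
    · push_cast; ring
    · simp
  have h3 : ((1 / √(b : ℝ) : ℝ) : ℂ) ^ 2 = (b : ℂ)⁻¹ := by
    rw [← Complex.ofReal_pow, inv_sqrt_sq]; simp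
  rw [Finset.sum_add_distrib, ← h2, h1, ← Finset.mul_sum, ← Finset.sum_mul, h3, selfErr, localAvg,
    bandRes]
  ring

theorem cwExp_selfErr_le_of_stein {η : ℝ} (hη : 2 ≤ η) (hn : 1 ≤ n) {b : ℕ} (hb : IsBandwidth n b)
    {β : ℝ} (hβ : 0 ≤ β) (hβ1 : β ≤ 1) (i : Fin n) :
    cwExp β (fun y : Fin n × Fin n → ℝ => ‖selfErr η b y i‖ ^ 6)
      ≤ cwExp β fun y : Fin n × Fin n → ℝ =>
        4 * (1 / √(b : ℝ)) * (‖selfErr η b y i‖ + 6 * (η + 1) * (1 / √(b : ℝ))) ^ 5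
        + 60 * (η + 1) * (1 / √(b : ℝ)) ^ 2
            * (‖selfErr η b y i‖ + 6 * (η + 1) * (1 / √(b : ℝ))) ^ 4
        + 3 * ((1 + |∑ p, y p|) / Fintype.card (Fin n × Fin n))
            * (‖selfErr η b y i‖ + 6 * (η + 1) * (1 / √(b : ℝ))) ^ 5 := by
  have hb1 := bandwidth_pos hn hb
  have : Nonempty (Fin n × Fin n) := ⟨(i, i)⟩
  have hκ1 := inv_sqrt_le_one hb1
  have hκb : (b : ℝ) * (1 / √(b : ℝ)) ^ 2 = 1 := by
    rw [inv_sqrt_sq]; exact mul_inv_cancel₀ (by positivity)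
  set κ : ℝ := 1 / √(b : ℝ) with hκ
  have hκ0 : 0 ≤ κ := by positivity
  set F : (Fin n × Fin n → ℝ) → ℂ := fun y => conjQuint (selfErr η b y i) with hF
  have step : cwExp β (fun y : Fin n × Fin n → ℝ => ((‖selfErr η b y i‖ ^ 6 : ℝ) : ℂ))
      = cwExp β fun y : Fin n × Fin n → ℝ => ∑ j ∈ rowSet b i,
        (((2 : ℝ)⁻¹ • ((κ : ℂ) * (bandRes η b (Function.update y (ordPair i j) 1) j i
              * F (Function.update y (ordPair i j) 1))
            - κ * (bandRes η b (Function.update y (ordPair i j) (-1)) j i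
              * F (Function.update y (ordPair i j) (-1))))
          + (condSpin β (ordPair i j) y * 2⁻¹) •
            ((κ : ℂ) * (bandRes η b (Function.update y (ordPair i j) 1) j i
              * F (Function.update y (ordPair i j) 1))
            + κ * (bandRes η b (Function.update y (ordPair i j) (-1)) j i
              * F (Function.update y (ordPair i j) (-1)))))
          + (κ : ℂ) ^ 2 * (bandRes η b y j j * bandRes η b y i i * F y)) := by
    have e1 : (fun y : Fin n × Fin n → ℝ => ((‖selfErr η b y i‖ ^ 6 : ℝ) : ℂ))
        = fun y => ∑ j ∈ rowSet b i, (y (ordPair i j) • ((κ : ℂ) * (bandRes η b y j i * F y))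
          + (κ : ℂ) ^ 2 * (bandRes η b y j j * bandRes η b y i i * F y)) := by
      ext y
      rw [← mul_conjQuint]
      nth_rewrite 1 [selfErr_eq (by linarith) b y i]
      rw [Finset.sum_mul]
      refine Finset.sum_congr rfl fun j _ => ?_
      rw [Complex.real_smul, ← hκ]
      ring
    rw [e1, cwExp_sum, cwExp_sum]
    refine Finset.sum_congr rfl fun j _ => ?_
    rw [cwExp_add, cwExp_spin_smul β (ordPair i j), ← cwExp_add]
  have hnorm : cwExp β (fun y : Fin n × Fin n → ℝ => ‖selfErr η b y i‖ ^ 6)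
      = ‖cwExp β (fun y : Fin n × Fin n → ℝ => ((‖selfErr η b y i‖ ^ 6 : ℝ) : ℂ))‖ := by
    rw [cwExp_ofReal β (fun y : Fin n × Fin n → ℝ => ‖selfErr η b y i‖ ^ 6), Complex.norm_real,
      Real.norm_of_nonneg (cwExp_nonneg fun y _ => by positivity)]
  rw [hnorm, step]
  refine (norm_cwExp_le _ _).trans (cwExp_mono fun y hy => (norm_sum_le _ _).trans ?_)
  -- A bounds |W_i| at y and at both values of any spin in row i.
  set A := ‖selfErr η b y i‖ + 6 * (η + 1) * κ with hA
  set τ := (1 + |∑ p, y p|) / Fintype.card (Fin n × Fin n) with hτ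
  have hτ0 : 0 ≤ τ := by positivity
  have hA0 : 0 ≤ A := by positivity
  have hW : ‖selfErr η b y i‖ ≤ A := by rw [hA]; linarith [show 0 ≤ 6 * (η + 1) * κ by positivity]
  set c := 3 * (η + 1) with hc
  have hc0 : 0 ≤ c := by positivity
  have hterm : ∀ j ∈ rowSet b i,
      ‖(((2 : ℝ)⁻¹ • ((κ : ℂ) * (bandRes η b (Function.update y (ordPair i j) 1) j i
              * F (Function.update y (ordPair i j) 1))
            - κ * (bandRes η b (Function.update y (ordPair i j) (-1)) j i
              * F (Function.update y (ordPair i j) (-1))))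
          + (condSpin β (ordPair i j) y * 2⁻¹) •
            ((κ : ℂ) * (bandRes η b (Function.update y (ordPair i j) 1) j i
              * F (Function.update y (ordPair i j) 1))
            + κ * (bandRes η b (Function.update y (ordPair i j) (-1)) j i
              * F (Function.update y (ordPair i j) (-1)))))
          + (κ : ℂ) ^ 2 * (bandRes η b y j j * bandRes η b y i i * F y))‖
      ≤ A ^ 5 * (κ ^ 3 + 2 * κ ^ 2 * ‖bandRes η b y i j‖ ^ 2 + 2 * κ ^ 4)
        + 15 * c * κ ^ 2 * A ^ 4 * (‖bandRes η b y i j‖ ^ 2 + κ ^ 2)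
        + τ * A ^ 5 * (‖bandRes η b y i j‖ ^ 2 + 2 * κ ^ 2) := by
    intro j hj
    have hrel : Relevant b i j := (Finset.mem_filter.1 hj).2
    set g := ‖bandRes η b y i j‖ with hg
    have hg' : ‖bandRes η b y j i‖ = g := by rw [bandRes_symm]
    have hg0 : 0 ≤ g := norm_nonneg _
    have u1 := norm_bandRes_update_le hη b hy hrel j i (c := 1) (Or.inl rfl)
    have u2 := norm_bandRes_update_le hη b hy hrel j i (c := -1) (Or.inr rfl)
    rw [hg'] at u1 u2
    have w1 := norm_selfErr_update_le hη hb1 hb hy hrel (c := 1) (Or.inl rfl)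
    have w2 := norm_selfErr_update_le hη hb1 hb hy hrel (c := -1) (Or.inr rfl)
    have w12 := norm_selfErr_flip_le hη hb1 hb hy hrel
    have f12 : ‖F (Function.update y (ordPair i j) 1) - F (Function.update y (ordPair i j) (-1))‖
        ≤ 5 * (c * κ * (g + κ)) * A ^ 4 :=
      (norm_conjQuint_sub_le w1 w2).trans (by gcongr)
    have hx : ‖if i = j then (0 : ℂ) else bandRes η b (Function.update y (ordPair i j) 1) j i
        * bandRes η b (Function.update y (ordPair i j) (-1)) j i‖ ≤ (g + κ) ^ 2 := by
      split_ifs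
      · rw [norm_zero]; positivity
      · rw [norm_mul, sq]; exact mul_le_mul u1 u2 (norm_nonneg _) (by positivity)
    refine norm_stein_term_le (d₁ := bandRes η b (Function.update y (ordPair i j) 1) j j)
      (e₂ := bandRes η b (Function.update y (ordPair i j) (-1)) i i) hκ0 hA0 hg0 hc0 ?_ hx
      (norm_bandRes_update_sub_le hη b hy hrel j j (Or.inl rfl))
      (norm_bandRes_update_sub_le hη b hy hrel i i (Or.inr rfl))
      (norm_bandRes_le hη b y j j) (norm_bandRes_le hη b _ i i) u1 u2 ?_ ?_ ?_ f12 ?_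
      (abs_condSpin_le hβ hβ1 (ordPair i j) hy)
    · rw [bandRes_flip (by linarith) b y hrel, ← hκ]
      by_cases hij : i = j
      · subst hij; simp
      · simp only [hij, if_false]; ring
    · rw [hF]; simp only [norm_conjQuint]; exact pow_le_pow_left₀ (norm_nonneg _) hW 5
    · rw [hF]; simp only [norm_conjQuint]; exact pow_le_pow_left₀ (norm_nonneg _) w1 5
    · rw [hF]; simp only [norm_conjQuint]; exact pow_le_pow_left₀ (norm_nonneg _) w2 5
    · rcases eq_update_or hy (ordPair i j) with hy' | hy'
      · rw [← hy', sub_self, norm_zero]; positivity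
      · rw [← hy'] at f12; exact f12
  refine (Finset.sum_le_sum hterm).trans ?_
  rw [Finset.sum_add_distrib, Finset.sum_add_distrib, ← Finset.mul_sum, ← Finset.mul_sum,
    ← Finset.mul_sum, Finset.sum_add_distrib, Finset.sum_add_distrib, Finset.sum_add_distrib,
    Finset.sum_add_distrib, ← Finset.mul_sum]
  simp only [Finset.sum_const, card_rowSet hb, nsmul_eq_mul]
  have hs := sum_norm_sq_bandRes_le hη b y i (rowSet b i)
  set s := ∑ j ∈ rowSet b i, ‖bandRes η b y i j‖ ^ 2 with hs'
  have hs0 : 0 ≤ s := Finset.sum_nonneg fun j _ => by positivity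
  have hκ2 : κ ^ 2 ≤ κ := by nlinarith
  -- Since bκ² = 1, summing over the b spins of the row costs exactly two powers of κ.
  have k3 : (b : ℝ) * κ ^ 3 = κ := by linear_combination κ * hκb
  have k4 : (b : ℝ) * (2 * κ ^ 4) = 2 * κ ^ 2 := by linear_combination 2 * κ ^ 2 * hκb
  have k5 : (b : ℝ) * (2 * κ ^ 2) = 2 := by linear_combination 2 * hκb
  rw [k3, k4, k5, hκb]
  have z1 : κ + 2 * κ ^ 2 * s + 2 * κ ^ 2 ≤ 4 * κ := by nlinarith [sq_nonneg κ]
  have z2 : 15 * c * κ ^ 2 * A ^ 4 * (s + 1) ≤ 60 * (η + 1) * κ ^ 2 * A ^ 4 := by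
    have : 15 * c * κ ^ 2 * A ^ 4 * (s + 1) ≤ 15 * c * κ ^ 2 * A ^ 4 * (4 / 3) := by
      gcongr; linarith
    refine this.trans (le_of_eq ?_)
    rw [hc]; ring
  have z3 : τ * A ^ 5 * (s + 2) ≤ 3 * τ * A ^ 5 := by
    have : τ * A ^ 5 * (s + 2) ≤ τ * A ^ 5 * 3 := by gcongr; linarith
    linarith
  have z4 : A ^ 5 * (κ + 2 * κ ^ 2 * s + 2 * κ ^ 2) ≤ 4 * κ * A ^ 5 := by
    rw [mul_comm]; gcongr
  linarith

/-- Young's inequality with exponents 6 and 6/5, by comparing x with δA. -/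
theorem young_five {x A δ : ℝ} (hx : 0 ≤ x) (hA : 0 ≤ A) (hδ : 0 < δ) :
    x * A ^ 5 ≤ δ * A ^ 6 + x ^ 6 / δ ^ 5 := by
  rcases le_total x (δ * A) with h | h
  · have h1 : x * A ^ 5 ≤ δ * A * A ^ 5 := by gcongr
    have h2 : 0 ≤ x ^ 6 / δ ^ 5 := by positivity
    nlinarith
  · have h1 : A ≤ x / δ := by rw [le_div_iff₀ hδ]; linarith
    have h2 : x * A ^ 5 ≤ x * (x / δ) ^ 5 := by gcongr
    have h3 : x * (x / δ) ^ 5 = x ^ 6 / δ ^ 5 := by rw [div_pow]; ring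
    have h4 : 0 ≤ δ * A ^ 6 := by positivity
    linarith

theorem young_four {x A δ : ℝ} (hx : 0 ≤ x) (hδ : 0 < δ) :
    x * A ^ 4 ≤ δ * A ^ 6 + x ^ 3 / δ ^ 2 := by
  rcases le_total x (δ * A ^ 2) with h | h
  · have h1 : x * A ^ 4 ≤ δ * A ^ 2 * A ^ 4 := by gcongr
    have h2 : 0 ≤ x ^ 3 / δ ^ 2 := by positivity
    nlinarith
  · have h1 : A ^ 2 ≤ x / δ := by rw [le_div_iff₀ hδ]; linarith
    have h2 : x * (A ^ 2) ^ 2 ≤ x * (x / δ) ^ 2 := by gcongr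
    have h3 : x * (x / δ) ^ 2 = x ^ 3 / δ ^ 2 := by rw [div_pow]; ring
    have h4 : 0 ≤ δ * A ^ 6 := by positivity
    nlinarith

theorem add_pow_six_le (x y : ℝ) (hx : 0 ≤ x) (hy : 0 ≤ y) :
    (x + y) ^ 6 ≤ 32 * (x ^ 6 + y ^ 6) := by
  have := add_pow_le hx hy 6
  norm_num at this
  linarith

/-- The error in the self-consistent equation has sixth moment of order `b⁻³`. -/
theorem cwExp_norm_selfErr_pow_six_le {η : ℝ} (hη : 2 ≤ η) : ∃ C : ℝ, 0 ≤ C ∧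
    ∀ (n b : ℕ), 1 ≤ n → IsBandwidth n b → ∀ β : ℝ, 0 ≤ β → β ≤ 1 → ∀ i : Fin n,
      cwExp β (fun y : Fin n × Fin n → ℝ => ‖selfErr η b y i‖ ^ 6) ≤ C / (b : ℝ) ^ 3 := by
  obtain ⟨C₀, hC₀, h₀⟩ := cwExp_total_spin_pow.{0} 6
  -- Three Young terms and the factor 32 of `add_pow_six_le` give 3 · 32 · δ = 1/2, so half of E|W|⁶
  -- is absorbed on the left; this is the factor 2 in `2 * K`.
  set δ : ℝ := 1 / 192 with hδ
  set K : ℝ := 3 * δ * 32 * (6 * (η + 1)) ^ 6 + 4 ^ 6 / δ ^ 5 + (60 * (η + 1)) ^ 3 / δ ^ 2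
    + 3 ^ 6 / δ ^ 5 * C₀ with hK
  refine ⟨2 * K, by positivity, fun n b hn hb β hβ hβ1 i => ?_⟩
  have : Nonempty (Fin n × Fin n) := ⟨(i, i)⟩
  have hb1 := bandwidth_pos hn hb
  have h1 := cwExp_selfErr_le_of_stein hη hn hb hβ hβ1 i
  set κ : ℝ := 1 / √(b : ℝ) with hκ
  have hκ0 : 0 ≤ κ := by positivity
  have hκ6 : κ ^ 6 = 1 / (b : ℝ) ^ 3 := by
    rw [show κ ^ 6 = (κ ^ 2) ^ 3 by ring, inv_sqrt_sq, inv_pow, one_div]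
  set N : ℝ := (Fintype.card (Fin n × Fin n) : ℝ) with hN
  have hN2 : N = (n : ℝ) ^ 2 := by rw [hN]; simp [sq]
  have hn0 : (0 : ℝ) < n := by exact_mod_cast hn
  -- The sixth moment of S is O(N^(9/2)) = O(n⁹), and division by N⁶ = n¹² leaves n⁻³ ≤ b⁻³, the
  -- same order as κ⁶.
  have hτ : cwExp β (fun y : Fin n × Fin n → ℝ => ((1 + |∑ p, y p|) / N) ^ 6) ≤ C₀ / (b : ℝ) ^ 3 := by
    have e : (fun y : Fin n × Fin n → ℝ => ((1 + |∑ p, y p|) / N) ^ 6)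
        = fun y => (N ^ 6)⁻¹ * (1 + |∑ p, y p|) ^ 6 := by
      ext y; rw [div_pow, div_eq_inv_mul]
    rw [e, cwExp_mul_left]
    have h2 := h₀ (Fin n × Fin n) β hβ hβ1
    rw [← hN] at h2
    have h3 : N ^ (3 * ((6 : ℕ) : ℝ) / 4) = (n : ℝ) ^ 9 := by
      rw [hN2, ← Real.rpow_natCast (n : ℝ) 2, ← Real.rpow_mul hn0.le, ← Real.rpow_natCast]
      norm_num
    rw [h3] at h2
    calc _ ≤ (N ^ 6)⁻¹ * (C₀ * (n : ℝ) ^ 9) := mul_le_mul_of_nonneg_left h2 (by positivity)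
      _ = C₀ / (n : ℝ) ^ 3 := by rw [hN2]; field_simp
      _ ≤ _ := by
        have : (b : ℝ) ≤ n := by exact_mod_cast bandwidth_le hb
        have hb0 : (0 : ℝ) < b := by exact_mod_cast hb1
        gcongr
  set T := cwExp β (fun y : Fin n × Fin n → ℝ => ‖selfErr η b y i‖ ^ 6) with hT
  have hpt : ∀ y ∈ spinConfigs (Fin n × Fin n),
      4 * κ * (‖selfErr η b y i‖ + 6 * (η + 1) * κ) ^ 5
        + 60 * (η + 1) * κ ^ 2 * (‖selfErr η b y i‖ + 6 * (η + 1) * κ) ^ 4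
        + 3 * ((1 + |∑ p, y p|) / N) * (‖selfErr η b y i‖ + 6 * (η + 1) * κ) ^ 5
      ≤ (2⁻¹ * ‖selfErr η b y i‖ ^ 6 + 3 ^ 6 / δ ^ 5 * ((1 + |∑ p, y p|) / N) ^ 6)
        + (3 * δ * 32 * (6 * (η + 1)) ^ 6 + 4 ^ 6 / δ ^ 5 + (60 * (η + 1)) ^ 3 / δ ^ 2) * κ ^ 6 := by
    intro y _
    set τ := (1 + |∑ p, y p|) / N
    have hτ0 : 0 ≤ τ := by positivity
    set w := ‖selfErr η b y i‖
    have hw : 0 ≤ w := norm_nonneg _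
    set A := w + 6 * (η + 1) * κ with hA
    have hA0 : 0 ≤ A := by positivity
    have hδ0 : 0 < δ := by norm_num [hδ]
    have y1 := young_five (x := 4 * κ) (by positivity) hA0 hδ0
    have y2 := young_four (x := 60 * (η + 1) * κ ^ 2) (A := A) (by positivity) hδ0
    have y3 := young_five (x := 3 * τ) (by positivity) hA0 hδ0
    have y4 := add_pow_six_le w (6 * (η + 1) * κ) hw (by positivity)
    rw [← hA] at y4
    have y5 := mul_le_mul_of_nonneg_left y4 hδ0.le
    have e1 : (4 * κ) ^ 6 / δ ^ 5 = 4 ^ 6 / δ ^ 5 * κ ^ 6 := by ring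
    have e2 : (60 * (η + 1) * κ ^ 2) ^ 3 / δ ^ 2 = (60 * (η + 1)) ^ 3 / δ ^ 2 * κ ^ 6 := by ring
    have e3 : (3 * τ) ^ 6 / δ ^ 5 = 3 ^ 6 / δ ^ 5 * τ ^ 6 := by ring
    have e4 : (6 * (η + 1) * κ) ^ 6 = (6 * (η + 1)) ^ 6 * κ ^ 6 := by ring
    have e5 : 3 * δ * 32 = 2⁻¹ := by norm_num [hδ]
    rw [e1] at y1
    rw [e2] at y2
    rw [e3] at y3
    rw [e4] at y5
    have e6 : 3 * (δ * (32 * (w ^ 6 + (6 * (η + 1)) ^ 6 * κ ^ 6)))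
        = 2⁻¹ * w ^ 6 + 3 * δ * 32 * (6 * (η + 1)) ^ 6 * κ ^ 6 := by
      rw [← e5]; ring
    linarith
  have h2 := h1.trans (cwExp_mono hpt)
  rw [cwExp_add, cwExp_add, cwExp_mul_left, cwExp_mul_left, cwExp_const, ← hT] at h2
  have h3 : 3 ^ 6 / δ ^ 5 * cwExp β (fun y : Fin n × Fin n → ℝ => ((1 + |∑ p, y p|) / N) ^ 6)
      ≤ 3 ^ 6 / δ ^ 5 * (C₀ / (b : ℝ) ^ 3) := mul_le_mul_of_nonneg_left hτ (by positivity)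
  rw [hκ6] at h2
  have e : 2 * K / (b : ℝ) ^ 3 = 2 * (3 ^ 6 / δ ^ 5 * (C₀ / (b : ℝ) ^ 3)
      + (3 * δ * 32 * (6 * (η + 1)) ^ 6 + 4 ^ 6 / δ ^ 5 + (60 * (η + 1)) ^ 3 / δ ^ 2)
        * (1 / (b : ℝ) ^ 3)) := by
    rw [hK]; ring
  rw [e]
  linarith

end Main

/-! ### Stability of the self-consistent equation -/

/-- The Stieltjes transform of the semicircle distribution at `i η`. -/
def scStieltjes (η : ℝ) : ℂ := ((√(η ^ 2 + 4) - η) / 2 : ℝ) * Complex.I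

theorem scStieltjes_eq (η : ℝ) : scStieltjes η * (η * Complex.I + scStieltjes η) = -1 := by
  set g : ℝ := (√(η ^ 2 + 4) - η) / 2 with hg
  have h1 : g * (η + g) = 1 := by
    have := Real.sq_sqrt (show 0 ≤ η ^ 2 + 4 by positivity)
    rw [hg]; linear_combination this / 4
  have h2 : (g : ℂ) * (η + g) = 1 := by exact_mod_cast h1
  rw [scStieltjes, ← hg]
  linear_combination (g : ℂ) * (η + g) * Complex.I_sq - h2

theorem scStieltjes_im_nonneg (η : ℝ) : 0 ≤ (scStieltjes η).im := by
  have : η ≤ √(η ^ 2 + 4) := Real.le_sqrt_of_sq_le (by linarith)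
  simp only [scStieltjes, Complex.mul_im, Complex.ofReal_re, Complex.ofReal_im, Complex.I_im,
    Complex.I_re]
  linarith

theorem norm_average_pow_six_le {κ : Type*} (s : Finset κ) (f : κ → ℂ) (hs : s.Nonempty) :
    ‖(s.card : ℂ)⁻¹ * ∑ j ∈ s, f j‖ ^ 6 ≤ (s.card : ℝ)⁻¹ * ∑ j ∈ s, ‖f j‖ ^ 6 := by
  have hc : (0 : ℝ) < s.card := by exact_mod_cast hs.card_pos
  rw [norm_mul, norm_inv, Complex.norm_natCast, mul_pow]
  have h1 := pow_sum_div_card_le_sum_pow (s := s) (f := fun j => ‖f j‖)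
    (fun j _ => norm_nonneg _) 5
  have h2 := pow_le_pow_left₀ (norm_nonneg _) (norm_sum_le s f) 6
  rw [div_le_iff₀ (by positivity)] at h1
  rw [inv_pow, inv_mul_le_iff₀ (by positivity)]
  refine h2.trans (h1.trans (le_of_eq ?_))
  field_simp

/-- With p = iη + H and q = iη + s one has s = -1/q, hence G - s = (pG + 1)/p + (H - s)/(pq), and
both |p| and |q| are at least 2. -/
theorem norm_sub_le_of_selfConsistent {η : ℝ} (hη : 2 ≤ η) {G H s : ℂ} (hH : 0 ≤ H.im)
    (hs : 0 ≤ s.im) (hse : s * (η * Complex.I + s) = -1) :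
    ‖G - s‖ ≤ ‖(η * Complex.I + H) * G + 1‖ / 2 + ‖H - s‖ / 4 := by
  have low : ∀ u : ℂ, 0 ≤ u.im → 2 ≤ ‖(η * Complex.I + u : ℂ)‖ := by
    intro u hu
    have h1 := Complex.abs_im_le_norm (η * Complex.I + u)
    have h2 : (η * Complex.I + u : ℂ).im = η + u.im := by simp
    rw [h2] at h1
    exact le_trans (by linarith) ((le_abs_self _).trans h1)
  have hH2 := low H hH
  have hs2 := low s hs
  set p := (η * Complex.I + H : ℂ) with hp
  set q := (η * Complex.I + s : ℂ) with hq
  have hp0 : p ≠ 0 := norm_pos_iff.1 (by linarith)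
  have hq0 : q ≠ 0 := norm_pos_iff.1 (by linarith)
  have e : G - s = (p * G + 1) / p + (H - s) / (p * q) := by
    have h1 : H - s = p - q := by rw [hp, hq]; ring
    rw [h1]
    field_simp
    linear_combination -p * hse
  rw [e]
  refine (norm_add_le _ _).trans ?_
  rw [norm_div, norm_div, norm_mul]
  refine add_le_add (div_le_div_of_nonneg_left (norm_nonneg _) two_pos hH2)
    (div_le_div_of_nonneg_left (norm_nonneg _) (by norm_num) (by nlinarith))

theorem localAvg_im_nonneg {n : ℕ} {η : ℝ} (hη : 0 < η) (b : ℕ) (y : Fin n × Fin n → ℝ)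
    (i : Fin n) : 0 ≤ (localAvg η b y i).im := by
  have h : (localAvg η b y i).im = (b : ℝ)⁻¹ * ∑ j ∈ rowSet b i, (bandRes η b y j j).im := by
    have : (b : ℂ)⁻¹ = (((b : ℝ)⁻¹ : ℝ) : ℂ) := by push_cast; rfl
    rw [localAvg, this, Complex.im_ofReal_mul, Complex.im_sum]
  rw [h]
  exact mul_nonneg (by positivity) (Finset.sum_nonneg fun j _ =>
    resolv_diag_im_nonneg hη (bandOf_isHermitian b y) j)

theorem cwExp_norm_bandRes_sub_le {η : ℝ} (hη : 2 ≤ η) : ∃ C : ℝ, 0 ≤ C ∧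
    ∀ (n b : ℕ), 1 ≤ n → IsBandwidth n b → ∀ β : ℝ, 0 ≤ β → β ≤ 1 → ∀ i : Fin n,
      cwExp β (fun y : Fin n × Fin n → ℝ => ‖bandRes η b y i i - scStieltjes η‖ ^ 6)
        ≤ C / (b : ℝ) ^ 3 := by
  obtain ⟨C, hC, h⟩ := cwExp_norm_selfErr_pow_six_le hη
  refine ⟨2 * C, by positivity, fun n b hn hb β hβ hβ1 => ?_⟩
  have hb1 := bandwidth_pos hn hb
  set D : Fin n → ℝ := fun i =>
    cwExp β (fun y : Fin n × Fin n → ℝ => ‖bandRes η b y i i - scStieltjes η‖ ^ 6) with hD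
  have hne : (Finset.univ : Finset (Fin n)).Nonempty := ⟨⟨0, hn⟩, Finset.mem_univ _⟩
  -- The equation at i involves the diagonal entries of the whole row, so the argument closes only
  -- at the worst index.
  obtain ⟨i₀, -, hmax⟩ := Finset.exists_max_image Finset.univ D hne
  have hstep : ∀ i, D i ≤ C / (b : ℝ) ^ 3 + 2⁻¹ * D i₀ := by
    intro i
    have hpt : ∀ y ∈ spinConfigs (Fin n × Fin n), ‖bandRes η b y i i - scStieltjes η‖ ^ 6
        ≤ ‖selfErr η b y i‖ ^ 6
          + 2⁻¹ * ((b : ℝ)⁻¹ * ∑ j ∈ rowSet b i, ‖bandRes η b y j j - scStieltjes η‖ ^ 6) := by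
      intro y _
      have h1 := norm_sub_le_of_selfConsistent hη (G := bandRes η b y i i)
        (localAvg_im_nonneg (show 0 < η by linarith) b y i) (scStieltjes_im_nonneg η) (scStieltjes_eq η)
      have hcard := card_rowSet hb i
      have hne' : (rowSet b i).Nonempty := by
        rw [← Finset.card_pos, hcard]; exact hb1
      have h2 := norm_average_pow_six_le (rowSet b i)
        (fun j => bandRes η b y j j - scStieltjes η) hne'
      have h3 : ((rowSet b i).card : ℂ)⁻¹ * ∑ j ∈ rowSet b i, (bandRes η b y j j - scStieltjes η)
          = localAvg η b y i - scStieltjes η := by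
        rw [Finset.sum_sub_distrib, Finset.sum_const, nsmul_eq_mul, hcard, mul_sub, localAvg,
          ← mul_assoc, inv_mul_cancel₀ (by exact_mod_cast (by omega : b ≠ 0)), one_mul]
      rw [h3, hcard] at h2
      have h4 := pow_le_pow_left₀ (norm_nonneg _) h1 6
      -- The resulting coefficients are 32/2⁶ = 1/2 ≤ 1 for the error and 32/4⁶ = 1/128 ≤ 1/2 for
      -- the average.
      have h5 := add_pow_six_le (‖(η * Complex.I + localAvg η b y i) * bandRes η b y i i + 1‖ / 2)
        (‖localAvg η b y i - scStieltjes η‖ / 4) (by positivity) (by positivity)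
      rw [div_pow, div_pow] at h5
      have h6 : 0 ≤ ‖selfErr η b y i‖ ^ 6 := by positivity
      have h7 : 0 ≤ ‖localAvg η b y i - scStieltjes η‖ ^ 6 := by positivity
      rw [← selfErr] at h4 h5
      linarith
    have h1 := cwExp_mono (β := β) hpt
    rw [cwExp_add, cwExp_mul_left, cwExp_mul_left, cwExp_sum] at h1
    have h2 : (b : ℝ)⁻¹ * ∑ j ∈ rowSet b i, D j ≤ D i₀ := by
      rw [inv_mul_le_iff₀ (by exact_mod_cast hb1), ← nsmul_eq_mul]
      have := Finset.sum_le_card_nsmul (rowSet b i) D _ fun j _ => hmax j (Finset.mem_univ j)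
      rwa [card_rowSet hb i] at this
    have h3 := h n b hn hb β hβ hβ1 i
    have h4 : D i ≤ _ := h1
    linarith
  intro i
  have h1 := hstep i₀
  have h2 := hmax i (Finset.mem_univ i)
  have e : 2 * C / (b : ℝ) ^ 3 = 2 * (C / (b : ℝ) ^ 3) := by ring
  rw [e]
  linarith

/-- The Stieltjes transform of the empirical spectral distribution is close to that of the
semicircle distribution in `L⁶`. -/
theorem cwExp_norm_stieltjes_sub_le {η : ℝ} (hη : 2 ≤ η) : ∃ C : ℝ, 0 ≤ C ∧
    ∀ (n b : ℕ), 1 ≤ n → IsBandwidth n b → ∀ β : ℝ, 0 ≤ β → β ≤ 1 →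
      cwExp β (fun y : Fin n × Fin n → ℝ =>
        ‖(n : ℂ)⁻¹ * ∑ i, bandRes η b y i i - scStieltjes η‖ ^ 6) ≤ C / (b : ℝ) ^ 3 := by
  obtain ⟨C, hC, h⟩ := cwExp_norm_bandRes_sub_le hη
  refine ⟨C, hC, fun n b hn hb β hβ hβ1 => ?_⟩
  have hne : (Finset.univ : Finset (Fin n)).Nonempty := ⟨⟨0, hn⟩, Finset.mem_univ _⟩
  have hpt : ∀ y ∈ spinConfigs (Fin n × Fin n),
      ‖(n : ℂ)⁻¹ * ∑ i, bandRes η b y i i - scStieltjes η‖ ^ 6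
        ≤ (n : ℝ)⁻¹ * ∑ i, ‖bandRes η b y i i - scStieltjes η‖ ^ 6 := by
    intro y _
    have h2 := norm_average_pow_six_le Finset.univ
      (fun i => bandRes η b y i i - scStieltjes η) hne
    have h3 : (n : ℂ)⁻¹ * ∑ i, (bandRes η b y i i - scStieltjes η)
        = (n : ℂ)⁻¹ * ∑ i, bandRes η b y i i - scStieltjes η := by
      rw [Finset.sum_sub_distrib, Finset.sum_const, nsmul_eq_mul, Finset.card_univ,
        Fintype.card_fin, mul_sub, ← mul_assoc,
        inv_mul_cancel₀ (by exact_mod_cast (by omega : n ≠ 0)), one_mul]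
    rwa [Finset.card_univ, Fintype.card_fin, h3] at h2
  refine (cwExp_mono hpt).trans ?_
  rw [cwExp_mul_left, cwExp_sum, inv_mul_le_iff₀ (by exact_mod_cast hn), ← nsmul_eq_mul]
  have := Finset.sum_le_card_nsmul Finset.univ (fun i : Fin n =>
    cwExp β (fun y : Fin n × Fin n → ℝ => ‖bandRes η b y i i - scStieltjes η‖ ^ 6)) _
    fun i _ => h n b hn hb β hβ hβ1 i
  rwa [Finset.card_univ, Fintype.card_fin] at this

/-! ### The semicircle distribution -/

/-- At x = ±2 both arcsines in this primitive have argument ±1, so the integral over [-2, 2] can be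
read off. -/
theorem hasDerivAt_semicircle_primitive {η x : ℝ} (hη : 0 < η) (hx : x ∈ Set.Ioo (-2 : ℝ) 2) :
    HasDerivAt (fun x => √(η ^ 2 + 4) / η * Real.arcsin (√(η ^ 2 + 4) * x / (2 * √(x ^ 2 + η ^ 2)))
      - Real.arcsin (x / 2)) (√(4 - x ^ 2) / (x ^ 2 + η ^ 2)) x := by
  have hw2 : 0 < 4 - x ^ 2 := by nlinarith [hx.1, hx.2]
  have hv2 : 0 < x ^ 2 + η ^ 2 := by positivity
  have hr2 : 0 < η ^ 2 + 4 := by positivity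
  set r := √(η ^ 2 + 4) with hr
  set w := √(4 - x ^ 2) with hw
  set v := √(x ^ 2 + η ^ 2) with hv
  have hr0 : 0 < r := Real.sqrt_pos.2 hr2
  have hw0 : 0 < w := Real.sqrt_pos.2 hw2
  have hv0 : 0 < v := Real.sqrt_pos.2 hv2
  have er : r ^ 2 = η ^ 2 + 4 := Real.sq_sqrt hr2.le
  have ew : w ^ 2 = 4 - x ^ 2 := Real.sq_sqrt hw2.le
  have ev : v ^ 2 = x ^ 2 + η ^ 2 := Real.sq_sqrt hv2.le
  have hu2 : 1 - (r * x / (2 * v)) ^ 2 = (η * w / (2 * v)) ^ 2 := by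
    field_simp
    rw [er, ew, ev]; ring
  have hpos : 0 < η * w / (2 * v) := by positivity
  have hsq : √(1 - (r * x / (2 * v)) ^ 2) = η * w / (2 * v) := by
    rw [hu2, Real.sqrt_sq hpos.le]
  have hne : r * x / (2 * v) ≠ -1 ∧ r * x / (2 * v) ≠ 1 := by
    constructor <;> intro h <;> rw [h] at hu2 <;> nlinarith [pow_pos hpos 2]
  have d1 : HasDerivAt (fun x : ℝ => √(x ^ 2 + η ^ 2)) (x / v) x := by
    have := ((hasDerivAt_pow 2 x).add_const (η ^ 2)).sqrt hv2.ne'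
    refine this.congr_deriv ?_
    rw [← hv]; field_simp; norm_num
  have d2 : HasDerivAt (fun x : ℝ => r * x / (2 * √(x ^ 2 + η ^ 2)))
      (r * η ^ 2 / (2 * v ^ 3)) x := by
    have := ((hasDerivAt_id' x).const_mul r).fun_div (d1.const_mul 2) (by positivity)
    refine this.congr_deriv ?_
    rw [← hv]; field_simp; rw [ev]; ring
  have d3 := (Real.hasDerivAt_arcsin hne.1 hne.2).comp x d2
  have d4 : HasDerivAt (fun x : ℝ => Real.arcsin (x / 2)) (1 / w) x := by
    have h1 : x / 2 ≠ -1 := by have := hx.1; intro h; linarith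
    have h2 : x / 2 ≠ 1 := by have := hx.2; intro h; linarith
    have := (Real.hasDerivAt_arcsin h1 h2).comp x ((hasDerivAt_id' x).div_const 2)
    refine this.congr_deriv ?_
    have e : 1 - (x / 2) ^ 2 = (w / 2) ^ 2 := by rw [div_pow w, ew]; ring
    rw [e, Real.sqrt_sq (by positivity)]
    field_simp
  have d5 := (d3.const_mul (r / η)).sub d4
  refine d5.congr_deriv ?_
  rw [hsq, ← ev]
  field_simp
  rw [er, ew, ev]; ring

theorem integral_sqrt_div_add_sq {η : ℝ} (hη : 0 < η) :
    ∫ x in (-2 : ℝ)..2, √(4 - x ^ 2) / (x ^ 2 + η ^ 2) = Real.pi * (√(η ^ 2 + 4) / η - 1) := by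
  have hcont : Continuous fun x : ℝ => √(4 - x ^ 2) / (x ^ 2 + η ^ 2) := by
    refine Continuous.div (by fun_prop) (by fun_prop) fun x => ?_
    positivity
  rw [intervalIntegral.integral_eq_sub_of_hasDerivAt_of_le (by norm_num) ?_
    (fun x hx => hasDerivAt_semicircle_primitive hη hx) (hcont.intervalIntegrable _ _)]
  · have h1 : √(η ^ 2 + 4) * 2 / (2 * √(2 ^ 2 + η ^ 2)) = 1 := by
      have : (2 : ℝ) ^ 2 + η ^ 2 = η ^ 2 + 4 := by ring
      rw [this, mul_comm]
      exact div_self (by positivity)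
    have h2 : √(η ^ 2 + 4) * (-2) / (2 * √((-2) ^ 2 + η ^ 2)) = -1 := by
      have : (-2 : ℝ) ^ 2 + η ^ 2 = 2 ^ 2 + η ^ 2 := by ring
      rw [this, mul_neg, neg_div, h1]
    have h3 : (-2 : ℝ) / 2 = -1 := by norm_num
    rw [h1, h2, h3, div_self two_ne_zero, Real.arcsin_neg, Real.arcsin_one]
    ring
  · refine Continuous.continuousOn ?_
    refine ((Real.continuous_arcsin.comp ?_).const_mul _).sub (Real.continuous_arcsin.comp (by fun_prop))
    refine Continuous.div (by fun_prop) (by fun_prop) fun x => ?_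
    positivity

theorem integral_sqrt_four_sub_sq : ∫ x in (-2 : ℝ)..2, √(4 - x ^ 2) = 2 * Real.pi := by
  have h := intervalIntegral.mul_integral_comp_mul_left (a := -1) (b := 1)
    (f := fun x : ℝ => √(4 - x ^ 2)) (2 : ℝ)
  norm_num at h
  rw [← h]
  have e : ∀ x : ℝ, √(4 - (2 * x) ^ 2) = 2 * √(1 - x ^ 2) := by
    intro x
    rw [show 4 - (2 * x) ^ 2 = 2 ^ 2 * (1 - x ^ 2) by ring, Real.sqrt_mul (by norm_num),
      Real.sqrt_sq (by norm_num)]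
  simp_rw [e]
  rw [intervalIntegral.integral_const_mul, integral_sqrt_one_sub_sq]
  ring

theorem measurable_semicircle_density : Measurable fun x : ℝ =>
    (Set.Icc (-2 : ℝ) 2).indicator (fun x => 1 / (2 * Real.pi) * √(4 - x ^ 2)) x :=
  Measurable.indicator (by fun_prop) measurableSet_Icc

theorem semicircle_density_nonneg (x : ℝ) :
    0 ≤ (Set.Icc (-2 : ℝ) 2).indicator (fun x => 1 / (2 * Real.pi) * √(4 - x ^ 2)) x :=
  Set.indicator_nonneg (fun x _ => by positivity) x

theorem integral_semicircle {V : Type*} [NormedAddCommGroup V] [NormedSpace ℝ V] (f : ℝ → V) :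
    ∫ x, f x ∂semicircle = ∫ x in (-2 : ℝ)..2, (1 / (2 * Real.pi) * √(4 - x ^ 2)) • f x := by
  rw [semicircle, integral_withDensity_eq_integral_toReal_smul
    measurable_semicircle_density.ennreal_ofReal (by simp)]
  simp_rw [ENNReal.toReal_ofReal (semicircle_density_nonneg _)]
  rw [intervalIntegral.integral_of_le (by norm_num), ← integral_Icc_eq_integral_Ioc,
    ← integral_indicator measurableSet_Icc]
  congr 1
  ext x
  by_cases hx : x ∈ Set.Icc (-2 : ℝ) 2 <;> simp [hx]

theorem isProbabilityMeasure_semicircle : IsProbabilityMeasure semicircle := by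
  constructor
  rw [semicircle, withDensity_apply _ MeasurableSet.univ, Measure.restrict_univ,
    ← ofReal_integral_eq_lintegral_ofReal ?_ (ae_of_all _ semicircle_density_nonneg)]
  · rw [integral_indicator measurableSet_Icc, integral_Icc_eq_integral_Ioc,
      ← intervalIntegral.integral_of_le (by norm_num), intervalIntegral.integral_const_mul,
      integral_sqrt_four_sub_sq, one_div, inv_mul_cancel₀ (by positivity), ENNReal.ofReal_one]
  · rw [integrable_indicator_iff measurableSet_Icc]
    exact (Continuous.continuousOn (by fun_prop)).integrableOn_Icc

/-- The real part of the integrand is odd; the imaginary part is the integral of √(4 - x²)/(x² +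
η²). -/
theorem stieltjes_semicircle {η : ℝ} (hη : 0 < η) :
    ∫ x, ((x : ℂ) - η * Complex.I)⁻¹ ∂semicircle = scStieltjes η := by
  rw [integral_semicircle]
  have e : ∀ x : ℝ, (1 / (2 * Real.pi) * √(4 - x ^ 2)) • ((x : ℂ) - η * Complex.I)⁻¹
      = ((1 / (2 * Real.pi) * (√(4 - x ^ 2) / (x ^ 2 + η ^ 2) * x) : ℝ) : ℂ)
        + ((η / (2 * Real.pi) * (√(4 - x ^ 2) / (x ^ 2 + η ^ 2)) : ℝ) : ℂ) * Complex.I := by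
    intro x
    have h1 : ((x ^ 2 + η ^ 2 : ℝ) : ℂ) ≠ 0 := by exact_mod_cast (by positivity : x ^ 2 + η ^ 2 ≠ 0)
    have h2 : ((x : ℂ) - η * Complex.I)⁻¹ = (x + η * Complex.I) / ((x ^ 2 + η ^ 2 : ℝ) : ℂ) := by
      refine inv_eq_of_mul_eq_one_right ?_
      rw [mul_div_assoc', div_eq_one_iff_eq h1]
      push_cast
      linear_combination -(η : ℂ) ^ 2 * Complex.I_sq
    rw [h2, Complex.real_smul]
    push_cast
    ring
  have hcont : Continuous fun x : ℝ => √(4 - x ^ 2) / (x ^ 2 + η ^ 2) := by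
    refine Continuous.div (by fun_prop) (by fun_prop) fun x => ?_
    positivity
  have hodd : ∫ x in (-2 : ℝ)..2, √(4 - x ^ 2) / (x ^ 2 + η ^ 2) * x = 0 := by
    have h := intervalIntegral.integral_comp_neg (a := -2) (b := 2)
      (fun x : ℝ => √(4 - x ^ 2) / (x ^ 2 + η ^ 2) * x)
    simp only [neg_sq, neg_neg, mul_neg, intervalIntegral.integral_neg] at h
    linarith
  simp_rw [e]
  rw [intervalIntegral.integral_add]
  · rw [intervalIntegral.integral_ofReal, intervalIntegral.integral_mul_const,
      intervalIntegral.integral_ofReal, intervalIntegral.integral_const_mul, hodd,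
      intervalIntegral.integral_const_mul, integral_sqrt_div_add_sq hη, scStieltjes]
    have : η / (2 * Real.pi) * (Real.pi * (√(η ^ 2 + 4) / η - 1)) = (√(η ^ 2 + 4) - η) / 2 := by
      field_simp
    rw [this]
    simp
  · refine Continuous.intervalIntegrable ?_ _ _
    exact Complex.continuous_ofReal.comp ((hcont.mul continuous_id).const_mul _)
  · refine Continuous.intervalIntegrable ?_ _ _
    exact (Complex.continuous_ofReal.comp (hcont.const_mul _)).mul continuous_const

/-! ### Weak convergence from convergence of Stieltjes transforms -/

section Weak

theorem norm_ofReal_sub_mul_I_inv_le (x : ℝ) {η : ℝ} (hη : η ≠ 0) :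
    ‖((x : ℂ) - η * Complex.I)⁻¹‖ ≤ |η|⁻¹ := by
  rw [norm_inv]
  refine inv_anti₀ (abs_pos.2 hη) ?_
  have := Complex.abs_im_le_norm ((x : ℂ) - η * Complex.I)
  simpa using this

theorem ofReal_sub_mul_I_ne_zero (x : ℝ) {η : ℝ} (hη : η ≠ 0) : (x : ℂ) - η * Complex.I ≠ 0 := by
  intro h
  have := congrArg Complex.im h
  simp at this
  exact hη this

/-- The function `x ↦ 1 / (x - i η)` on the one-point compactification of the line. -/
def resFun (η : ℝ) (hη : η ≠ 0) : C(OnePoint ℝ, ℂ) :=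
  OnePoint.continuousMapMk
    ⟨fun x : ℝ => ((x : ℂ) - η * Complex.I)⁻¹,
      Continuous.inv₀ (by fun_prop) fun x => ofReal_sub_mul_I_ne_zero x hη⟩ 0 (by
    rw [coclosedCompact_eq_cocompact]
    refine tendsto_inv₀_cobounded.comp ?_
    rw [← tendsto_norm_atTop_iff_cobounded]
    refine tendsto_atTop_mono (fun x : ℝ => ?_) (tendsto_norm_cocompact_atTop (E := ℝ))
    have := Complex.abs_re_le_norm ((x : ℂ) - η * Complex.I)
    simpa using this)

theorem resFun_coe (η : ℝ) (hη : η ≠ 0) (x : ℝ) :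
    resFun η hη (x : OnePoint ℝ) = ((x : ℂ) - η * Complex.I)⁻¹ := rfl

theorem resFun_infty (η : ℝ) (hη : η ≠ 0) : resFun η hη OnePoint.infty = 0 := rfl

theorem norm_resFun_le {η : ℝ} (hη : η ≠ 0) : ‖resFun η hη‖ ≤ |η|⁻¹ := by
  rw [ContinuousMap.norm_le _ (by positivity)]
  intro x
  induction x using OnePoint.rec with
  | infty => rw [resFun_infty, norm_zero]; positivity
  | coe x => exact norm_ofReal_sub_mul_I_inv_le x hη

theorem resFun_sub {η η' : ℝ} (hη : η ≠ 0) (hη' : η' ≠ 0) :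
    resFun η hη - resFun η' hη' = ((η - η') * Complex.I : ℂ) • (resFun η hη * resFun η' hη') := by
  ext x
  induction x using OnePoint.rec with
  | infty => simp [resFun_infty]
  | coe x =>
    simp only [ContinuousMap.sub_apply, ContinuousMap.smul_apply, ContinuousMap.mul_apply,
      resFun_coe, smul_eq_mul]
    have h1 := ofReal_sub_mul_I_ne_zero x hη
    have h2 := ofReal_sub_mul_I_ne_zero x hη'
    rw [show ((η : ℂ) - η') * Complex.I = (x - η' * Complex.I) - (x - η * Complex.I) by ring]
    generalize (x : ℂ) - η * Complex.I = p at *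
    generalize (x : ℂ) - η' * Complex.I = q at *
    field_simp

theorem star_resFun {η : ℝ} (hη : η ≠ 0) : star (resFun η hη) = resFun (-η) (neg_ne_zero.2 hη) := by
  ext x
  induction x using OnePoint.rec with
  | infty => simp [resFun_infty]
  | coe x => simp [resFun_coe]

/-- The functions `resFun η` with `2 ≤ |η|`. -/
def resFuns : Set C(OnePoint ℝ, ℂ) := {g | ∃ (η : ℝ) (hη : η ≠ 0), 2 ≤ |η| ∧ g = resFun η hη}

/-- The span of the constants and the functions `resFun η` with `2 ≤ |η|`. -/
def resSpan : Submodule ℂ C(OnePoint ℝ, ℂ) := Submodule.span ℂ (insert 1 resFuns)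

/-- Partial fractions put products with distinct parameters into the span; a square is a limit of
such products, so only the closure is closed under multiplication. -/
theorem resFun_mul_resFun_mem {η η' : ℝ} (hη : η ≠ 0) (hη' : η' ≠ 0) (h : 2 ≤ |η|) (h' : 2 ≤ |η'|) :
    resFun η hη * resFun η' hη' ∈ resSpan.topologicalClosure := by
  have main : ∀ {a b : ℝ} (ha : a ≠ 0) (hb : b ≠ 0), 2 ≤ |a| → 2 ≤ |b| → a ≠ b →
      resFun a ha * resFun b hb ∈ resSpan := by
    intro a b ha hb h2a h2b hab
    have hne : ((a - b) * Complex.I : ℂ) ≠ 0 :=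
      mul_ne_zero (sub_ne_zero.2 (by exact_mod_cast hab)) Complex.I_ne_zero
    have e : resFun a ha * resFun b hb
        = ((a - b) * Complex.I : ℂ)⁻¹ • (resFun a ha - resFun b hb) := by
      rw [resFun_sub, smul_smul, inv_mul_cancel₀ hne, one_smul]
    rw [e]
    refine Submodule.smul_mem _ _ (Submodule.sub_mem _ ?_ ?_)
    · exact Submodule.subset_span (Set.mem_insert_of_mem _ ⟨a, ha, h2a, rfl⟩)
    · exact Submodule.subset_span (Set.mem_insert_of_mem _ ⟨b, hb, h2b, rfl⟩)
  by_cases hne : η = η'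
  · subst hne
    change _ ∈ closure (resSpan : Set C(OnePoint ℝ, ℂ))
    rw [Metric.mem_closure_iff]
    intro ε hε
    -- The parameter (1 + t)η differs from η by ε in modulus and still satisfies the lower bound 2.
    set t : ℝ := ε / |η| with ht
    have hη0 : 0 < |η| := abs_pos.2 hη
    have ht0 : 0 < t := by positivity
    have hη2 : (1 + t) * η ≠ 0 := mul_ne_zero (by positivity) hη
    have habs : |(1 + t) * η| = (1 + t) * |η| := by
      rw [abs_mul, abs_of_pos (by positivity : 0 < 1 + t)]
    have h2 : 2 ≤ |(1 + t) * η| := by rw [habs]; nlinarith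
    refine ⟨resFun η hη * resFun ((1 + t) * η) hη2, main hη hη2 h h2 ?_, ?_⟩
    · intro h3
      have : t * η = 0 := by linarith
      exact (mul_ne_zero ht0.ne' hη) this
    · rw [dist_eq_norm, ← mul_sub, resFun_sub]
      have n1 : ‖resFun η hη‖ ≤ 2⁻¹ := (norm_resFun_le hη).trans (inv_anti₀ two_pos h)
      have n2 : ‖resFun ((1 + t) * η) hη2‖ ≤ 2⁻¹ := (norm_resFun_le hη2).trans (inv_anti₀ two_pos h2)
      have n3 : ‖((η - ((1 + t) * η : ℝ)) * Complex.I : ℂ)‖ = ε := by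
        rw [norm_mul, Complex.norm_I, mul_one, ← Complex.ofReal_sub, Complex.norm_real,
          Real.norm_eq_abs, show η - (1 + t) * η = -(t * η) by ring, abs_neg, abs_mul,
          abs_of_pos ht0, ht, div_mul_cancel₀ _ hη0.ne']
      have n4 : ‖resFun η hη * resFun ((1 + t) * η) hη2‖ ≤ 2⁻¹ * 2⁻¹ :=
        (norm_mul_le _ _).trans (mul_le_mul n1 n2 (norm_nonneg _) (by norm_num))
      calc _ ≤ ‖resFun η hη‖ * ‖((η - ((1 + t) * η : ℝ)) * Complex.I : ℂ) •
            (resFun η hη * resFun ((1 + t) * η) hη2)‖ := norm_mul_le _ _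
        _ ≤ 2⁻¹ * (ε * (2⁻¹ * 2⁻¹)) := by
          rw [norm_smul, n3]; gcongr
        _ < ε := by linarith
  · exact Submodule.le_topologicalClosure _ (main hη hη' h h' hne)

theorem resFun_mul_mem {η : ℝ} (hη : η ≠ 0) (h : 2 ≤ |η|) {g : C(OnePoint ℝ, ℂ)}
    (hg : g ∈ resSpan.topologicalClosure) : resFun η hη * g ∈ resSpan.topologicalClosure := by
  have hmaps : ∀ g ∈ resSpan, resFun η hη * g ∈ resSpan.topologicalClosure := by
    intro g hg
    refine Submodule.span_induction (p := fun g _ => resFun η hη * g ∈ resSpan.topologicalClosure)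
      ?_ ?_ ?_ ?_ hg
    · intro g hg
      rcases hg with rfl | ⟨η', hη', h', rfl⟩
      · rw [mul_one]
        exact Submodule.le_topologicalClosure _
          (Submodule.subset_span (Set.mem_insert_of_mem _ ⟨η, hη, h, rfl⟩))
      · exact resFun_mul_resFun_mem hη hη' h h'
    · rw [mul_zero]; exact Submodule.zero_mem _
    · intro a b _ _ ha hb; rw [mul_add]; exact Submodule.add_mem _ ha hb
    · intro c a _ ha; rw [mul_smul_comm]; exact Submodule.smul_mem _ _ ha
  have h1 : Set.MapsTo (fun g => resFun η hη * g) (closure (resSpan : Set C(OnePoint ℝ, ℂ)))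
      (closure (resSpan.topologicalClosure : Set C(OnePoint ℝ, ℂ))) :=
    Set.MapsTo.closure hmaps (continuous_const.mul continuous_id)
  have h2 := h1 hg
  rwa [resSpan.isClosed_topologicalClosure.closure_eq] at h2

/-- Stone-Weierstrass: the closure contains the star algebra generated by the resolvent functions,
and `resFun 2` alone separates the points of the compactification. -/
theorem resSpan_topologicalClosure : resSpan.topologicalClosure = ⊤ := by
  have hstar : star resFuns = resFuns := by
    have hsub : ∀ g ∈ resFuns, star g ∈ resFuns := by
      rintro _ ⟨η, hη, h, rfl⟩
      exact ⟨-η, neg_ne_zero.2 hη, by rwa [abs_neg], star_resFun hη⟩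
    ext g
    rw [Set.mem_star]
    exact ⟨fun h => by simpa using hsub _ h, fun h => hsub g h⟩
  have hle : ∀ g ∈ StarAlgebra.adjoin ℂ resFuns, g ∈ resSpan.topologicalClosure := by
    intro g hg
    have h1 : g ∈ Algebra.adjoin ℂ resFuns := by
      have h2 : g ∈ (StarAlgebra.adjoin ℂ resFuns).toSubalgebra := hg
      rwa [StarAlgebra.adjoin_toSubalgebra, hstar, Set.union_self] at h2
    have h2 : g ∈ Submodule.span ℂ (Submonoid.closure resFuns : Set C(OnePoint ℝ, ℂ)) := by
      rw [← Algebra.adjoin_eq_span]; exact h1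
    refine (Submodule.span_le.2 ?_) h2
    intro u hu
    refine Submonoid.closure_induction_left
      (motive := fun u _ => u ∈ resSpan.topologicalClosure) ?_ ?_ hu
    · exact Submodule.le_topologicalClosure _ (Submodule.subset_span (Set.mem_insert _ _))
    · rintro _ ⟨η, hη, h, rfl⟩ v _ hv
      exact resFun_mul_mem hη h hv
  have hsep : (StarAlgebra.adjoin ℂ resFuns).SeparatesPoints := by
    intro x y hxy
    refine ⟨_, ⟨resFun 2 two_ne_zero, ?_, rfl⟩, ?_⟩
    · exact StarAlgebra.subset_adjoin ℂ _ ⟨2, two_ne_zero, by norm_num, rfl⟩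
    · beta_reduce
      induction x using OnePoint.rec with
      | infty =>
        induction y using OnePoint.rec with
        | infty => exact absurd rfl hxy
        | coe y =>
          rw [resFun_infty, resFun_coe]
          exact (inv_ne_zero (ofReal_sub_mul_I_ne_zero y two_ne_zero)).symm
      | coe x =>
        induction y using OnePoint.rec with
        | infty =>
          rw [resFun_infty, resFun_coe]
          exact inv_ne_zero (ofReal_sub_mul_I_ne_zero x two_ne_zero)
        | coe y =>
          rw [resFun_coe, resFun_coe]
          intro h
          have := inv_injective h
          refine hxy (congrArg _ ?_)
          exact_mod_cast sub_left_injective this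
  have hSW := ContinuousMap.starSubalgebra_topologicalClosure_eq_top_of_separatesPoints _ hsep
  rw [eq_top_iff]
  intro g _
  have hg : g ∈ (StarAlgebra.adjoin ℂ resFuns).topologicalClosure := by rw [hSW]; trivial
  have hg' : g ∈ closure ((StarAlgebra.adjoin ℂ resFuns : StarSubalgebra ℂ C(OnePoint ℝ, ℂ)) :
      Set C(OnePoint ℝ, ℂ)) := hg
  exact closure_minimal hle resSpan.isClosed_topologicalClosure hg'

theorem integrable_onePoint (ν : Measure ℝ) [IsProbabilityMeasure ν] (g : C(OnePoint ℝ, ℂ)) :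
    Integrable (fun x : ℝ => g (x : OnePoint ℝ)) ν :=
  Integrable.of_bound (g.continuous.comp OnePoint.continuous_coe).aestronglyMeasurable ‖g‖
    (ae_of_all _ fun x => g.norm_coe_le_norm x)

theorem norm_integral_onePoint_sub_le (ν : Measure ℝ) [IsProbabilityMeasure ν]
    (g g' : C(OnePoint ℝ, ℂ)) :
    ‖∫ x : ℝ, g (x : OnePoint ℝ) ∂ν - ∫ x : ℝ, g' (x : OnePoint ℝ) ∂ν‖ ≤ ‖g - g'‖ := by
  rw [← integral_sub (integrable_onePoint ν g) (integrable_onePoint ν g')]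
  have := norm_integral_le_of_norm_le_const (μ := ν)
    (f := fun x : ℝ => g (x : OnePoint ℝ) - g' (x : OnePoint ℝ)) (C := ‖g - g'‖)
    (ae_of_all _ fun x => (g - g').norm_coe_le_norm x)
  simpa using this

theorem tendsto_integral_onePoint {α : Type*} {l : Filter α} {ν : α → Measure ℝ}
    [∀ a, IsProbabilityMeasure (ν a)] {σ : Measure ℝ} [IsProbabilityMeasure σ]
    (h : ∀ η : ℝ, 2 ≤ η → Tendsto (fun a => ∫ x : ℝ, ((x : ℂ) - η * Complex.I)⁻¹ ∂(ν a)) l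
      (𝓝 (∫ x : ℝ, ((x : ℂ) - η * Complex.I)⁻¹ ∂σ))) (g : C(OnePoint ℝ, ℂ)) :
    Tendsto (fun a => ∫ x : ℝ, g (x : OnePoint ℝ) ∂(ν a)) l
      (𝓝 (∫ x : ℝ, g (x : OnePoint ℝ) ∂σ)) := by
  have hspan : ∀ g ∈ resSpan, Tendsto (fun a => ∫ x : ℝ, g (x : OnePoint ℝ) ∂(ν a)) l
      (𝓝 (∫ x : ℝ, g (x : OnePoint ℝ) ∂σ)) := by
    intro g hg
    refine Submodule.span_induction (p := fun g _ =>
      Tendsto (fun a => ∫ x : ℝ, g (x : OnePoint ℝ) ∂(ν a)) l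
        (𝓝 (∫ x : ℝ, g (x : OnePoint ℝ) ∂σ))) ?_ ?_ ?_ ?_ hg
    · intro g hg
      rcases hg with rfl | ⟨η, hη, h2, rfl⟩
      · simpa using tendsto_const_nhds
      · simp only [resFun_coe]
        rcases le_total 0 η with h0 | h0
        · rw [abs_of_nonneg h0] at h2
          exact h η h2
        · rw [abs_of_nonpos h0] at h2
          -- Negative parameters follow from positive ones by complex conjugation.
          have e : ∀ ρ : Measure ℝ, ∫ x : ℝ, ((x : ℂ) - η * Complex.I)⁻¹ ∂ρ
              = (starRingEnd ℂ) (∫ x : ℝ, ((x : ℂ) - (-η : ℝ) * Complex.I)⁻¹ ∂ρ) := by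
            intro ρ
            rw [← integral_conj]
            congr 1; ext x
            simp [sub_eq_add_neg]
          simp_rw [e]
          exact (Complex.continuous_conj.tendsto _).comp (h (-η) h2)
    · simpa using tendsto_const_nhds
    · intro u v _ _ hu hv
      simp only [ContinuousMap.add_apply]
      rw [integral_add (integrable_onePoint σ u) (integrable_onePoint σ v)]
      refine (hu.add hv).congr fun a => ?_
      rw [integral_add (integrable_onePoint (ν a) u) (integrable_onePoint (ν a) v)]
    · intro c u _ hu
      simp only [ContinuousMap.smul_apply, integral_smul]
      exact hu.const_smul c
  have hg : g ∈ closure (resSpan : Set C(OnePoint ℝ, ℂ)) := by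
    have : g ∈ resSpan.topologicalClosure := by rw [resSpan_topologicalClosure]; trivial
    exact this
  rw [Metric.tendsto_nhds]
  intro ε hε
  obtain ⟨u, hu, hgu⟩ := Metric.mem_closure_iff.1 hg (ε / 3) (by positivity)
  rw [dist_eq_norm] at hgu
  filter_upwards [Metric.tendsto_nhds.1 (hspan u hu) (ε / 3) (by positivity)] with a ha
  have h1 := norm_integral_onePoint_sub_le (ν a) g u
  have h2 := norm_integral_onePoint_sub_le σ g u
  rw [← dist_eq_norm] at h1 h2
  rw [dist_comm] at h2
  have h3 := dist_triangle4 (∫ x : ℝ, g (x : OnePoint ℝ) ∂(ν a)) (∫ x : ℝ, u (x : OnePoint ℝ) ∂(ν a))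
    (∫ x : ℝ, u (x : OnePoint ℝ) ∂σ) (∫ x : ℝ, g (x : OnePoint ℝ) ∂σ)
  linarith

/-! ### Bounded continuous test functions: no mass escapes to infinity -/

/-- A continuous function equal to `1` on `[-2, 2]` and vanishing outside `[-3, 3]`. -/
def cutoff (x : ℝ) : ℝ := max 0 (min 1 (3 - |x|))

theorem continuous_cutoff : Continuous cutoff := by unfold cutoff; fun_prop

theorem cutoff_nonneg (x : ℝ) : 0 ≤ cutoff x := le_max_left _ _

theorem cutoff_le_one (x : ℝ) : cutoff x ≤ 1 := max_le zero_le_one (min_le_left _ _)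

theorem cutoff_eq_one {x : ℝ} (hx : x ∈ Set.Icc (-2 : ℝ) 2) : cutoff x = 1 := by
  have : |x| ≤ 2 := abs_le.2 hx
  rw [cutoff, min_eq_left (by linarith), max_eq_right zero_le_one]

theorem cutoff_eq_zero {x : ℝ} (hx : 3 ≤ |x|) : cutoff x = 0 := by
  rw [cutoff, min_eq_right (by linarith), max_eq_left (by linarith)]

/-- A continuous function multiplied by the cutoff, extended by `0` at infinity. -/
def cutoffMul (f : C(ℝ, ℝ)) : C(OnePoint ℝ, ℂ) :=
  OnePoint.continuousMapMk
    ⟨fun x : ℝ => ((f x * cutoff x : ℝ) : ℂ),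
      Complex.continuous_ofReal.comp (f.continuous.mul continuous_cutoff)⟩ 0 (by
    rw [coclosedCompact_eq_cocompact]
    refine tendsto_const_nhds.congr' ?_
    filter_upwards [(tendsto_norm_cocompact_atTop (E := ℝ)).eventually_ge_atTop 3] with x hx
    simp [cutoff_eq_zero hx])

/-- A bounded `f` need not extend to the compactification, but `f * cutoff` does. Taking the
constant function 1 shows that ∫ cutoff tends to the full mass 1, so what the cutoff discards is
negligible. -/
theorem tendsto_integral_of_stieltjes {α : Type*} {l : Filter α} {ν : α → Measure ℝ}
    [∀ a, IsProbabilityMeasure (ν a)] {σ : Measure ℝ} [IsProbabilityMeasure σ]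
    (hσ : ∀ᵐ x ∂σ, x ∈ Set.Icc (-2 : ℝ) 2)
    (h : ∀ η : ℝ, 2 ≤ η → Tendsto (fun a => ∫ x : ℝ, ((x : ℂ) - η * Complex.I)⁻¹ ∂(ν a)) l
      (𝓝 (∫ x : ℝ, ((x : ℂ) - η * Complex.I)⁻¹ ∂σ))) (f : ℝ →ᵇ ℝ) :
    Tendsto (fun a => ∫ x, f x ∂(ν a)) l (𝓝 (∫ x, f x ∂σ)) := by
  have hcut : ∀ g : C(ℝ, ℝ), Tendsto (fun a => ∫ x, g x * cutoff x ∂(ν a)) l (𝓝 (∫ x, g x ∂σ)) := by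
    intro g
    have h1 := tendsto_integral_onePoint h (cutoffMul g)
    have e : ∀ ρ : Measure ℝ, ∫ x : ℝ, cutoffMul g (x : OnePoint ℝ) ∂ρ
        = ((∫ x, g x * cutoff x ∂ρ : ℝ) : ℂ) := fun ρ => integral_ofReal
    simp_rw [e] at h1
    have h2 := (Complex.continuous_re.tendsto _).comp h1
    have e2 : ∫ x, g x * cutoff x ∂σ = ∫ x, g x ∂σ := by
      refine integral_congr_ae ?_
      filter_upwards [hσ] with x hx
      rw [cutoff_eq_one hx, mul_one]
    rw [e2] at h2
    exact h2
  have hf := hcut f.toContinuousMap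
  have h1 := hcut 1
  simp only [ContinuousMap.one_apply, one_mul, integral_const, probReal_univ, smul_eq_mul] at h1
  have hbd : ∀ a, ‖∫ x, f x ∂(ν a) - ∫ x, f x * cutoff x ∂(ν a)‖
      ≤ ‖f‖ * (1 - ∫ x, cutoff x ∂(ν a)) := by
    intro a
    have i1 : Integrable f (ν a) := f.integrable _
    have i2 : Integrable cutoff (ν a) :=
      Integrable.of_bound continuous_cutoff.aestronglyMeasurable 1 (ae_of_all _ fun x => by
        rw [Real.norm_of_nonneg (cutoff_nonneg x)]; exact cutoff_le_one x)
    have i3 : Integrable (fun x => f x * cutoff x) (ν a) :=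
      Integrable.of_bound (f.continuous.mul continuous_cutoff).aestronglyMeasurable ‖f‖
        (ae_of_all _ fun x => by
          rw [norm_mul, Real.norm_of_nonneg (cutoff_nonneg x)]
          exact (mul_le_of_le_one_right (norm_nonneg _) (cutoff_le_one x)).trans
            (f.norm_coe_le_norm x))
    have i4 : Integrable (fun x => ‖f‖ * (1 - cutoff x)) (ν a) :=
      ((integrable_const 1).sub i2).const_mul _
    rw [← integral_sub i1 i3]
    have := norm_integral_le_of_norm_le i4
      (f := fun x => f x - f x * cutoff x) (ae_of_all _ fun x => by
        rw [← mul_one_sub, norm_mul, Real.norm_of_nonneg (sub_nonneg.2 (cutoff_le_one x))]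
        exact mul_le_mul_of_nonneg_right (f.norm_coe_le_norm x)
          (sub_nonneg.2 (cutoff_le_one x)))
    refine this.trans (le_of_eq ?_)
    rw [integral_const_mul, integral_sub (integrable_const 1) i2]
    simp
  have hz : Tendsto (fun a => ∫ x, f x ∂(ν a) - ∫ x, f x * cutoff x ∂(ν a)) l (𝓝 0) := by
    refine squeeze_zero_norm hbd ?_
    have := (h1.const_sub 1).const_mul ‖f‖
    simpa using this
  have := hz.add hf
  simpa using this

theorem ae_semicircle_mem_Icc : ∀ᵐ x ∂semicircle, x ∈ Set.Icc (-2 : ℝ) 2 := by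
  rw [semicircle, ae_withDensity_iff measurable_semicircle_density.ennreal_ofReal]
  refine ae_of_all _ fun x hx => ?_
  by_contra h
  exact hx (by rw [Set.indicator_of_notMem h, ENNReal.ofReal_zero])

/-- Weak convergence to the semicircle distribution follows from convergence of Stieltjes
transforms far away from the real axis. -/
theorem tendsto_integral_semicircle {α : Type*} {l : Filter α} {ν : α → Measure ℝ}
    (hν : ∀ᶠ a in l, IsProbabilityMeasure (ν a))
    (h : ∀ η : ℝ, 2 ≤ η → Tendsto (fun a => ∫ x : ℝ, ((x : ℂ) - η * Complex.I)⁻¹ ∂(ν a)) l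
      (𝓝 (scStieltjes η))) (f : ℝ →ᵇ ℝ) :
    Tendsto (fun a => ∫ x, f x ∂(ν a)) l (𝓝 (∫ x, f x ∂semicircle)) := by
  classical
  have := isProbabilityMeasure_semicircle
  -- Only eventual normalization is available (for n = 0 the empirical distribution is the zero
  -- measure), so other indices are redefined.
  set ν' : α → Measure ℝ := fun a => if IsProbabilityMeasure (ν a) then ν a else semicircle with hν'
  have hprob : ∀ a, IsProbabilityMeasure (ν' a) := by
    intro a
    simp only [hν']
    split_ifs with ha
    · exact ha
    · exact this
  have heq : ν =ᶠ[l] ν' := by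
    filter_upwards [hν] with a ha
    simp [hν', ha]
  have hmain := tendsto_integral_of_stieltjes (ν := ν') (l := l) ae_semicircle_mem_Icc
    (fun η hη => by
      rw [stieltjes_semicircle (by linarith)]
      refine (h η hη).congr' ?_
      filter_upwards [heq] with a ha
      rw [ha]) f
  refine hmain.congr' ?_
  filter_upwards [heq] with a ha
  rw [ha]

end Weak

/-! ### Empirical spectral distributions -/

theorem isProbabilityMeasure_esd {n : ℕ} (hn : 1 ≤ n) {A : Matrix (Fin n) (Fin n) ℝ}
    (hA : A.IsHermitian) : IsProbabilityMeasure (esd hA) := by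
  constructor
  simp only [esd, Measure.smul_apply, Measure.finsetSum_apply, measure_univ, Finset.sum_const,
    Finset.card_univ, Fintype.card_fin, nsmul_eq_mul, mul_one, smul_eq_mul]
  exact ENNReal.inv_mul_cancel (by exact_mod_cast (by omega : n ≠ 0)) (ENNReal.natCast_ne_top n)

theorem stieltjes_esd {n : ℕ} {A : Matrix (Fin n) (Fin n) ℝ} (hA : A.IsHermitian) {η : ℝ}
    (hη : 0 < η) :
    ∫ x : ℝ, ((x : ℂ) - η * Complex.I)⁻¹ ∂(esd hA) = (n : ℂ)⁻¹ * ∑ i, resolv η A i i := by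
  rw [trace_resolv hη hA, esd, integral_smul_measure, integral_finsetSum_measure]
  · simp only [integral_dirac]
    simp
  · intro i _
    exact integrable_dirac (by simp)

/-- The filter on `ℕ × Ω` along which convergence means convergence in measure. -/
def inMeasureFilter {Ω : Type*} [MeasurableSpace Ω] (μ : Measure Ω) : Filter (ℕ × Ω) where
  sets := {U | Tendsto (fun n => μ {ω | (n, ω) ∉ U}) atTop (𝓝 0)}
  univ_sets := by simp
  sets_of_superset := by
    intro U V hU hUV
    exact tendsto_of_tendsto_of_tendsto_of_le_of_le tendsto_const_nhds hU (fun _ => zero_le)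
      fun n => measure_mono fun ω hω h => hω (hUV h)
  inter_sets := by
    intro U V hU hV
    have h := Tendsto.add hU hV
    rw [add_zero] at h
    refine tendsto_of_tendsto_of_tendsto_of_le_of_le tendsto_const_nhds h (fun _ => zero_le)
      fun n => ?_
    refine (measure_mono fun ω hω => ?_).trans (measure_union_le _ _)
    by_cases h1 : (n, ω) ∈ U
    · exact Or.inr fun h2 => hω ⟨h1, h2⟩
    · exact Or.inl h1

theorem eventually_inMeasureFilter {Ω : Type*} [MeasurableSpace Ω] {μ : Measure Ω}
    {p : ℕ × Ω → Prop} :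
    (∀ᶠ q in inMeasureFilter μ, p q) ↔ Tendsto (fun n => μ {ω | ¬ p (n, ω)}) atTop (𝓝 0) :=
  Iff.rfl

/-! ### The semicircle law in probability and almost surely -/

section Law

variable {Ω : Type*} [MeasurableSpace Ω] {μ : Measure Ω} [IsProbabilityMeasure μ] {β : ℝ}
  {a' : (n : ℕ) → Fin n × Fin n → Ω → ℝ}

/-- Deviations of the Stieltjes transform of the empirical spectral distribution. -/
theorem measure_stieltjes_deviation_le (hβ : 0 ≤ β) (hβ1 : β ≤ 1)
    (ha' : ∀ n, 1 ≤ n → IsCurieWeiss β (a' n) μ) {b : ℕ → ℕ}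
    (hb : ∀ n, 1 ≤ n → IsBandwidth n (b n)) {η : ℝ} (hη : 2 ≤ η) {ε : ℝ} (hε : 0 < ε) :
    ∃ C : ℝ, 0 ≤ C ∧ ∀ n, 1 ≤ n →
      μ {ω | ε ≤ dist (∫ x : ℝ, ((x : ℂ) - η * Complex.I)⁻¹ ∂(esd (bandMatrix_isHermitian a' b n ω)))
        (scStieltjes η)} ≤ ENNReal.ofReal (C * (1 / (b n : ℝ) ^ 3)) := by
  obtain ⟨C, hC, h⟩ := cwExp_norm_stieltjes_sub_le hη
  refine ⟨C / ε ^ 6, by positivity, fun n hn => ?_⟩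
  have hcw := ha' n hn
  set Φ : (Fin n × Fin n → ℝ) → ℝ := fun y =>
    ‖(n : ℂ)⁻¹ * ∑ i, bandRes η (b n) y i i - scStieltjes η‖ ^ 6 with hΦ
  have hset : {ω | ε ≤ dist (∫ x : ℝ, ((x : ℂ) - η * Complex.I)⁻¹
        ∂(esd (bandMatrix_isHermitian a' b n ω))) (scStieltjes η)}
      ⊆ {ω | ε ^ 6 ≤ Φ fun p => a' n p ω} := by
    intro ω hω
    rw [Set.mem_ofPred_eq, stieltjes_esd _ (by linarith), bandMatrix_symmetrize, dist_eq_norm] at hω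
    exact pow_le_pow_left₀ hε.le hω 6
  -- Markov's inequality for the sixth power, which yields exactly the rate b⁻³ of the summability
  -- hypothesis.
  have hM := mul_meas_ge_le_integral_of_nonneg (μ := μ) (f := fun ω => Φ fun p => a' n p ω)
    (ae_of_all _ fun ω => by positivity) (hcw.integrable Φ) (ε ^ 6)
  rw [hcw.integral_eq Φ] at hM
  have hM' := hM.trans (h n (b n) hn (hb n hn) β hβ hβ1)
  refine (measure_mono hset).trans ?_
  rw [← ofReal_measureReal]
  refine ENNReal.ofReal_le_ofReal ?_
  have hε6 : 0 < ε ^ 6 := by positivity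
  calc _ ≤ (C / (b n : ℝ) ^ 3) / ε ^ 6 := by rw [le_div_iff₀ hε6, mul_comm]; exact hM'
    _ = _ := by ring

theorem semicircleLawInProbability (hβ : 0 ≤ β) (hβ1 : β ≤ 1)
    (ha' : ∀ n, 1 ≤ n → IsCurieWeiss β (a' n) μ) {b : ℕ → ℕ}
    (hb : ∀ n, 1 ≤ n → IsBandwidth n (b n)) (hlim : Tendsto b atTop atTop) :
    SemicircleLawInProbability μ (bandMatrix (symmetrize a') b) (bandMatrix_isHermitian a' b) := by
  intro f
  have hmain := tendsto_integral_semicircle (l := inMeasureFilter μ)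
    (ν := fun q : ℕ × Ω => esd (bandMatrix_isHermitian a' b q.1 q.2)) ?_ ?_ f
  · rw [tendstoInMeasure_iff_dist]
    intro ε hε
    have h1 := eventually_inMeasureFilter.1 (Metric.tendsto_nhds.1 hmain ε hε)
    simpa only [not_lt] using h1
  · rw [eventually_inMeasureFilter]
    refine tendsto_const_nhds.congr' ?_
    filter_upwards [eventually_ge_atTop 1] with n hn
    simp [isProbabilityMeasure_esd hn]
  · intro η hη
    rw [Metric.tendsto_nhds]
    intro ε hε
    rw [eventually_inMeasureFilter]
    simp only [not_lt]
    obtain ⟨C, hC, h⟩ := measure_stieltjes_deviation_le hβ hβ1 ha' hb hη hε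
    have hz : Tendsto (fun n => ENNReal.ofReal (C * (1 / (b n : ℝ) ^ 3))) atTop (𝓝 0) := by
      have h1 : Tendsto (fun n => (b n : ℝ)) atTop atTop := tendsto_natCast_atTop_atTop.comp hlim
      have h2 : Tendsto (fun n => (b n : ℝ) ^ 3) atTop atTop :=
        (tendsto_pow_atTop (by norm_num)).comp h1
      have h3 := (h2.const_div_atTop 1).const_mul C
      have h4 := ENNReal.tendsto_ofReal h3
      simpa using h4
    refine tendsto_of_tendsto_of_tendsto_of_le_of_le' tendsto_const_nhds hz
      (Eventually.of_forall fun _ => zero_le) ?_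
    filter_upwards [eventually_ge_atTop 1] with n hn using h n hn

theorem semicircleLawAlmostSurely (hβ : 0 ≤ β) (hβ1 : β ≤ 1)
    (ha' : ∀ n, 1 ≤ n → IsCurieWeiss β (a' n) μ) {b : ℕ → ℕ}
    (hb : ∀ n, 1 ≤ n → IsBandwidth n (b n)) (hsum : Summable fun n => 1 / (b n : ℝ) ^ 3) :
    SemicircleLawAlmostSurely μ (bandMatrix (symmetrize a') b) (bandMatrix_isHermitian a' b) := by
  intro f
  -- An event along this filter holds, for almost every ω, for all large n. The null set may depend
  -- on ε, hence the countable choice ε = 1/(k + 1) below.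
  have hmain := tendsto_integral_semicircle (l := (ae μ).curry atTop)
    (ν := fun q : Ω × ℕ => esd (bandMatrix_isHermitian a' b q.2 q.1)) ?_ ?_ f
  · have h1 : ∀ k : ℕ, ∀ᵐ ω ∂μ, ∀ᶠ n in atTop,
        dist (∫ x, f x ∂(esd (bandMatrix_isHermitian a' b n ω))) (∫ x, f x ∂semicircle)
          < 1 / ((k : ℝ) + 1) := fun k =>
      eventually_curry_iff.1 (Metric.tendsto_nhds.1 hmain _ Nat.one_div_pos_of_nat)
    filter_upwards [ae_all_iff.2 h1] with ω hω
    rw [Metric.tendsto_nhds]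
    intro ε hε
    obtain ⟨k, hk⟩ := exists_nat_one_div_lt hε
    filter_upwards [hω k] with n hn using hn.trans hk
  · rw [eventually_curry_iff]
    refine ae_of_all _ fun ω => ?_
    filter_upwards [eventually_ge_atTop 1] with n hn using isProbabilityMeasure_esd hn _
  · intro η hη
    rw [Metric.tendsto_nhds]
    intro ε hε
    rw [eventually_curry_iff]
    obtain ⟨C, hC, h⟩ := measure_stieltjes_deviation_le hβ hβ1 ha' hb hη hε
    -- The condition 1 ≤ n empties the set at n = 0, where no deviation bound is available, so that
    -- Borel-Cantelli applies to all n.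
    set s : ℕ → Set Ω := fun n => {ω | 1 ≤ n ∧ ε ≤ dist (∫ x : ℝ, ((x : ℂ) - η * Complex.I)⁻¹
      ∂(esd (bandMatrix_isHermitian a' b n ω))) (scStieltjes η)} with hs
    have hμ : ∀ n, μ (s n) ≤ ENNReal.ofReal (C * (1 / (b n : ℝ) ^ 3)) := by
      intro n
      by_cases hn : 1 ≤ n
      · refine (measure_mono fun ω hω => ?_).trans (h n hn)
        exact hω.2
      · have : s n = ∅ := by ext ω; simp [hs, hn]
        rw [this, measure_empty]; exact zero_le
    have hfin : ∑' n, μ (s n) ≠ ∞ := by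
      refine ne_top_of_le_ne_top ?_ (ENNReal.tsum_le_tsum hμ)
      exact (hsum.mul_left C).tsum_ofReal_ne_top
    filter_upwards [ae_eventually_notMem hfin] with ω hω
    filter_upwards [hω, eventually_ge_atTop 1] with n hn hn1
    by_contra hcon
    exact hn ⟨hn1, not_lt.1 hcon⟩

end Law

end CurieWeissBand

end

/-! ### The main theorem -/

theorem theorem3p4 {Ω : Type*} [MeasurableSpace Ω] (μ : Measure Ω) [IsProbabilityMeasure μ]
    (β : ℝ) (hβ : 0 < β) (hβ1 : β ≤ 1)
    (a' : (n : ℕ) → Fin n × Fin n → Ω → ℝ)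
    (ha' : ∀ n, 1 ≤ n → CurieWeissBand.IsCurieWeiss β (a' n) μ) :
    CurieWeissBand.IsAlmostUncorrelated μ (1 / 2) (CurieWeissBand.symmetrize a') ∧
    (∀ b : ℕ → ℕ, (∀ n, 1 ≤ n → CurieWeissBand.IsBandwidth n (b n)) →
      (Tendsto b atTop atTop →
        CurieWeissBand.SemicircleLawInProbability μ
          (CurieWeissBand.bandMatrix (CurieWeissBand.symmetrize a') b)
          (CurieWeissBand.bandMatrix_isHermitian a' b)) ∧
      (Summable (fun n => 1 / (b n : ℝ) ^ 3) →
        CurieWeissBand.SemicircleLawAlmostSurely μ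
          (CurieWeissBand.bandMatrix (CurieWeissBand.symmetrize a') b)
          (CurieWeissBand.bandMatrix_isHermitian a' b))) ∧
    CurieWeissBand.SemicircleLawAlmostSurely μ
      (CurieWeissBand.bandMatrix (CurieWeissBand.symmetrize a') (fun n => n))
      (CurieWeissBand.bandMatrix_isHermitian a' (fun n => n)) := by

  have hfull : ∀ n : ℕ, 1 ≤ n → CurieWeissBand.IsBandwidth n n := fun n _ => Or.inr rfl
  refine ⟨CurieWeissBand.isAlmostUncorrelated_curieWeiss μ β hβ.le hβ1 a' ha',
    fun b hb => ⟨CurieWeissBand.semicircleLawInProbability hβ.le hβ1 ha' hb,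
      CurieWeissBand.semicircleLawAlmostSurely hβ.le hβ1 ha' hb⟩,
    CurieWeissBand.semicircleLawAlmostSurely hβ.le hβ1 ha' hfull ?_⟩
  exact Real.summable_one_div_nat_pow.2 (by norm_num)
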